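/- Let $M$ be a smooth manifold, $\mathcal V$ an orientable regular foliation of $M$ with tangent bundle $\mathbb V=T\mathcal V$ of rank $k$ (that is, there is a leaf-wise volume form, a nowhere vanishing $\tau\in\Gamma(\wedge^{k}\mathbb V^*)$), and $\Pi$ a $\mathcal V$-coupling Poisson structure on $M$: a Poisson bivector field such that $\mathbb H:=\Pi^\sharp(\mathbb V^0)$ satisfies $TM=\mathbb H\oplus\mathbb V$, where $\mathbb V^0\subset T^*M$ is the annihilator of $\mathbb V$ and $\langle\beta,\Pi^\sharp\alpha\rangle=\Pi(\alpha,\beta)$. Let $\gamma:TM\to\mathbb V$ be the projection along $\mathbb H$ (the connection), and let $P:=\Pi_{0,2}\in\Gamma(\wedge^2\mathbb V)$, $P(\alpha,\beta)=\Pi(\alpha\circ\gamma,\beta\circ\gamma)$, be the leaf-tangent part of $\Pi$. Write $\operatorname{Poiss}(M,\Pi)=\{X: L_X\Pi=0\}$, $\operatorname{Ham}(M,\Pi)=\{\Pi^\sharp df: f\in C^\infty(M)\}$, $H^1_\Pi(M)=\operatorname{Poiss}(M,\Pi)/\operatorname{Ham}(M,\Pi)$, and likewise for $P$; let $\operatorname{Poiss}_{\mathcal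 V}(M,P)=\operatorname{Poiss}(M,P)\cap\Gamma(\mathbb V)$. The modular class $\operatorname{Mod}(M,\Pi)\in H^1_\Pi(M)$ is the class of the modular vector field $Z^\Omega_\Pi$, $Z^\Omega_\Pi(f)=\operatorname{div}^\Omega(\Pi^\sharp df)$, for any volume form $\Omega$ on $M$. The modular class $\operatorname{Mod}(M,\mathcal V,P)\in\operatorname{Poiss}_{\mathcal V}(M,P)/\operatorname{Ham}(M,P)$ is the class of the vector field $Z^\tau_P\in\Gamma(\mathbb V)$ defined by $\mathbf i_{Z^\tau_P}\tau=-d_{\mathcal V}\mathbf i_P\tau$, for any leaf-wise volume form $\tau$ of $\mathcal V$; here $d_{\mathcal V}$ is the foliated exterior derivative and $\mathbf i_{X\wedge Y}=\mathbf i_X\circ\mathbf i_Y$. Then $P$ is a Poisson structure, so that $(M,\mathcal V,P)$ is a Poisson foliation; $M$ is orientable, and both modular classes are well defined (the modular vector fields exist, lie in $\operatorname{Poiss}(M,\Pi)$ and $\operatorname{Poiss}_{\mathcal V}(M,P)$ respectively, and their classes do not depend on $\Omega$ and $\tau$); the connection induces a well-defined linear map $$\gamma^*:H^1_\Pi(M)\to\frac{\operatorname{Poiss}_{\mathcal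 V}(M,P)}{\operatorname{Ham}(M,P)},\qquad \gamma^*[X]=[\gamma X];$$ and $$\gamma^*\big(\operatorname{Mod}(M,\Pi)\big)=\operatorname{Mod}(M,\mathcal V,P).$$ -/

import Mathlib

open scoped Manifold ContDiff
open VectorField Module

noncomputable section

namespace CouplingPoisson

/-! ### Smooth functions and vector fields -/

section

variable {E : Type*} [NormedAddCommGroup E] [NormedSpace ℝ E]
  {M : Type*} [TopologicalSpace M] [ChartedSpace E M]

/-- Smooth vector fields on `M`. -/
abbrev VField (E M : Type*) [NormedAddCommGroup E] [NormedSpace ℝ E] [TopologicalSpace M]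
    [ChartedSpace E M] [IsManifold 𝓘(ℝ, E) ∞ M] :=
  Cₛ^∞⟮𝓘(ℝ, E); E, (TangentSpace 𝓘(ℝ, E) : M → Type _)⟯

/-- Smooth real functions on `M`. -/
abbrev SFun (E M : Type*) [NormedAddCommGroup E] [NormedSpace ℝ E] [TopologicalSpace M]
    [ChartedSpace E M] :=
  C^∞⟮𝓘(ℝ, E), M; ℝ⟯

/-- The differential `df_x`, as an element of the dual of `T_x M`. -/
def dAt (E : Type*) {M : Type*} [NormedAddCommGroup E] [NormedSpace ℝ E] [TopologicalSpace M]
    [ChartedSpace E M] (f : M → ℝ) (x : M) : Dual ℝ (TangentSpace 𝓘(ℝ, E) x) :=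
  (mvfderiv 𝓘(ℝ, E) f x).toLinearMap

theorem dAt_const (c : ℝ) (x : M) : dAt E (fun _ : M ↦ c) x = 0 := by
  simp only [dAt, mvfderiv_const]; rfl

theorem dAt_add {f g : M → ℝ} (hf : ContMDiff 𝓘(ℝ, E) 𝓘(ℝ) ∞ f)
    (hg : ContMDiff 𝓘(ℝ, E) 𝓘(ℝ) ∞ g) (x : M) :
    dAt E (fun y ↦ f y + g y) x = dAt E f x + dAt E g x := by
  have h := mvfderiv_add (I := 𝓘(ℝ, E)) (x := x) (hf.mdifferentiable (by simp) x)
    (hg.mdifferentiable (by simp) x)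
  simp only [dAt]
  change ((mvfderiv 𝓘(ℝ, E) (f + g) x).toLinearMap) = _
  rw [h]; rfl

theorem dAt_smul (c : ℝ) {f : M → ℝ} (hf : ContMDiff 𝓘(ℝ, E) 𝓘(ℝ) ∞ f) (x : M) :
    dAt E (fun y ↦ c * f y) x = c • dAt E f x := by
  have h := mvfderiv_mul (I := 𝓘(ℝ, E)) (x := x) (f := fun _ ↦ c) (g := f)
    (mdifferentiableAt_const) (hf.mdifferentiable (by simp) x)
  simp only [dAt]
  change ((mvfderiv 𝓘(ℝ, E) ((fun _ ↦ c) * f) x).toLinearMap) = _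
  rw [h, mvfderiv_const]
  ext v; simp

variable [IsManifold 𝓘(ℝ, E) ∞ M]

/-- The derivative `X f` of a smooth function along a smooth vector field is smooth. -/
theorem contMDiff_dAt_apply (X : VField E M) {f : M → ℝ} (hf : ContMDiff 𝓘(ℝ, E) 𝓘(ℝ) ∞ f) :
    ContMDiff 𝓘(ℝ, E) 𝓘(ℝ) ∞ (fun x ↦ dAt E f x (X x)) := by
  have h1 := (hf.contMDiff_tangentMap (m := ∞) (by simp)).comp X.contMDiff
  exact (contMDiff_snd_tangentBundle_modelSpace ℝ 𝓘(ℝ)).comp h1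

/-- The smooth function `X f`. -/
def VField.deriv (X : VField E M) (f : SFun E M) : SFun E M :=
  ⟨fun x ↦ dAt E f x (X x), contMDiff_dAt_apply X f.contMDiff⟩

end

/-! ### Bivector fields, Poisson structures and first Poisson cohomology -/

section

variable {E : Type*} [NormedAddCommGroup E] [NormedSpace ℝ E]
  {M : Type*} [TopologicalSpace M] [ChartedSpace E M]

/-- A (not necessarily smooth) bivector field `B`, given at each point by the skew-symmetric map
`B♯ : T*M → TM`; the bivector itself is `B(α, β) = ⟨β, B♯ α⟩`. Smoothness is part of
`BivectorField.IsPoisson`. -/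
structure BivectorField (E M : Type*) [NormedAddCommGroup E] [NormedSpace ℝ E]
    [TopologicalSpace M] [ChartedSpace E M] where
  /-- The map `B♯ : T*_x M → T_x M`. -/
  sharp : ∀ x : M, Dual ℝ (TangentSpace 𝓘(ℝ, E) x) →ₗ[ℝ] TangentSpace 𝓘(ℝ, E) x
  /-- Skew-symmetry, `B(α, α) = 0`. -/
  alt : ∀ (x : M) (α : Dual ℝ (TangentSpace 𝓘(ℝ, E) x)), α (sharp x α) = 0

namespace BivectorField

variable (B : BivectorField E M)

/-- The function `B(df, dg)`. -/
def bracket (f g : M → ℝ) (x : M) : ℝ := dAt E g x (B.sharp x (dAt E f x))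

/-- The Hamiltonian vector field `B♯ df`. -/
def ham (f : M → ℝ) (x : M) : TangentSpace 𝓘(ℝ, E) x := B.sharp x (dAt E f x)

/-- `B` is a smooth Poisson bivector field: `B(df, dg)` is smooth for all smooth `f`, `g`, and the
bracket `{f, g} = B(df, dg)` satisfies the Jacobi identity (equivalently, the Schouten bracket
`[B, B]` vanishes). -/
structure IsPoisson : Prop where
  smooth : ∀ f g : SFun E M, ContMDiff 𝓘(ℝ, E) 𝓘(ℝ) ∞ (B.bracket f g)
  jacobi : ∀ (f g h : SFun E M) (x : M),
    B.bracket f (B.bracket g h) x + B.bracket g (B.bracket h f) x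
      + B.bracket h (B.bracket f g) x = 0

variable [IsManifold 𝓘(ℝ, E) ∞ M]

theorem bracket_deriv_add_left (X Y : VField E M) (f g : SFun E M) (x : M) :
    B.bracket (VField.deriv (X + Y) f) g x
      = B.bracket (VField.deriv X f) g x + B.bracket (VField.deriv Y f) g x := by
  have : (VField.deriv (X + Y) f : M → ℝ)
      = fun y ↦ VField.deriv X f y + VField.deriv Y f y := by
    funext y; exact map_add (dAt E f y) (X y) (Y y)
  simp only [bracket, this]
  rw [dAt_add (VField.deriv X f).contMDiff (VField.deriv Y f).contMDiff, map_add, map_add]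

theorem bracket_deriv_add_right (X Y : VField E M) (f g : SFun E M) (x : M) :
    B.bracket f (VField.deriv (X + Y) g) x
      = B.bracket f (VField.deriv X g) x + B.bracket f (VField.deriv Y g) x := by
  have : (VField.deriv (X + Y) g : M → ℝ)
      = fun y ↦ VField.deriv X g y + VField.deriv Y g y := by
    funext y; exact map_add (dAt E g y) (X y) (Y y)
  simp only [bracket, this]
  rw [dAt_add (VField.deriv X g).contMDiff (VField.deriv Y g).contMDiff, LinearMap.add_apply]

theorem bracket_deriv_smul_left (c : ℝ) (X : VField E M) (f g : SFun E M) (x : M) :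
    B.bracket (VField.deriv (c • X) f) g x = c * B.bracket (VField.deriv X f) g x := by
  have : (VField.deriv (c • X) f : M → ℝ) = fun y ↦ c * VField.deriv X f y := by
    funext y; exact map_smul (dAt E f y) c (X y)
  simp only [bracket, this]
  rw [dAt_smul c (VField.deriv X f).contMDiff, map_smul, map_smul, smul_eq_mul]

theorem bracket_deriv_smul_right (c : ℝ) (X : VField E M) (f g : SFun E M) (x : M) :
    B.bracket f (VField.deriv (c • X) g) x = c * B.bracket f (VField.deriv X g) x := by
  have : (VField.deriv (c • X) g : M → ℝ) = fun y ↦ c * VField.deriv X g y := by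
    funext y; exact map_smul (dAt E g y) c (X y)
  simp only [bracket, this]
  rw [dAt_smul c (VField.deriv X g).contMDiff, LinearMap.smul_apply, smul_eq_mul]

/-- `Poiss(M, B)`: the smooth vector fields `X` with `L_X B = 0`. The Lie derivative is evaluated on
exact 1-forms, which span `T*M`:
`(L_X B)(df, dg) = X(B(df, dg)) - B(d(X f), dg) - B(df, d(X g))`. -/
def poiss : Submodule ℝ (VField E M) where
  carrier := {X | ∀ (f g : SFun E M) (x : M),
    dAt E (B.bracket f g) x (X x)
      = B.bracket (VField.deriv X f) g x + B.bracket f (VField.deriv X g) x}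
  add_mem' {X Y} hX hY f g x := by
    rw [bracket_deriv_add_left, bracket_deriv_add_right]
    have h := map_add (dAt E (B.bracket f g) x) (X x) (Y x)
    rw [hX f g x, hY f g x] at h
    exact h.trans (by ring)
  zero_mem' f g x := by
    have h1 := B.bracket_deriv_smul_left 0 (0 : VField E M) f g x
    have h2 := B.bracket_deriv_smul_right 0 (0 : VField E M) f g x
    rw [smul_zero, zero_mul] at h1 h2
    rw [h1, h2, add_zero]
    exact map_zero (dAt E (B.bracket f g) x)
  smul_mem' c X hX f g x := by
    rw [bracket_deriv_smul_left, bracket_deriv_smul_right, ← mul_add, ← hX f g x]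
    exact map_smul (dAt E (B.bracket f g) x) c (X x)

/-- `Ham(M, B)`: the vector fields `B♯ df` with `f` a smooth function. -/
def hamFields : Submodule ℝ (VField E M) where
  carrier := {X | ∃ f : SFun E M, ∀ x, X x = B.ham f x}
  add_mem' := by
    rintro X Y ⟨f, hf⟩ ⟨g, hg⟩
    refine ⟨f + g, fun x ↦ ?_⟩
    have h := dAt_add (x := x) f.contMDiff g.contMDiff
    change X x + Y x = B.sharp x (dAt E (fun y ↦ f y + g y) x)
    rw [h, map_add, hf x, hg x]; rfl
  zero_mem' := by
    refine ⟨0, fun x ↦ ?_⟩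
    change (0 : TangentSpace 𝓘(ℝ, E) x) = B.sharp x (dAt E (fun _ ↦ (0 : ℝ)) x)
    rw [dAt_const, map_zero]
  smul_mem' := by
    rintro c X ⟨f, hf⟩
    refine ⟨c • f, fun x ↦ ?_⟩
    have h := dAt_smul (x := x) c f.contMDiff
    change c • X x = B.sharp x (dAt E (fun y ↦ c * f y) x)
    rw [h, map_smul, hf x]; rfl

/-- The first Poisson cohomology `H¹_B(M) = Poiss(M, B) / Ham(M, B)`. -/
abbrev H1 : Type _ := B.poiss ⧸ B.hamFields.submoduleOf B.poiss

/-- The class in `H¹_B(M)` of a Poisson vector field. -/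
def H1.mk (X : B.poiss) : B.H1 := (B.hamFields.submoduleOf B.poiss).mkQ X

end BivectorField

end

/-! ### Volume forms, divergence and the modular class of a Poisson manifold -/

section

variable {E : Type*} [NormedAddCommGroup E] [NormedSpace ℝ E]
  {M : Type*} [TopologicalSpace M] [ChartedSpace E M] [IsManifold 𝓘(ℝ, E) ∞ M]

/-- A field of forms of top degree on `M`. -/
abbrev TopForm (E M : Type*) [NormedAddCommGroup E] [NormedSpace ℝ E] [TopologicalSpace M]
    [ChartedSpace E M] :=
  ∀ x : M, (TangentSpace 𝓘(ℝ, E) x) [⋀^Fin (finrank ℝ E)]→ₗ[ℝ] ℝ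

/-- `Ω` is a volume form: a smooth nowhere vanishing form of top degree. -/
structure IsVolumeForm (Ω : TopForm E M) : Prop where
  smooth : ∀ X : Fin (finrank ℝ E) → VField E M,
    ContMDiff 𝓘(ℝ, E) 𝓘(ℝ) ∞ (fun x ↦ Ω x (fun i ↦ X i x))
  ne_zero : ∀ x, Ω x ≠ 0

/-- The Lie derivative `L_X Ω`, evaluated on vector fields:
`(L_X Ω)(Y₁, …, Yₙ) = X(Ω(Y₁, …, Yₙ)) - ∑ᵢ Ω(Y₁, …, [X, Yᵢ], …, Yₙ)`. -/
def lieDerivTop (Ω : TopForm E M) (X : ∀ x : M, TangentSpace 𝓘(ℝ, E) x)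
    (Y : Fin (finrank ℝ E) → VField E M) (x : M) : ℝ :=
  dAt E (fun y ↦ Ω y (fun i ↦ Y i y)) x (X x)
    - ∑ i, Ω x (Function.update (fun j ↦ Y j x) i (mlieBracket 𝓘(ℝ, E) X (Y i) x))

/-- `h` is the divergence of `X` with respect to `Ω`, that is, `L_X Ω = h Ω`. -/
def IsDivergence (Ω : TopForm E M) (X : ∀ x : M, TangentSpace 𝓘(ℝ, E) x) (h : M → ℝ) : Prop :=
  ∀ (Y : Fin (finrank ℝ E) → VField E M) (x : M),
    lieDerivTop Ω X Y x = h x * Ω x (fun i ↦ Y i x)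

/-- `Z` is the modular vector field of `(M, B)` with respect to the volume form `Ω`:
`Z(f) = div^Ω (B♯ df)` for every smooth `f`. -/
def IsModularField (B : BivectorField E M) (Ω : TopForm E M) (Z : VField E M) : Prop :=
  ∀ f : SFun E M, IsDivergence Ω (B.ham f) (VField.deriv Z f)

/-- `m` is the modular class `Mod(M, B)`: volume forms exist on `M`, and for each of them the
modular vector field exists, is a Poisson vector field, and represents `m`. -/
structure IsModularClass (B : BivectorField E M) (m : B.H1) : Prop where
  orientable : ∃ Ω : TopForm E M, IsVolumeForm Ω
  eq_class : ∀ Ω : TopForm E M, IsVolumeForm Ω →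
    ∃ Z : B.poiss, IsModularField B Ω Z ∧ BivectorField.H1.mk B Z = m

end

/-! ### Regular foliations -/

section

/-- A regular foliation of rank `k`, given by its tangent distribution `𝕍`: every point has a
foliated chart, in which `𝕍` becomes the constant distribution parallel to a fixed `k`-dimensional
subspace `F`. (The plaques are the slices parallel to `F`, and the leaves are the maximal
connected integral submanifolds of `𝕍`.) -/
structure RegularFoliation (E M : Type*) [NormedAddCommGroup E] [NormedSpace ℝ E]
    [TopologicalSpace M] [ChartedSpace E M] (k : ℕ) where
  /-- The tangent spaces `𝕍_x` of the leaves. -/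
  tangent : ∀ x : M, Submodule ℝ (TangentSpace 𝓘(ℝ, E) x)
  /-- Foliated charts. -/
  exists_chart : ∀ x : M, ∃ φ ∈ IsManifold.maximalAtlas 𝓘(ℝ, E) ∞ M, x ∈ φ.source ∧
    ∃ F : Submodule ℝ E, finrank ℝ F = k ∧ ∀ y ∈ φ.source, ∀ v : TangentSpace 𝓘(ℝ, E) y,
      v ∈ tangent y ↔ (mfderiv 𝓘(ℝ, E) 𝓘(ℝ, E) φ y v : E) ∈ F

namespace RegularFoliation

variable {E : Type*} [NormedAddCommGroup E] [NormedSpace ℝ E] [FiniteDimensional ℝ E]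
  {M : Type*} [TopologicalSpace M] [ChartedSpace E M] [IsManifold 𝓘(ℝ, E) ∞ M]
  {k : ℕ} (𝒱 : RegularFoliation E M k)

/-- Smooth vector fields tangent to the foliation, `Γ(𝕍)`. -/
def tangentFields : Submodule ℝ (VField E M) where
  carrier := {X | ∀ x, X x ∈ 𝒱.tangent x}
  add_mem' {_ _} hX hY x := (𝒱.tangent x).add_mem (hX x) (hY x)
  zero_mem' x := (𝒱.tangent x).zero_mem
  smul_mem' c {_} hX x := (𝒱.tangent x).smul_mem c (hX x)

/-- The value at `x` of a tangent vector field, as an element of `𝕍_x`. -/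
def val (X : 𝒱.tangentFields) (x : M) : 𝒱.tangent x := ⟨(X : VField E M) x, X.2 x⟩

/-- Vector fields tangent to a foliation are closed under the Lie bracket. -/
theorem mlieBracket_mem (X Y : 𝒱.tangentFields) (x : M) :
    mlieBracket 𝓘(ℝ, E) (X : VField E M) (Y : VField E M) x ∈ 𝒱.tangent x := by
  obtain ⟨φ, hφ, hx, F, -, hF⟩ := 𝒱.exists_chart x
  have : CompleteSpace E := FiniteDimensional.complete ℝ E
  have hM2 : IsManifold 𝓘(ℝ, E) (minSmoothness ℝ 2) M := by
    simp only [minSmoothness_of_isRCLikeNormedField]; infer_instance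
  -- the derivative of the chart inverts the derivative of its inverse
  have hinv : ∀ z ∈ φ.target, ∀ v : TangentSpace 𝓘(ℝ, E) (φ.symm z),
      ((mfderiv 𝓘(ℝ, E) 𝓘(ℝ, E) φ.symm z).inverse v : E)
        = (mfderiv 𝓘(ℝ, E) 𝓘(ℝ, E) φ (φ.symm z) v : E) := by
    intro z hz v
    have hd : MDifferentiableAt 𝓘(ℝ, E) 𝓘(ℝ, E) φ (φ.symm z) :=
      (contMDiffAt_of_mem_maximalAtlas hφ (φ.map_target hz)).mdifferentiableAt (by simp)
    have hd' : MDifferentiableAt 𝓘(ℝ, E) 𝓘(ℝ, E) φ.symm z :=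
      (contMDiffAt_symm_of_mem_maximalAtlas hφ hz).mdifferentiableAt (by simp)
    have h1 : (mfderiv 𝓘(ℝ, E) 𝓘(ℝ, E) φ (φ.symm z)).comp
        (mfderiv 𝓘(ℝ, E) 𝓘(ℝ, E) φ.symm z) = ContinuousLinearMap.id ℝ E := by
      have h3 : mfderiv 𝓘(ℝ, E) 𝓘(ℝ, E) (φ ∘ φ.symm) z = mfderiv 𝓘(ℝ, E) 𝓘(ℝ, E) id z :=
        Filter.EventuallyEq.mfderiv_eq (φ.eventually_right_inverse hz)
      exact (mfderiv_comp z hd hd').symm.trans (h3.trans mfderiv_id)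
    have h2 : (mfderiv 𝓘(ℝ, E) 𝓘(ℝ, E) φ.symm z).comp
        (mfderiv 𝓘(ℝ, E) 𝓘(ℝ, E) φ (φ.symm z)) = ContinuousLinearMap.id ℝ E := by
      have hd'' : MDifferentiableAt 𝓘(ℝ, E) 𝓘(ℝ, E) φ.symm (φ (φ.symm z)) := by
        rwa [φ.right_inv hz]
      have h3 := mfderiv_comp (φ.symm z) hd'' hd
      rw [φ.right_inv hz] at h3
      have h4 : mfderiv 𝓘(ℝ, E) 𝓘(ℝ, E) (φ.symm ∘ φ) (φ.symm z)
          = mfderiv 𝓘(ℝ, E) 𝓘(ℝ, E) id (φ.symm z) :=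
        Filter.EventuallyEq.mfderiv_eq (φ.eventually_left_inverse (φ.map_target hz))
      exact h3.symm.trans (h4.trans mfderiv_id)
    exact congrArg (fun L ↦ L v) (ContinuousLinearMap.inverse_eq h2 h1)
  -- a map into `F` has its derivative in `F`
  have hder : ∀ (U : E → E) (z : E), (∀ᶠ w in nhds z, U w ∈ F) → ∀ v, fderiv ℝ U z v ∈ F := by
    intro U z hU v
    by_cases hd : DifferentiableAt ℝ U z
    · obtain ⟨G, hG⟩ := F.exists_isCompl
      let q : E →L[ℝ] G := (G.projectionOnto F hG.symm).toContinuousLinearMap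
      have hq : ∀ u, q u = 0 ↔ u ∈ F := fun u ↦ Submodule.projectionOnto_apply_eq_zero_iff _
      have h0 : (fun w ↦ q (U w)) =ᶠ[nhds z] fun _ ↦ 0 := hU.mono fun w hw ↦ (hq _).2 hw
      have h1 : HasFDerivAt (fun w ↦ q (U w)) (q.comp (fderiv ℝ U z)) z :=
        q.hasFDerivAt.comp z hd.hasFDerivAt
      have h2 : q.comp (fderiv ℝ U z) = 0 :=
        h1.fderiv.symm.trans (h0.fderiv_eq.trans (fderiv_const_apply 0))
      exact (hq _).1 (congrArg (fun L ↦ L v) h2)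
    · rw [fderiv_zero_of_not_differentiableAt hd]; exact F.zero_mem
  have hbr : ∀ (U U' : E → E) (z : E), (∀ᶠ w in nhds z, U w ∈ F) → (∀ᶠ w in nhds z, U' w ∈ F) →
      lieBracketWithin ℝ U U' Set.univ z ∈ F := by
    intro U U' z hU hU'
    rw [lieBracketWithin_univ]
    exact F.sub_mem (hder U' z hU' _) (hder U z hU _)
  have hpull : ∀ (U : 𝒱.tangentFields) (z : E), z ∈ φ.target →
      (mpullback 𝓘(ℝ, E) 𝓘(ℝ, E) φ.symm (U : VField E M) z : E) ∈ F := by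
    intro U z hz
    rw [mpullback_apply, hinv z hz]
    exact (hF _ (φ.map_target hz) _).1 (U.2 _)
  have key : ∀ z ∈ φ.target,
      mlieBracket 𝓘(ℝ, E) (X : VField E M) (Y : VField E M) (φ.symm z)
        ∈ 𝒱.tangent (φ.symm z) := by
    intro z hz
    rw [hF _ (φ.map_target hz), ← hinv z hz]
    have h := mpullback_mlieBracket (I := 𝓘(ℝ, E)) (I' := 𝓘(ℝ, E)) (n := ∞) (f := φ.symm)
      (x₀ := z) ((X : VField E M).mdifferentiableAt) ((Y : VField E M).mdifferentiableAt)
      (contMDiffAt_symm_of_mem_maximalAtlas hφ hz)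
      (by simp only [minSmoothness_of_isRCLikeNormedField]; exact ENat.LEInfty.out)
    rw [mpullback_apply] at h
    have hev : ∀ U : 𝒱.tangentFields, ∀ᶠ w in nhds z,
        (mpullback 𝓘(ℝ, E) 𝓘(ℝ, E) φ.symm (U : VField E M) w : E) ∈ F :=
      fun U ↦ Filter.eventually_of_mem (φ.open_target.mem_nhds hz) (hpull U)
    rw [h, ← mlieBracketWithin_univ, mlieBracketWithin_eq_lieBracketWithin]
    exact hbr _ _ z (hev X) (hev Y)
  have := key (φ x) (φ.map_source hx)
  rwa [φ.left_inv hx] at this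

/-- The bracket `[X, Y]` of vector fields tangent to the foliation, as an element of `𝕍_x`. -/
def lieBracket (X Y : 𝒱.tangentFields) (x : M) : 𝒱.tangent x :=
  ⟨mlieBracket 𝓘(ℝ, E) (X : VField E M) (Y : VField E M) x, 𝒱.mlieBracket_mem X Y x⟩

/-- A field of `n`-forms on `𝕍`. -/
abbrev Form (n : ℕ) := ∀ x : M, (𝒱.tangent x) [⋀^Fin n]→ₗ[ℝ] ℝ

/-- The foliated exterior derivative `d_𝒱 β` of a foliated `n`-form, evaluated on `n + 1` vector
fields tangent to the foliation:
`(d_𝒱 β)(X₀, …, Xₙ) = ∑ᵢ (-1)ⁱ Xᵢ(β(…, X̂ᵢ, …))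
  + ∑_{i < j} (-1)^{i + j} β([Xᵢ, Xⱼ], …, X̂ᵢ, …, X̂ⱼ, …)`.
In the second sum the pair of positions is `(i, j + 1)` with `i ≤ j`, whence the minus sign. -/
def extDeriv : (n : ℕ) → 𝒱.Form n → (Fin (n + 1) → 𝒱.tangentFields) → M → ℝ
  | 0, β, X, x => dAt E (fun y ↦ β y ![]) x ((X 0 : VField E M) x)
  | n + 1, β, X, x =>
    (∑ i : Fin (n + 2), (-1) ^ (i : ℕ) *
      dAt E (fun y ↦ β y (i.removeNth fun l ↦ 𝒱.val (X l) y)) x ((X i : VField E M) x))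
    - ∑ i : Fin (n + 1), ∑ j ≥ i, (-1) ^ (i + j : ℕ) *
        β x (Matrix.vecCons (𝒱.lieBracket (X i.castSucc) (X j.succ) x)
          (j.removeNth (i.castSucc.removeNth fun l ↦ 𝒱.val (X l) x)))

/-- `τ` is a leaf-wise volume form: a smooth nowhere vanishing section of `⋀^k 𝕍*`, where `k` is the
rank of `𝕍`. -/
structure IsLeafVolume (τ : 𝒱.Form k) : Prop where
  smooth : ∀ X : Fin k → 𝒱.tangentFields,
    ContMDiff 𝓘(ℝ, E) 𝓘(ℝ) ∞ (fun x ↦ τ x (fun i ↦ 𝒱.val (X i) x))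
  ne_zero : ∀ x, τ x ≠ 0

/-- The foliation is orientable: it admits a leaf-wise volume form. -/
def IsOrientable : Prop := ∃ τ : 𝒱.Form k, 𝒱.IsLeafVolume τ

end RegularFoliation

end

/-! ### Contraction of alternating forms with bivectors -/

section

variable {W : Type*} [AddCommGroup W] [Module ℝ W]

/-- For an alternating form `τ` of degree `m + 2` and vectors `w₁, …, w_m`, the map `W → W*`
sending `u` to the covector `v ↦ τ(u, v, w₁, …, w_m)`. -/
def pairing {m : ℕ} (τ : W [⋀^Fin (m + 2)]→ₗ[ℝ] ℝ) (w : Fin m → W) : W →ₗ[ℝ] Dual ℝ W :=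
  LinearMap.mk₂ ℝ (fun u v ↦ (τ.curryLeft u).curryLeft v w)
    (fun u u' v ↦ by simp) (fun c u v ↦ by simp) (fun u v v' ↦ by simp) (fun c u v ↦ by simp)

/-- The contraction `i_B τ` of an alternating form `τ` on a finite-dimensional space with a
bivector `B`, the latter given by `B♯ : W* → W`:
`(i_B τ)(w) = ½ tr (u ↦ B♯ (τ(u, ·, w)))`. For `B = X ∧ Y`, where `B♯ α = α(X) Y - α(Y) X`, this
is `i_X (i_Y τ)`, that is, `w ↦ τ(Y, X, w)`. -/
def contract (B : Dual ℝ W →ₗ[ℝ] W) {m : ℕ} (τ : W [⋀^Fin (m + 2)]→ₗ[ℝ] ℝ) :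
    W [⋀^Fin m]→ₗ[ℝ] ℝ where
  toFun w := 2⁻¹ * LinearMap.trace ℝ W (B ∘ₗ pairing τ w)
  map_update_add' w i a b := by
    have : pairing τ (Function.update w i (a + b))
        = pairing τ (Function.update w i a) + pairing τ (Function.update w i b) := by
      ext u v; exact ((τ.curryLeft u).curryLeft v).map_update_add w i a b
    rw [this, LinearMap.comp_add, map_add, mul_add]
  map_update_smul' w i c a := by
    have : pairing τ (Function.update w i (c • a))
        = c • pairing τ (Function.update w i a) := by
      ext u v; exact ((τ.curryLeft u).curryLeft v).map_update_smul w i c a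
    rw [this, LinearMap.comp_smul, map_smul, smul_eq_mul, smul_eq_mul, mul_left_comm]
  map_eq_zero_of_eq' w i j hw hij := by
    have : pairing τ w = 0 := by
      ext u v; exact ((τ.curryLeft u).curryLeft v).map_eq_zero_of_eq w hw hij
    rw [this, LinearMap.comp_zero, map_zero, mul_zero]

end

/-! ### Poisson foliations and their modular class -/

section

variable {E : Type*} [NormedAddCommGroup E] [NormedSpace ℝ E] [FiniteDimensional ℝ E]
  {M : Type*} [TopologicalSpace M] [ChartedSpace E M] [IsManifold 𝓘(ℝ, E) ∞ M]
  {k : ℕ}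

/-- A (not necessarily smooth) leaf-tangent bivector field, a section `P` of `⋀² 𝕍`, given at each
point by the skew-symmetric map `P♯ : 𝕍* → 𝕍`. -/
structure LeafBivector (𝒱 : RegularFoliation E M k) where
  /-- The map `P♯ : 𝕍_x* → 𝕍_x`. -/
  sharp : ∀ x : M, Dual ℝ (𝒱.tangent x) →ₗ[ℝ] 𝒱.tangent x
  /-- Skew-symmetry, `P(α, α) = 0`. -/
  alt : ∀ (x : M) (α : Dual ℝ (𝒱.tangent x)), α (sharp x α) = 0

namespace LeafBivector

variable {𝒱 : RegularFoliation E M k} (P : LeafBivector 𝒱)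

/-- A leaf-tangent bivector field as a bivector field on `M`: `P(α, β) = P(α|_𝕍, β|_𝕍)`. -/
def toBivectorField : BivectorField E M where
  sharp x := (𝒱.tangent x).subtype ∘ₗ P.sharp x ∘ₗ (𝒱.tangent x).subtype.dualMap
  alt x α := P.alt x ((𝒱.tangent x).subtype.dualMap α)

/-- `(M, 𝒱, P)` is a Poisson foliation: the leaf-tangent bivector field `P` is Poisson. -/
def IsPoissonFoliation : Prop := P.toBivectorField.IsPoisson

/-- `Poiss_𝒱(M, P)`: the Poisson vector fields of `P` that are tangent to the foliation. -/
def poiss : Submodule ℝ (VField E M) := P.toBivectorField.poiss ⊓ 𝒱.tangentFields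

/-- A field in `Poiss_𝒱(M, P)`, as a section of `𝕍`. -/
def toTangent (Z : P.poiss) : 𝒱.tangentFields := ⟨Z.1, Z.2.2⟩

/-- The first cohomology `Poiss_𝒱(M, P) / Ham(M, P)` of the Poisson foliation. -/
abbrev H1 : Type _ := P.poiss ⧸ P.toBivectorField.hamFields.submoduleOf P.poiss

/-- The class in the first cohomology of the Poisson foliation of a field in
`Poiss_𝒱(M, P)`. -/
def H1.mk (X : P.poiss) : P.H1 := (P.toBivectorField.hamFields.submoduleOf P.poiss).mkQ X

/-- The relation `i_Z τ = - d_𝒱 (i_P τ)` between a foliated `n`-form `τ` and a section `Z` of `𝕍`.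
Here `i_P τ = 0` if `n < 2`, and both sides vanish if `n = 0`. -/
def ModularRelation : (n : ℕ) → 𝒱.Form n → 𝒱.tangentFields → Prop
  | 0, _, _ => True
  | 1, τ, Z => ∀ x, τ x ![𝒱.val Z x] = 0
  | m + 2, τ, Z => ∀ (X : Fin (m + 1) → 𝒱.tangentFields) (x : M),
      τ x (Matrix.vecCons (𝒱.val Z x) fun i ↦ 𝒱.val (X i) x)
        = - 𝒱.extDeriv m (fun y ↦ contract (P.sharp y) (τ y)) X x

/-- `Z` is the modular vector field of the Poisson foliation with respect to the leaf-wise volume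
form `τ`: the section of `𝕍` with `i_Z τ = - d_𝒱 (i_P τ)`. -/
def IsModularField (τ : 𝒱.Form k) (Z : 𝒱.tangentFields) : Prop := P.ModularRelation k τ Z

/-- `m` is the modular class `Mod(M, 𝒱, P)`: leaf-wise volume forms exist, and for each of them the
modular vector field exists, belongs to `Poiss_𝒱(M, P)`, and represents `m`. -/
structure IsModularClass (m : P.H1) : Prop where
  orientable : 𝒱.IsOrientable
  eq_class : ∀ τ : 𝒱.Form k, 𝒱.IsLeafVolume τ →
    ∃ Z : P.poiss, P.IsModularField τ (P.toTangent Z) ∧ H1.mk P Z = m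

end LeafBivector

/-! ### Coupling Poisson structures -/

/-- The distribution `ℍ = B♯(𝕍⁰)`, where `𝕍⁰` is the annihilator of `𝕍`. -/
def horizontal (𝒱 : RegularFoliation E M k) (B : BivectorField E M) (x : M) :
    Submodule ℝ (TangentSpace 𝓘(ℝ, E) x) :=
  (𝒱.tangent x).dualAnnihilator.map (B.sharp x)

/-- `B` is a `𝒱`-coupling Poisson structure: a Poisson bivector field for which `ℍ = B♯(𝕍⁰)` is a
normal bundle of the foliation, `TM = ℍ ⊕ 𝕍`. -/
structure IsCoupling (𝒱 : RegularFoliation E M k) (B : BivectorField E M) : Prop where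
  poisson : B.IsPoisson
  isCompl : ∀ x, IsCompl (𝒱.tangent x) (horizontal 𝒱 B x)

namespace IsCoupling

variable {𝒱 : RegularFoliation E M k} {B : BivectorField E M} (h : IsCoupling 𝒱 B)

/-- The connection form `γ : TM → 𝕍`, the projection onto `𝕍` along `ℍ`. -/
def connection (x : M) : TangentSpace 𝓘(ℝ, E) x →ₗ[ℝ] 𝒱.tangent x :=
  (𝒱.tangent x).projectionOnto (horizontal 𝒱 B x) (h.isCompl x)

/-- The component `P = B_{0,2}` of `B` in `⋀² 𝕍` with respect to `TM = ℍ ⊕ 𝕍`: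
`P(α, β) = B(α ∘ γ, β ∘ γ)`. -/
def leafPart : LeafBivector 𝒱 where
  sharp x := h.connection x ∘ₗ B.sharp x ∘ₗ (h.connection x).dualMap
  alt x α := B.alt x ((h.connection x).dualMap α)

/-- The linear map `g` on cohomology is induced by the connection: `γ` maps every Poisson vector
field `X` of `B` to a field `γ X` in `Poiss_𝒱(M, P)`, and `g [X] = [γ X]`. -/
def IsInducedByConnection (g : B.H1 →ₗ[ℝ] h.leafPart.H1) : Prop :=
  ∀ X : B.poiss, ∃ Y : h.leafPart.poiss,
    (∀ x, (Y : VField E M) x = (h.connection x ((X : VField E M) x) : TangentSpace 𝓘(ℝ, E) x)) ∧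
      g (BivectorField.H1.mk B X) = LeafBivector.H1.mk h.leafPart Y

end IsCoupling

end

end CouplingPoisson

end

/-! Write `n` for the dimension of `M`, and let `b : TM → 𝕍⁰` invert `Π♯` on the annihilator: `b`
vanishes on `𝕍` and `Π♯ ∘ b = id - γ`. It is a skew form with kernel `𝕍`, so its rank `n - k` is an
even number `2s`. For a leaf-wise volume form `τ`, the form `Ω = b^s ∧ γ^*τ` is therefore a volume
form on `M` (`isVolumeForm_couplingVolume`); in particular `M` is orientable. The heart of the
matter is that for this `Ω` the equality `γ(Z^Ω_Π) = Z^τ_P` holds exactly, not only up to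
Hamiltonian fields (`isModularField_verticalPart`).

The rest is then formal. Modular fields of two volume forms on `M` differ by a Hamiltonian field, so
they all lie in one class. Every `τ` has its own `Ω`, so every `Z^τ_P` represents the image of that
class under `γ*`. This gives existence of the leaf-wise modular class, its independence of `τ` and
the formula at the same time.

The equality is local and is checked in a foliated chart, where `𝕍` is a fixed subspace `F`. For a
constant covector `α`, the number `α(Z^Ω_Π)` is the divergence of the field `Π♯α`: the trace of its
derivative plus the derivative of the logarithm of the density of `Ω`. As `Π` has no mixed
component, `P♯α = Π♯(α ∘ γ)` (`conn_sharp_conn`), and differentiating the factor `γ` adds to the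
trace for `P` the number `tr T`, where `T v = Π♯(α ∘ Dγ(v))`. So the log-density of `Ω` has to grow
along `P♯α` by `tr T` more than that of `τ` (`conn_modelModular`). Indeed, by the Jacobi identity
(`fderiv_flat`) the derivative of the pair `(b, γ)` along `P♯α` is the infinitesimal action of an
endomorphism with trace `tr T`, and a top-degree form built naturally from `(b, γ)` is then
multiplied by that trace (`hasDerivAt_couplingForm`, `fderiv_couplingForm`).

Three further facts are needed. The field defined by `-d i_P τ` has the same coordinate expression
(`extDeriv_contract`). Modular fields are Poisson (`poissonAt_modelModular`). Finally `γ` maps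
Poisson fields of `Π` to Poisson fields of `P`, by `L_X Π = 0` together with the Jacobi identity
applied to `b X` (`poissonAt_leafSharp`), and `Π♯df` to `P♯df`, since `γ ∘ Π♯` kills `𝕍⁰`
(`leafPart_ham`). -/

noncomputable section

namespace CouplingPoisson

/-! ### Exterior algebra of forms -/

section Forms

open AlternatingMap

variable {W : Type*} [AddCommGroup W] [Module ℝ W]

/-- Families of alternating forms of all degrees. -/
def Forms (W : Type*) [AddCommGroup W] [Module ℝ W] := ∀ m : ℕ, W [⋀^Fin m]→ₗ[ℝ] ℝ

instance : AddCommGroup (Forms W) := inferInstanceAs (AddCommGroup (∀ m, W [⋀^Fin m]→ₗ[ℝ] ℝ))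

instance : Module ℝ (Forms W) := inferInstanceAs (Module ℝ (∀ m, W [⋀^Fin m]→ₗ[ℝ] ℝ))

namespace Forms

@[ext] theorem ext {η ζ : Forms W} (h : ∀ m, η m = ζ m) : η = ζ := funext h

@[simp] theorem zero_apply (m : ℕ) : (0 : Forms W) m = 0 := rfl

@[simp] theorem add_apply (η ζ : Forms W) (m : ℕ) : (η + ζ) m = η m + ζ m := rfl

@[simp] theorem sub_apply (η ζ : Forms W) (m : ℕ) : (η - ζ) m = η m - ζ m := rfl

@[simp] theorem neg_apply (η : Forms W) (m : ℕ) : (-η) m = -η m := rfl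

@[simp] theorem smul_apply (c : ℝ) (η : Forms W) (m : ℕ) : (c • η) m = c • η m := rfl

/-- The component of degree `m`. -/
def proj (m : ℕ) : Forms W →ₗ[ℝ] W [⋀^Fin m]→ₗ[ℝ] ℝ where
  toFun η := η m
  map_add' _ _ := rfl
  map_smul' _ _ := rfl

@[simp] theorem proj_apply (m : ℕ) (η : Forms W) : proj m η = η m := rfl

end Forms

/-- Exterior multiplication by a covector, as a function. -/
def wedgeFun (a : Dual ℝ W) (η : Forms W) : Forms W := fun m ↦ match m with
  | 0 => 0
  | m + 1 => alternatizeUncurryFin (a.smulRight (η m))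

/-- Exterior multiplication by a covector. -/
def wedge : Dual ℝ W →ₗ[ℝ] Module.End ℝ (Forms W) :=
  LinearMap.mk₂ ℝ wedgeFun
    (by
      intro a b η; ext m : 1
      rcases m with _ | m
      · simp [wedgeFun]
      · ext v; simp [wedgeFun, alternatizeUncurryFin_apply, add_mul, Finset.sum_add_distrib])
    (by
      intro c a η; ext m : 1
      rcases m with _ | m
      · simp [wedgeFun]
      · ext v; simp [wedgeFun, alternatizeUncurryFin_apply, Finset.mul_sum, mul_left_comm, mul_assoc])
    (by
      intro a η ζ; ext m : 1
      rcases m with _ | m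
      · simp [wedgeFun]
      · ext v; simp [wedgeFun, alternatizeUncurryFin_apply, Finset.sum_add_distrib])
    (by
      intro c a η; ext m : 1
      rcases m with _ | m
      · simp [wedgeFun]
      · ext v; simp [wedgeFun, alternatizeUncurryFin_apply, Finset.mul_sum, mul_left_comm])

@[simp] theorem wedge_zero (a : Dual ℝ W) (η : Forms W) : wedge a η 0 = 0 := rfl

theorem wedge_succ (a : Dual ℝ W) (η : Forms W) (m : ℕ) :
    wedge a η (m + 1) = alternatizeUncurryFin (a.smulRight (η m)) := rfl

theorem wedge_succ_apply (a : Dual ℝ W) (η : Forms W) (m : ℕ) (v : Fin (m + 1) → W) :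
    wedge a η (m + 1) v = ∑ i : Fin (m + 1), (-1) ^ (i : ℕ) * (a (v i) * η m (i.removeNth v)) := by
  simp [wedge_succ, alternatizeUncurryFin_apply]

/-- In degree at least two this is the double alternatization of `a ⊗ a ⊗ η`, which is symmetric in
its first two arguments. -/
theorem wedge_wedge_self (a : Dual ℝ W) (η : Forms W) : wedge a (wedge a η) = 0 := by
  ext m : 1
  rcases m with _ | _ | m
  · rfl
  · ext v
    simp [wedge_succ_apply]
  · have h := alternatizeUncurryFin_alternatizeUncurryFinLM_comp_of_symmetric
      (f := a.smulRight (a.smulRight (η m))) (fun x y ↦ by ext v; simp; ring)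
    rw [wedge_succ, wedge_succ]
    refine Eq.trans ?_ h
    congr 1
    ext u v
    simp [alternatizeUncurryFin_apply, Finset.mul_sum, mul_left_comm]

theorem wedge_wedge_comm (a b : Dual ℝ W) (η : Forms W) :
    wedge a (wedge b η) = - wedge b (wedge a η) := by
  have h := wedge_wedge_self (a + b) η
  simp only [map_add, LinearMap.add_apply, wedge_wedge_self, zero_add, add_zero] at h
  exact eq_neg_of_add_eq_zero_left (by rw [add_comm]; exact h)

theorem removeNth_succ_cons {α : Type*} {m : ℕ} (i : Fin (m + 1)) (u : α) (v : Fin (m + 1) → α) :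
    i.succ.removeNth (Fin.cons u v : Fin (m + 2) → α) = Fin.cons u (i.removeNth v) := by
  funext j
  refine Fin.cases ?_ (fun j ↦ ?_) j
  · simp [Fin.removeNth]
  · simp [Fin.removeNth]

/-- Contraction with a vector, as a function. -/
def contrFun (u : W) (η : Forms W) : Forms W := fun m ↦ (η (m + 1)).curryLeft u

/-- Contraction with a vector. -/
def contr (u : W) : Module.End ℝ (Forms W) where
  toFun := contrFun u
  map_add' η ζ := by ext m : 1; ext v; simp [contrFun]
  map_smul' c η := by ext m : 1; ext v; simp [contrFun]

theorem contr_apply (u : W) (η : Forms W) (m : ℕ) : contr u η m = (η (m + 1)).curryLeft u := rfl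

/-- The summand of index `0` in the alternating sum gives `a u • η`; every other summand keeps `u`
inside `η` and loses one sign. -/
theorem contr_wedge (u : W) (a : Dual ℝ W) (η : Forms W) :
    contr u (wedge a η) = a u • η - wedge a (contr u η) := by
  ext m : 1
  ext v
  rw [contr_apply, curryLeft_apply_apply, wedge_succ_apply, Fin.sum_univ_succ]
  rcases m with _ | m
  · simp [Matrix.vecCons]
  · simp [wedge_succ_apply, contr_apply, Matrix.vecCons, removeNth_succ_cons, pow_succ,
      sub_eq_add_neg]

/-- Exterior multiplication (up to a factor) by a bilinear form, as a function. -/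
def wedgeTwoFun (θ : W →ₗ[ℝ] Dual ℝ W) (η : Forms W) : Forms W := fun m ↦ match m with
  | 0 => 0
  | m + 1 => alternatizeUncurryFin (Forms.proj m ∘ₗ wedge.flip η ∘ₗ θ)

/-- Exterior multiplication (up to a factor) by a bilinear form. -/
def wedgeTwo : (W →ₗ[ℝ] Dual ℝ W) →ₗ[ℝ] Module.End ℝ (Forms W) :=
  LinearMap.mk₂ ℝ wedgeTwoFun
    (by
      intro a b η; ext m : 1
      rcases m with _ | m
      · simp [wedgeTwoFun]
      · simp only [wedgeTwoFun, LinearMap.comp_add, alternatizeUncurryFin_add, Forms.add_apply])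
    (by
      intro c a η; ext m : 1
      rcases m with _ | m
      · simp [wedgeTwoFun]
      · simp only [wedgeTwoFun, LinearMap.comp_smul, alternatizeUncurryFin_smul, Forms.smul_apply])
    (by
      intro a η ζ; ext m : 1
      rcases m with _ | m
      · simp [wedgeTwoFun]
      · simp only [wedgeTwoFun, map_add, LinearMap.comp_add, LinearMap.add_comp, alternatizeUncurryFin_add,
          Forms.add_apply])
    (by
      intro c a η; ext m : 1
      rcases m with _ | m
      · simp [wedgeTwoFun]
      · simp only [wedgeTwoFun, map_smul, LinearMap.comp_smul, LinearMap.smul_comp,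
          alternatizeUncurryFin_smul, Forms.smul_apply])

@[simp] theorem wedgeTwo_zero (θ : W →ₗ[ℝ] Dual ℝ W) (η : Forms W) : wedgeTwo θ η 0 = 0 := rfl

theorem wedgeTwo_succ (θ : W →ₗ[ℝ] Dual ℝ W) (η : Forms W) (m : ℕ) :
    wedgeTwo θ η (m + 1)
      = alternatizeUncurryFin (Forms.proj m ∘ₗ wedge.flip η ∘ₗ θ) := rfl

theorem wedgeTwo_succ_apply (θ : W →ₗ[ℝ] Dual ℝ W) (η : Forms W) (m : ℕ) (v : Fin (m + 1) → W) :
    wedgeTwo θ η (m + 1) v = ∑ i : Fin (m + 1), (-1) ^ (i : ℕ) * wedge (θ (v i)) η m (i.removeNth v) := by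
  simp [wedgeTwo_succ, alternatizeUncurryFin_apply]

/-- This fixes the normalization: on a skew form `a ⊗ b - b ⊗ a` the operator is twice the product
with `a ∧ b`. The factor is harmless, since only nonvanishing and logarithmic derivatives are used.
-/
theorem wedgeTwo_smulRight (a b : Dual ℝ W) : wedgeTwo (a.smulRight b) = wedge a * wedge b := by
  ext η m v
  rcases m with _ | m
  · rfl
  · rw [wedgeTwo_succ_apply, Module.End.mul_apply, wedge_succ_apply]
    simp

/-- The contraction passes two covectors that vanish on `u`, and the two signs cancel. -/
theorem contr_wedgeTwo (u : W) (θ : W →ₗ[ℝ] Dual ℝ W) (hu : θ u = 0) (hu' : ∀ v, θ v u = 0)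
    (η : Forms W) : contr u (wedgeTwo θ η) = wedgeTwo θ (contr u η) := by
  ext m : 1
  ext v
  rw [contr_apply, curryLeft_apply_apply, wedgeTwo_succ_apply, Fin.sum_univ_succ]
  rcases m with _ | m
  · simp [Matrix.vecCons, hu]
  · rw [wedgeTwo_succ_apply]
    have h (a : Dual ℝ W) (ha : a u = 0) (w : Fin m → W) :
        wedge a η (m + 1) (Fin.cons u w) = - wedge a (contr u η) m w := by
      have := congrArg (fun ζ : Forms W ↦ ζ m w) (contr_wedge u a η)
      simpa [contr_apply, ha, Matrix.vecCons] using this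
    simp [Matrix.vecCons, hu, removeNth_succ_cons, h _ (hu' _), pow_succ]

/-- Pullback of forms. -/
def pullForms {W' : Type*} [AddCommGroup W'] [Module ℝ W'] (g : W →ₗ[ℝ] W') (η : Forms W') :
    Forms W := fun m ↦ (η m).compLinearMap g

theorem pullForms_wedge {W' : Type*} [AddCommGroup W'] [Module ℝ W'] (g : W →ₗ[ℝ] W')
    (a : Dual ℝ W') (η : Forms W') :
    pullForms g (wedge a η) = wedge (a ∘ₗ g) (pullForms g η) := by
  ext m : 1
  rcases m with _ | m
  · ext; simp [pullForms]
  · ext v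
    simp [pullForms, wedge_succ_apply]
    rfl

theorem pullForms_wedgeTwo {W' : Type*} [AddCommGroup W'] [Module ℝ W'] (g : W →ₗ[ℝ] W')
    (θ : W' →ₗ[ℝ] Dual ℝ W') (η : Forms W') :
    pullForms g (wedgeTwo θ η) = wedgeTwo (g.dualMap ∘ₗ θ ∘ₗ g) (pullForms g η) := by
  ext m : 1
  rcases m with _ | m
  · ext; simp [pullForms]
  · ext v
    have h (a : Dual ℝ W') (w : Fin m → W) : wedge a η m (g ∘ w)
        = wedge (g.dualMap a) (pullForms g η) m w :=
      congrArg (fun ζ : Forms W ↦ ζ m w) (pullForms_wedge g a η)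
    simp only [wedgeTwo_succ_apply, LinearMap.comp_apply, ← h]
    simp [pullForms, wedgeTwo_succ_apply]
    rfl

theorem pullForms_wedgeTwo_pow {W' : Type*} [AddCommGroup W'] [Module ℝ W'] (g : W →ₗ[ℝ] W')
    (θ : W' →ₗ[ℝ] Dual ℝ W') (r : ℕ) (η : Forms W') :
    pullForms g ((wedgeTwo θ ^ r) η)
      = (wedgeTwo (g.dualMap ∘ₗ θ ∘ₗ g) ^ r) (pullForms g η) := by
  induction r with
  | zero => simp
  | succ r ih => rw [pow_succ', pow_succ', Module.End.mul_apply, Module.End.mul_apply,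
      pullForms_wedgeTwo, ih]

/-! ### Powers of a skew form of given rank. -/

section Nondegenerate

variable [FiniteDimensional ℝ W]

/-- Expanded in a basis, `θ` is a sum of products of two covectors, and products of even degree
commute. -/
theorem wedgeTwo_wedge_comm (θ : W →ₗ[ℝ] Dual ℝ W) (a b : Dual ℝ W) :
    Commute (wedgeTwo θ) (wedge a * wedge b) := by
  have key : ∀ (c d : Dual ℝ W), Commute (wedge c * wedge d) (wedge a * wedge b) := by
    intro c d
    have h : ∀ c d : Dual ℝ W, wedge c * wedge d = - (wedge d * wedge c) := by
      intro c d; ext1 η; exact wedge_wedge_comm c d η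
    calc wedge c * wedge d * (wedge a * wedge b)
        = wedge c * (wedge d * wedge a) * wedge b := by simp only [mul_assoc]
      _ = - ((wedge c * wedge a) * (wedge d * wedge b)) := by rw [h d a]; simp only [neg_mul, mul_neg, mul_assoc]
      _ = wedge a * wedge c * (wedge d * wedge b) := by rw [h c a]; simp only [neg_mul, neg_neg, mul_assoc]
      _ = - (wedge a * (wedge c * wedge b) * wedge d) := by rw [h d b]; simp only [mul_neg, mul_assoc]
      _ = wedge a * wedge b * (wedge c * wedge d) := by rw [h c b]; simp only [neg_mul, mul_neg, neg_neg, mul_assoc]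
  let e := Module.finBasis ℝ W
  have hθ : θ = ∑ i, (e.coord i).smulRight (θ (e i)) := by
    refine e.ext fun i ↦ ?_
    simp [LinearMap.sum_apply, Finsupp.single_apply]
  rw [hθ, map_sum]
  refine Commute.sum_left _ _ _ fun i _ ↦ ?_
  rw [wedgeTwo_smulRight]
  exact key _ _

/-- The binomial formula, cut off after the linear term in `y`. -/
theorem add_pow_of_sq_zero {R : Type*} [Ring R] {x y : R} (h : Commute x y) (hy : y * y = 0)
    (s : ℕ) : (x + y) ^ (s + 1) = x ^ (s + 1) + (s + 1 : ℕ) • (x ^ s * y) := by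
  induction s with
  | zero => simp
  | succ s ih =>
    have h1 : x ^ s * y * x = x ^ (s + 1) * y := by rw [mul_assoc, ← h.eq, ← mul_assoc, pow_succ]
    have h2 : x ^ s * y * y = 0 := by rw [mul_assoc, hy, mul_zero]
    rw [pow_succ, ih, mul_add, add_mul, add_mul, smul_mul_assoc, smul_mul_assoc, h1, h2,
      smul_zero, ← pow_succ, add_zero, add_assoc]
    congr 1
    rw [succ_nsmul (x ^ (s + 1) * y) (s + 1)]

/-- The wedge powers of a skew form of rank `2 s`: the power `s + 1` vanishes, and the power `s`
is nonzero on forms that are killed by contractions with a complement of the kernel. -/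
theorem exists_wedgeTwo_pow (d : ℕ) : ∀ θ : W →ₗ[ℝ] Dual ℝ W, (∀ v, θ v v = 0) →
    finrank ℝ (LinearMap.range θ) = d → ∃ s, d = 2 * s ∧ wedgeTwo θ ^ (s + 1) = 0 ∧
      ∀ η : Forms W, η ≠ 0 → (∀ v, ∃ p, θ v = θ p ∧ contr p η = 0) →
        (wedgeTwo θ ^ s) η ≠ 0 := by
  induction d using Nat.strong_induction_on with
  | _ d ih =>
  intro θ hθ hd
  by_cases h0 : θ = 0
  · refine ⟨0, ?_, ?_, fun η hη _ ↦ by simpa using hη⟩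
    · rw [← hd, h0, LinearMap.range_zero, finrank_bot]
    · rw [h0, _root_.map_zero]; simp
  have hskew : ∀ u v, θ u v = - θ v u := by
    intro u v
    have := hθ (u + v)
    simp only [map_add, LinearMap.add_apply, hθ] at this
    linarith
  -- splitting off a hyperbolic pair
  have alternative : ∀ u v, θ u v = 1 → ∃ s, d = 2 * (s + 1) ∧ wedgeTwo θ ^ (s + 1 + 1) = 0 ∧
      ∀ η : Forms W, η ≠ 0 → (∀ w, ∃ p, θ w = θ p ∧ contr p η = 0) → contr u η = 0 →
        contr v η = 0 → (wedgeTwo θ ^ (s + 1)) η ≠ 0 := by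
    intro u v huv
    -- The signs make `a, b` dual to `u, v`. Removing the hyperbolic block `a ⊗ b - b ⊗ a` leaves a
    -- skew form `θ'` that has `u` and `v` in its kernel.
    set a : Dual ℝ W := - θ v with ha
    set b : Dual ℝ W := θ u with hb
    obtain ⟨θ', happ⟩ : ∃ θ' : W →ₗ[ℝ] Dual ℝ W,
        ∀ p q, θ' p q = θ p q - a p * b q + b p * a q :=
      ⟨θ - a.smulRight b + b.smulRight a, fun p q ↦ by simp⟩
    have huv' : θ u v = 1 := huv
    have hvu : θ v u = -1 := by rw [hskew, huv']
    have hau : a u = 1 := by simp [ha, hvu]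
    have hav : a v = 0 := by simp [ha, hθ]
    have hbu : b u = 0 := by simp [hb, hθ]
    have hbv : b v = 1 := by simp [hb, huv']
    have hu' : θ' u = 0 := by
      ext q; rw [happ, hau, hbu, hb]; simp
    have hv' : θ' v = 0 := by
      ext q; rw [happ, hav, hbv, ha]; simp
    have hθ0 : ∀ w, θ' w w = 0 := by
      intro w; rw [happ, hθ]; ring
    have hskew' : ∀ p q, θ' p q = - θ' q p := by
      intro p q; rw [happ, happ, hskew p q]; ring
    -- If `θ' w = 0` then `w - a(w) u - b(w) v` lies in the kernel of `θ`. The sum is direct, so the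
    -- rank drops by exactly two.
    have hker : LinearMap.ker θ' = LinearMap.ker θ ⊔ Submodule.span ℝ (Set.range ![u, v]) := by
      apply le_antisymm
      · intro w hw
        have h1 : w - (a w • u + b w • v) ∈ LinearMap.ker θ := by
          rw [LinearMap.mem_ker] at hw ⊢
          ext q
          have := congrArg (fun l ↦ l q) hw
          simp only [happ, LinearMap.zero_apply] at this
          simp only [map_sub, map_add, map_smul, LinearMap.sub_apply, LinearMap.add_apply,
            LinearMap.smul_apply, smul_eq_mul, LinearMap.zero_apply]
          have e1 : θ u q = b q := rfl
          have e2 : θ v q = - a q := by simp [ha]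
          rw [e1, e2]; linarith
        have h2 : a w • u + b w • v ∈ Submodule.span ℝ (Set.range ![u, v]) :=
          Submodule.add_mem _ (Submodule.smul_mem _ _ (Submodule.subset_span ⟨0, rfl⟩))
            (Submodule.smul_mem _ _ (Submodule.subset_span ⟨1, rfl⟩))
        have := Submodule.add_mem_sup h1 h2
        rwa [sub_add_cancel] at this
      · refine sup_le (fun w hw ↦ ?_) (Submodule.span_le.2 ?_)
        · rw [LinearMap.mem_ker] at hw ⊢
          have e1 : a w = 0 := by simp [ha, hskew v w, hw]
          have e2 : b w = 0 := by rw [hb, hskew u w, hw]; simp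
          ext q
          rw [happ, hw, e1, e2]; simp
        · rintro _ ⟨i, rfl⟩
          fin_cases i
          · exact hu'
          · exact hv'
    have hli : LinearIndependent ℝ ![u, v] := by
      rw [LinearIndependent.pair_iff]
      intro s t hst
      have h1 := congrArg a hst
      have h2 := congrArg b hst
      simp [hau, hav, hbu, hbv] at h1 h2
      exact ⟨h1, h2⟩
    have hdisj : LinearMap.ker θ ⊓ Submodule.span ℝ (Set.range ![u, v]) = ⊥ := by
      rw [eq_bot_iff]
      rintro w ⟨hw, hw'⟩
      have e1 : a w = 0 := by simp [ha, hskew v w, LinearMap.mem_ker.1 hw]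
      have e2 : b w = 0 := by rw [hb, hskew u w, LinearMap.mem_ker.1 hw]; simp
      rw [Matrix.range_cons, Matrix.range_cons, Matrix.range_empty, Set.union_empty,
        Set.singleton_union] at hw'
      obtain ⟨s, t, rfl⟩ := Submodule.mem_span_pair.1 hw'
      simp [hau, hav, hbu, hbv] at e1 e2
      simp [e1, e2]
    have hrank : finrank ℝ (LinearMap.range θ') + 2 = d := by
      have h1 := LinearMap.finrank_range_add_finrank_ker θ
      have h2 := LinearMap.finrank_range_add_finrank_ker θ'
      have h3 := Submodule.finrank_sup_add_finrank_inf_eq (LinearMap.ker θ)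
        (Submodule.span ℝ (Set.range ![u, v]))
      rw [hdisj, finrank_bot, finrank_span_eq_card hli, ← hker, Fintype.card_fin] at h3
      omega
    obtain ⟨s, hs, hpow, hne⟩ := ih _ (by omega) θ' hθ0 rfl
    have hW : wedgeTwo θ = wedgeTwo θ' + (2 : ℕ) • (wedge a * wedge b) := by
      have h1 : θ = θ' + (a.smulRight b + (-1 : ℝ) • b.smulRight a) := by
        ext p q
        simp only [LinearMap.add_apply, LinearMap.smul_apply, LinearMap.smulRight_apply, happ,
          smul_eq_mul]
        ring
      have h2 : wedge b * wedge a = - (wedge a * wedge b) := by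
        ext1 η; exact wedge_wedge_comm b a η
      have h3 := congrArg wedgeTwo h1
      rw [LinearMap.map_add, LinearMap.map_add, LinearMap.map_smul, wedgeTwo_smulRight,
        wedgeTwo_smulRight, h2, smul_neg, neg_one_smul, neg_neg] at h3
      rw [h3, two_smul]
    have hcomm : Commute (wedgeTwo θ') ((2 : ℕ) • (wedge a * wedge b)) :=
      (wedgeTwo_wedge_comm θ' a b).smul_right 2
    have hsq : ((2 : ℕ) • (wedge a * wedge b)) * ((2 : ℕ) • (wedge a * wedge b)) = 0 := by
      have h1 : wedge a * wedge b * (wedge a * wedge b) = 0 := by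
        ext1 η
        change wedge a (wedge b (wedge a (wedge b η))) = 0
        rw [wedge_wedge_comm b a, map_neg, wedge_wedge_self, neg_zero]
      rw [smul_mul_assoc, mul_smul_comm, h1, smul_zero, smul_zero]
    refine ⟨s, by omega, ?_, ?_⟩
    · rw [hW, add_pow_of_sq_zero hcomm hsq, pow_succ, hpow, zero_mul, zero_mul, smul_zero,
        add_zero]
    · intro η hη hc hu hv
      have hζ : (wedgeTwo θ' ^ s) η ≠ 0 := by
        refine hne η hη fun w ↦ ?_
        obtain ⟨p, hp, hp'⟩ := hc w
        refine ⟨p, ?_, hp'⟩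
        ext q
        have e1 : a w = a p := by simp [ha, hskew v, hp]
        have e2 : b w = b p := by simp [hb, hskew u, hp]
        rw [happ, happ, e1, e2, hp]
      have hcontr : ∀ (j : ℕ) (p : W), θ' p = 0 → contr p η = 0 →
          contr p ((wedgeTwo θ' ^ j) η) = 0 := by
        intro j p hp hp'
        induction j with
        | zero => simpa using hp'
        | succ j ihj =>
          rw [pow_succ', Module.End.mul_apply, contr_wedgeTwo p θ' hp
            (fun w ↦ by rw [hskew', hp]; simp), ihj, _root_.map_zero]
      have hcu := hcontr s u hu' hu
      have hcv := hcontr s v hv' hv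
      intro h
      rw [hW, add_pow_of_sq_zero hcomm hsq, hpow, zero_add,
        ((wedgeTwo_wedge_comm θ' a b).smul_right 2).pow_left s |>.eq] at h
      simp only [LinearMap.smul_apply, Module.End.mul_apply] at h
      have h' : wedge a (wedge b ((wedgeTwo θ' ^ s) η)) = 0 := by
        simpa [smul_smul, ← Nat.cast_smul_eq_nsmul ℝ, Nat.cast_add_one_ne_zero] using h
      -- With `ζ = θ' ^ s ∧ η` killed by `u` and `v`, contracting `a ∧ b ∧ ζ = 0` with `u` and then
      -- with `v` returns `ζ = 0`.
      have h1 := congrArg (contr u) h'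
      rw [contr_wedge, contr_wedge, hau, hbu, hcu] at h1
      have h2 := congrArg (contr v) h1
      simp only [one_smul, _root_.map_zero, zero_smul, sub_zero] at h2
      rw [contr_wedge, hbv, hcv] at h2
      simp at h2
      exact hζ h2
  have hexists : ∃ u v, θ u v = 1 := by
    obtain ⟨u, hu⟩ : ∃ u, θ u ≠ 0 := by
      by_contra! h; exact h0 (LinearMap.ext h)
    obtain ⟨v, hv⟩ : ∃ v, θ u v ≠ 0 := by
      by_contra! h; exact hu (LinearMap.ext h)
    exact ⟨u, (θ u v)⁻¹ • v, by simp [hv]⟩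
  obtain ⟨u, v, huv⟩ := hexists
  -- The exponent must be known before `η`, so the splitting is used twice: first with any
  -- hyperbolic pair, then with representatives `p, p₂` of the same covectors that kill `η`. They
  -- still satisfy `θ p p₂ = 1`, and the rank forces the same exponent.
  obtain ⟨s, hs, hpow, -⟩ := alternative u v huv
  refine ⟨s + 1, hs, hpow, fun η hη hc ↦ ?_⟩
  obtain ⟨p, hp, hp'⟩ := hc u
  obtain ⟨p₂, hp₂, hp₂'⟩ := hc v
  obtain ⟨s', hs', -, hne⟩ := alternative p p₂ (by rw [← hp, hskew, ← hp₂, ← hskew, huv])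
  obtain rfl : s' = s := by omega
  exact hne η hη hc hp' hp₂'

end Nondegenerate
end Forms

/-! ### Top-degree forms, traces and derivatives of forms -/

section TopForms

open AlternatingMap

/-- The sum is `a ∧ η` on `k + 1` vectors of a `k`-dimensional space. -/
theorem sum_wedge_top_eq_zero {W : Type*} [AddCommGroup W] [Module ℝ W] [FiniteDimensional ℝ W]
    {k : ℕ} (hk : finrank ℝ W = k) (a : Dual ℝ W) (η : W [⋀^Fin k]→ₗ[ℝ] ℝ) (v : Fin (k + 1) → W) :
    ∑ i : Fin (k + 1), (-1) ^ (i : ℕ) * (a (v i) * η (i.removeNth v)) = 0 := by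
  have h : alternatizeUncurryFin (a.smulRight η) v = 0 := by
    apply AlternatingMap.map_linearDependent
    intro h
    have := h.fintype_card_le_finrank
    simp [hk] at this
  simpa [alternatizeUncurryFin_apply] using h

variable {W : Type*} [NormedAddCommGroup W] [NormedSpace ℝ W] [FiniteDimensional ℝ W]

/-- An alternating form on a finite-dimensional space, as a continuous one. -/
def toContAlt {n : ℕ} (η : W [⋀^Fin n]→ₗ[ℝ] ℝ) : W [⋀^Fin n]→L[ℝ] ℝ :=
  { η with
    cont := by
      classical
      let e := Module.finBasis ℝ W
      have h : ∀ v : Fin n → W, η v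
          = ∑ r : Fin n → Fin (finrank ℝ W), (∏ i, e.coord (r i) (v i)) * η (fun i ↦ e (r i)) := by
        intro v
        have h1 : v = fun i ↦ ∑ j, e.coord j (v i) • e j := by
          funext i; exact (e.sum_repr (v i)).symm
        conv_lhs => rw [h1]
        have h2 := η.toMultilinearMap.map_sum (fun i j ↦ e.coord j (v i) • e j)
        refine h2.trans (Finset.sum_congr rfl fun r _ ↦ ?_)
        exact η.toMultilinearMap.map_smul_univ _ _
      have hc : ∀ j, Continuous (e.coord j) := fun j ↦ LinearMap.continuous_of_finiteDimensional _
      change Continuous fun v ↦ η v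
      rw [show (fun v ↦ η v) = _ from funext h]
      fun_prop }

@[simp] theorem toContAlt_apply {n : ℕ} (η : W [⋀^Fin n]→ₗ[ℝ] ℝ) (v : Fin n → W) :
    toContAlt η v = η v := rfl

theorem hasFDerivAt_alternating {V : Type*} [NormedAddCommGroup V] [NormedSpace ℝ V] {n : ℕ}
    (η : W [⋀^Fin n]→ₗ[ℝ] ℝ) {Y : Fin n → V → W} {Y' : Fin n → V →L[ℝ] W} {z : V}
    (h : ∀ i, HasFDerivAt (Y i) (Y' i) z) :
    HasFDerivAt (fun z ↦ η (fun i ↦ Y i z))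
      (∑ i, (toContAlt η).toContinuousLinearMap (fun i ↦ Y i z) i ∘L Y' i) z := by
  have := HasFDerivAt.continuousAlternatingMap_apply (hasFDerivAt_const (toContAlt η) z) h
  simpa using this

theorem hasDerivAt_alternating {n : ℕ}
    (η : W [⋀^Fin n]→ₗ[ℝ] ℝ) {Y : Fin n → ℝ → W} {Y' : Fin n → W} {t : ℝ}
    (h : ∀ i, HasDerivAt (Y i) (Y' i) t) :
    HasDerivAt (fun t ↦ η (fun i ↦ Y i t))
      (∑ i, η (Function.update (fun j ↦ Y j t) i (Y' i))) t := by
  have := (hasFDerivAt_alternating η (fun i ↦ (h i).hasFDerivAt)).hasDerivAt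
  simpa using this

theorem hasDerivAt_det_one_add_smul (T : W →ₗ[ℝ] W) :
    HasDerivAt (fun t : ℝ ↦ LinearMap.det (1 + t • T)) (LinearMap.trace ℝ W T) 0 := by
  classical
  let e := Module.finBasis ℝ W
  have h : ∀ t : ℝ, LinearMap.det (1 + t • T) = (1 + t • LinearMap.toMatrix e e T).det := by
    intro t
    rw [← LinearMap.det_toMatrix e, map_add, map_smul, LinearMap.toMatrix_one]
  rw [show (fun t : ℝ ↦ LinearMap.det (1 + t • T)) = _ from
    funext fun t ↦ (h t).trans (Matrix.det_one_add_smul t _), LinearMap.trace_eq_matrix_trace ℝ e]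
  set p := (Matrix.det (1 + (Polynomial.X : Polynomial ℝ) •
    (LinearMap.toMatrix e e T).map Polynomial.C)).divX.divX
  have h1 : HasDerivAt (fun t : ℝ ↦ p.eval t * t ^ 2) 0 0 := by
    have := (p.hasDerivAt 0).fun_mul (hasDerivAt_pow 2 (0 : ℝ))
    simpa using this
  have h2 : HasDerivAt (fun t : ℝ ↦ 1 + (LinearMap.toMatrix e e T).trace * t)
      (LinearMap.toMatrix e e T).trace 0 := by
    simpa using ((hasDerivAt_id (0 : ℝ)).const_mul (LinearMap.toMatrix e e T).trace).const_add 1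
  simpa using h2.fun_add h1

theorem top_comp_eq_det_mul {V : Type*} [AddCommGroup V] [Module ℝ V] {n : ℕ}
    (e : Basis (Fin n) ℝ V) (η : V [⋀^Fin n]→ₗ[ℝ] ℝ) (g : V →ₗ[ℝ] V) (v : Fin n → V) : η (fun i ↦ g (v i)) = LinearMap.det g * η v := by
  rw [η.eq_smul_basis_det e]
  simp only [AlternatingMap.smul_apply, smul_eq_mul]
  rw [show (fun i ↦ g (v i)) = g ∘ v from rfl, Basis.det_comp]
  ring

/-- Both sides are the derivative at `t = 0` of `η((1 + tT) v) = det(1 + tT) η(v)`. -/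
theorem sum_update_eq_trace_mul {n : ℕ} (e : Basis (Fin n) ℝ W) (η : W [⋀^Fin n]→ₗ[ℝ] ℝ)
    (T : W →ₗ[ℝ] W) (v : Fin n → W) :
    ∑ i, η (Function.update v i (T (v i))) = LinearMap.trace ℝ W T * η v := by
  have h1 : HasDerivAt (fun t : ℝ ↦ η (fun i ↦ v i + t • T (v i)))
      (∑ i, η (Function.update v i (T (v i)))) 0 := by
    have := hasDerivAt_alternating η (Y := fun i t ↦ v i + t • T (v i)) (Y' := fun i ↦ T (v i))
      (t := 0) (fun i ↦ by
        simpa using ((hasDerivAt_id (0 : ℝ)).smul_const (T (v i))).const_add (v i))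
    simpa using this
  have h2 := (hasDerivAt_det_one_add_smul T).mul_const (η v)
  refine h1.unique (h2.congr_of_eventuallyEq (Filter.Eventually.of_forall fun t ↦ ?_))
  have := top_comp_eq_det_mul e η (1 + t • T) v
  simpa using this

end TopForms

section Jets

variable {W : Type*} [AddCommGroup W] [Module ℝ W]

/-- `η'` is the derivative of the family of forms `η` at `0`. -/
def HasFormDeriv (η : ℝ → Forms W) (η' : Forms W) : Prop :=
  ∀ m v, HasDerivAt (fun t ↦ η t m v) (η' m v) 0

theorem HasFormDeriv.wedge {η : ℝ → Forms W} {η' : Forms W} (h : HasFormDeriv η η')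
    {a : ℝ → Dual ℝ W} {a' : Dual ℝ W} (ha : ∀ u, HasDerivAt (fun t ↦ a t u) (a' u) 0) :
    HasFormDeriv (fun t ↦ wedge (a t) (η t)) (wedge a' (η 0) + wedge (a 0) η') := by
  intro m v
  rcases m with _ | m
  · simpa using hasDerivAt_const (0 : ℝ) (0 : ℝ)
  · simp only [wedge_succ_apply, Forms.add_apply, AlternatingMap.add_apply,
      ← Finset.sum_add_distrib, ← mul_add]
    exact HasDerivAt.fun_sum fun i _ ↦ ((ha _).mul (h m _)).const_mul _

theorem HasFormDeriv.wedgeTwo {η : ℝ → Forms W} {η' : Forms W} (h : HasFormDeriv η η')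
    {θ : ℝ → W →ₗ[ℝ] Dual ℝ W} {θ' : W →ₗ[ℝ] Dual ℝ W}
    (hθ : ∀ u v, HasDerivAt (fun t ↦ θ t u v) (θ' u v) 0) :
    HasFormDeriv (fun t ↦ wedgeTwo (θ t) (η t)) (wedgeTwo θ' (η 0) + wedgeTwo (θ 0) η') := by
  intro m v
  rcases m with _ | m
  · simpa using hasDerivAt_const (0 : ℝ) (0 : ℝ)
  · simp only [wedgeTwo_succ_apply, Forms.add_apply, AlternatingMap.add_apply,
      ← Finset.sum_add_distrib, ← mul_add]
    exact HasDerivAt.fun_sum fun i _ ↦ ((h.wedge (hθ _)) m _).const_mul _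

/-- The derivative of `θ ^ r ∧ η` only depends on the `1`-jets of `θ` and `η`. -/
theorem exists_hasFormDeriv_pow {η η₂ : ℝ → Forms W} {η' : Forms W} (h : HasFormDeriv η η')
    (h₂ : HasFormDeriv η₂ η') (h0 : η 0 = η₂ 0)
    {θ θ₂ : ℝ → W →ₗ[ℝ] Dual ℝ W} {θ' : W →ₗ[ℝ] Dual ℝ W}
    (hθ : ∀ u v, HasDerivAt (fun t ↦ θ t u v) (θ' u v) 0)
    (hθ₂ : ∀ u v, HasDerivAt (fun t ↦ θ₂ t u v) (θ' u v) 0) (hθ0 : θ 0 = θ₂ 0) (r : ℕ) :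
    ∃ ζ, HasFormDeriv (fun t ↦ (CouplingPoisson.wedgeTwo (θ t) ^ r) (η t)) ζ ∧
      HasFormDeriv (fun t ↦ (CouplingPoisson.wedgeTwo (θ₂ t) ^ r) (η₂ t)) ζ := by
  induction r with
  | zero => exact ⟨η', by simpa using h, by simpa using h₂⟩
  | succ r ih =>
    obtain ⟨ζ, hζ, hζ₂⟩ := ih
    have e1 := hζ.wedgeTwo hθ
    have e2 := hζ₂.wedgeTwo hθ₂
    rw [← hθ0, ← h0] at e2
    simp only [pow_succ', Module.End.mul_apply]
    exact ⟨_, e1, e2⟩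

end Jets

/-! ### Poisson calculus on a finite-dimensional normed space -/

section Model

set_option maxSynthPendingDepth 3

variable {E : Type*} [NormedAddCommGroup E] [NormedSpace ℝ E]

/-- The tensorial Jacobi identity of a bivector field on `E` at a point. -/
def JacobiAt (B : E → (E →L[ℝ] ℝ) →L[ℝ] E) (z : E) : Prop :=
  ∀ α β δ : E →L[ℝ] ℝ, δ (fderiv ℝ B z (B z α) β) + α (fderiv ℝ B z (B z β) δ)
    + β (fderiv ℝ B z (B z δ) α) = 0

/-- The tensorial form of `L_X B = 0` at a point. -/
def PoissonAt (B : E → (E →L[ℝ] ℝ) →L[ℝ] E) (X : E → E) (z : E) : Prop :=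
  ∀ α β : E →L[ℝ] ℝ, β (fderiv ℝ B z (X z) α)
    = β (B z (α ∘L fderiv ℝ X z)) + β (fderiv ℝ X z (B z α))

/-- The bracket of functions on `E`. -/
def modelBracket (B : E → (E →L[ℝ] ℝ) →L[ℝ] E) (f g : E → ℝ) (z : E) : ℝ :=
  fderiv ℝ g z (B z (fderiv ℝ f z))

theorem skew_of_alt {B : (E →L[ℝ] ℝ) →L[ℝ] E} (h : ∀ α : E →L[ℝ] ℝ, α (B α) = 0) (α β : E →L[ℝ] ℝ) :
    β (B α) = - α (B β) := by
  have := h (α + β)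
  simp only [map_add, add_apply, h] at this
  linarith

variable {B : E → (E →L[ℝ] ℝ) →L[ℝ] E} {z : E}

theorem fderiv_alt (hB : ∀ z (α : E →L[ℝ] ℝ), α (B z α) = 0) (hd : DifferentiableAt ℝ B z) (v : E)
    (α : E →L[ℝ] ℝ) : α (fderiv ℝ B z v α) = 0 := by
  have h1 : HasFDerivAt (fun z ↦ α (B z α)) _ z :=
    α.hasFDerivAt.comp z (hd.hasFDerivAt.clm_apply (hasFDerivAt_const α z))
  have h2 : HasFDerivAt (fun z ↦ α (B z α)) (0 : E →L[ℝ] ℝ) z := by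
    simp_rw [hB]; exact hasFDerivAt_const _ _
  have := congrArg (fun L ↦ L v) (h1.unique h2)
  simpa using this

theorem fderiv_skew (hB : ∀ z (α : E →L[ℝ] ℝ), α (B z α) = 0) (hd : DifferentiableAt ℝ B z) (v : E)
    (α β : E →L[ℝ] ℝ) : β (fderiv ℝ B z v α) = - α (fderiv ℝ B z v β) :=
  skew_of_alt (fderiv_alt hB hd v) α β

theorem hasFDerivAt_modelBracket (hd : DifferentiableAt ℝ B z) {f g : E → ℝ}
    (hf : ContDiffAt ℝ 2 f z) (hg : ContDiffAt ℝ 2 g z) :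
    ∀ v, fderiv ℝ (modelBracket B f g) z v = fderiv ℝ (fderiv ℝ g) z v (B z (fderiv ℝ f z))
      + fderiv ℝ g z (fderiv ℝ B z v (fderiv ℝ f z))
      + fderiv ℝ g z (B z (fderiv ℝ (fderiv ℝ f) z v)) := by
  intro v
  have hf' : DifferentiableAt ℝ (fderiv ℝ f) z :=
    (hf.fderiv_right (m := 1) (by norm_num)).differentiableAt (by norm_num)
  have hg' : DifferentiableAt ℝ (fderiv ℝ g) z :=
    (hg.fderiv_right (m := 1) (by norm_num)).differentiableAt (by norm_num)
  have h := hg'.hasFDerivAt.clm_apply (hd.hasFDerivAt.clm_apply hf'.hasFDerivAt)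
  have h2 := congrArg (fun L ↦ L v) h.fderiv
  simp only [add_apply, ContinuousLinearMap.comp_apply,
    ContinuousLinearMap.flip_apply, map_add] at h2
  rw [show modelBracket B f g = fun z ↦ fderiv ℝ g z (B z (fderiv ℝ f z)) from rfl, h2]
  ring

theorem second_symm {f : E → ℝ} (hf : ContDiffAt ℝ 2 f z) (u v : E) :
    fderiv ℝ (fderiv ℝ f) z u v = fderiv ℝ (fderiv ℝ f) z v u :=
  (hf.isSymmSndFDerivAt (by simp)) u v

/-- The terms with second derivatives cancel in pairs, by symmetry of Hessians and skewness of `B`.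
Hence the Jacobi identity for functions depends only on their differentials and amounts to
`JacobiAt`. -/
theorem modelBracket_jacobi (hB : ∀ z (α : E →L[ℝ] ℝ), α (B z α) = 0) (hd : DifferentiableAt ℝ B z)
    {f g h : E → ℝ} (hf : ContDiffAt ℝ 2 f z) (hg : ContDiffAt ℝ 2 g z)
    (hh : ContDiffAt ℝ 2 h z) :
    modelBracket B f (modelBracket B g h) z + modelBracket B g (modelBracket B h f) z
        + modelBracket B h (modelBracket B f g) z
      = fderiv ℝ h z (fderiv ℝ B z (B z (fderiv ℝ f z)) (fderiv ℝ g z))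
        + fderiv ℝ f z (fderiv ℝ B z (B z (fderiv ℝ g z)) (fderiv ℝ h z))
        + fderiv ℝ g z (fderiv ℝ B z (B z (fderiv ℝ h z)) (fderiv ℝ f z)) := by
  have e : ∀ f g : E → ℝ, modelBracket B f g z = fderiv ℝ g z (B z (fderiv ℝ f z)) :=
    fun _ _ ↦ rfl
  rw [e f, e g, e h, hasFDerivAt_modelBracket hd hg hh, hasFDerivAt_modelBracket hd hh hf,
    hasFDerivAt_modelBracket hd hf hg]
  rw [skew_of_alt (hB z) (fderiv ℝ (fderiv ℝ g) z _) (fderiv ℝ h z),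
    skew_of_alt (hB z) (fderiv ℝ (fderiv ℝ h) z _) (fderiv ℝ f z),
    skew_of_alt (hB z) (fderiv ℝ (fderiv ℝ f) z _) (fderiv ℝ g z),
    second_symm hf (B z (fderiv ℝ g z)), second_symm hg (B z (fderiv ℝ h z)),
    second_symm hh (B z (fderiv ℝ f z))]
  ring

/-- Again the Hessians of `f` and `g` cancel, which makes `L_X B = 0` equivalent to a tensorial
identity. -/
theorem lie_modelBracket (hB : ∀ z (α : E →L[ℝ] ℝ), α (B z α) = 0) (hd : DifferentiableAt ℝ B z)
    {f g : E → ℝ} (hf : ContDiffAt ℝ 2 f z) (hg : ContDiffAt ℝ 2 g z) {X : E → E}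
    (hX : DifferentiableAt ℝ X z) :
    fderiv ℝ (modelBracket B f g) z (X z) - modelBracket B (fun z ↦ fderiv ℝ f z (X z)) g z
        - modelBracket B f (fun z ↦ fderiv ℝ g z (X z)) z
      = fderiv ℝ g z (fderiv ℝ B z (X z) (fderiv ℝ f z))
        - fderiv ℝ g z (B z (fderiv ℝ f z ∘L fderiv ℝ X z))
        - fderiv ℝ g z (fderiv ℝ X z (B z (fderiv ℝ f z))) := by
  have hD : ∀ f : E → ℝ, ContDiffAt ℝ 2 f z → fderiv ℝ (fun z ↦ fderiv ℝ f z (X z)) z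
      = fderiv ℝ (fderiv ℝ f) z (X z) + fderiv ℝ f z ∘L fderiv ℝ X z := by
    intro f hf
    have hf' : DifferentiableAt ℝ (fderiv ℝ f) z :=
      (hf.fderiv_right (m := 1) (by norm_num)).differentiableAt (by norm_num)
    rw [(hf'.hasFDerivAt.clm_apply hX.hasFDerivAt).fderiv]
    ext v
    simp [second_symm hf v, add_comm]
  rw [hasFDerivAt_modelBracket hd hf hg, modelBracket, modelBracket, hD f hf, hD g hg]
  simp only [map_add, add_apply, ContinuousLinearMap.comp_apply]
  ring

/-! ### Divergence -/

variable [FiniteDimensional ℝ E]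

/-- The trace as a continuous linear map. -/
def traceCLM (E : Type*) [NormedAddCommGroup E] [NormedSpace ℝ E] [FiniteDimensional ℝ E] :
    (E →L[ℝ] E) →L[ℝ] ℝ :=
  (LinearMap.trace ℝ E ∘ₗ ContinuousLinearMap.coeLM ℝ).toContinuousLinearMap

theorem traceCLM_apply (T : E →L[ℝ] E) : traceCLM E T = LinearMap.trace ℝ E T.toLinearMap := rfl

theorem traceCLM_comp_comm (S T : E →L[ℝ] E) : traceCLM E (S ∘L T) = traceCLM E (T ∘L S) :=
  LinearMap.trace_mul_comm ℝ S.toLinearMap T.toLinearMap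

theorem traceCLM_eq_sum (T : E →L[ℝ] E) :
    traceCLM E T = ∑ i, (finBasis ℝ E).coord i (T (finBasis ℝ E i)) := by
  rw [traceCLM_apply, LinearMap.trace_eq_matrix_trace ℝ (finBasis ℝ E), Matrix.trace]
  simp [LinearMap.toMatrix_apply]

/-- The divergence of a vector field with respect to the volume form `exp σ · vol`. -/
def modelDiv (σ : E → ℝ) (X : E → E) (z : E) : ℝ := traceCLM E (fderiv ℝ X z) + fderiv ℝ σ z (X z)

/-- The coordinates of the standard basis as continuous linear forms. -/
def coordCLM (E : Type*) [NormedAddCommGroup E] [NormedSpace ℝ E] [FiniteDimensional ℝ E]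
    (i : Fin (finrank ℝ E)) : E →L[ℝ] ℝ :=
  ((finBasis ℝ E).coord i).toContinuousLinearMap

theorem sum_coordCLM_smul (v : E) : ∑ i, coordCLM E i v • finBasis ℝ E i = v :=
  (finBasis ℝ E).sum_repr v

theorem sum_smul_coordCLM (α : E →L[ℝ] ℝ) : ∑ i, α (finBasis ℝ E i) • coordCLM E i = α := by
  ext v
  conv_rhs => rw [← sum_coordCLM_smul v]
  simp [mul_comm]

/-- The modular vector field of `B` with respect to the volume form `exp σ · vol`. -/
def modelModular (B : E → (E →L[ℝ] ℝ) →L[ℝ] E) (σ : E → ℝ) (z : E) : E :=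
  ∑ i, (traceCLM E ((fderiv ℝ B z).flip (coordCLM E i)) + fderiv ℝ σ z (B z (coordCLM E i)))
    • finBasis ℝ E i

/-- For constant `α` the right side is the divergence of the field `w ↦ B w α`. -/
theorem apply_modelModular (B : E → (E →L[ℝ] ℝ) →L[ℝ] E) (σ : E → ℝ) (z : E) (α : E →L[ℝ] ℝ) :
    α (modelModular B σ z) = traceCLM E ((fderiv ℝ B z).flip α) + fderiv ℝ σ z (B z α) := by
  conv_rhs => rw [← sum_smul_coordCLM α]
  simp [modelModular, ← Finset.sum_add_distrib, mul_comm, mul_add]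

/-- Exchanging the two summation indices changes the sign of the double sum. -/
theorem traceCLM_comp_symm {B : (E →L[ℝ] ℝ) →L[ℝ] E} (hB : ∀ α : E →L[ℝ] ℝ, α (B α) = 0)
    {H : E →L[ℝ] E →L[ℝ] ℝ} (hH : ∀ u v, H u v = H v u) : traceCLM E (B ∘L H) = 0 := by
  have h1 : traceCLM E (B ∘L H) = ∑ i, ∑ j, H (finBasis ℝ E i) (finBasis ℝ E j)
      * coordCLM E i (B (coordCLM E j)) := by
    rw [traceCLM_eq_sum]
    refine Finset.sum_congr rfl fun i _ ↦ ?_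
    change coordCLM E i (B (H (finBasis ℝ E i))) = _
    conv_lhs => rw [← sum_smul_coordCLM (H (finBasis ℝ E i))]
    simp only [map_sum, map_smul, smul_eq_mul]
  have h2 : traceCLM E (B ∘L H) = - traceCLM E (B ∘L H) := by
    conv_lhs => rw [h1, Finset.sum_comm]
    rw [h1, ← Finset.sum_neg_distrib]
    refine Finset.sum_congr rfl fun i _ ↦ ?_
    rw [← Finset.sum_neg_distrib]
    refine Finset.sum_congr rfl fun j _ ↦ ?_
    rw [skew_of_alt hB, hH]; ring
  linarith

/-- The Hessian of `f` enters only through the trace of a skew map after a symmetric one, which is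
zero. This is why `f ↦ div(B df)` is a derivation. -/
theorem modelDiv_ham (hB : ∀ z (α : E →L[ℝ] ℝ), α (B z α) = 0) (hd : DifferentiableAt ℝ B z) (σ : E → ℝ)
    {f : E → ℝ} (hf : ContDiffAt ℝ 2 f z) :
    modelDiv σ (fun z ↦ B z (fderiv ℝ f z)) z = fderiv ℝ f z (modelModular B σ z) := by
  have hf' : DifferentiableAt ℝ (fderiv ℝ f) z :=
    (hf.fderiv_right (m := 1) (by norm_num)).differentiableAt (by norm_num)
  rw [modelDiv, (hd.hasFDerivAt.clm_apply hf'.hasFDerivAt).fderiv, map_add,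
    traceCLM_comp_symm (hB z) (second_symm hf), zero_add, apply_modelModular]

theorem contDiffAt_modelModular (hB : ContDiffAt ℝ ∞ B z) {σ : E → ℝ} (hσ : ContDiffAt ℝ ∞ σ z) :
    ContDiffAt ℝ ∞ (modelModular B σ) z := by
  have h1 : ContDiffAt ℝ ∞ (fderiv ℝ B) z := hB.fderiv_right (by simp)
  have h2 : ContDiffAt ℝ ∞ (fderiv ℝ σ) z := hσ.fderiv_right (by simp)
  refine ContDiffAt.sum fun i _ ↦ ContDiffAt.smul (ContDiffAt.add ?_ ?_) contDiffAt_const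
  · let L : (E →L[ℝ] (E →L[ℝ] ℝ) →L[ℝ] E) →L[ℝ] E →L[ℝ] E :=
      (ContinuousLinearMap.apply ℝ (E →L[ℝ] E) (coordCLM E i)) ∘L
        (ContinuousLinearMap.flipₗᵢ ℝ E (E →L[ℝ] ℝ) E : _ →L[ℝ] _)
    exact ((traceCLM E ∘L L).contDiff.contDiffAt).comp z h1
  · exact h2.clm_apply (hB.clm_apply contDiffAt_const)

/-- The products of first derivatives cancel because `tr(ST) = tr(TS)`; second derivatives of `X`
and `Y` are matched by symmetry, and those of `σ` cancel. -/
theorem modelDiv_lieBracket {σ : E → ℝ} (hσ : ContDiffAt ℝ 2 σ z) {X Y : E → E}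
    (hX : ContDiffAt ℝ 2 X z) (hY : ContDiffAt ℝ 2 Y z) :
    modelDiv σ (lieBracket ℝ X Y) z
      = fderiv ℝ (modelDiv σ Y) z (X z) - fderiv ℝ (modelDiv σ X) z (Y z) := by
  have hD : ∀ {X : E → E}, ContDiffAt ℝ 2 X z → DifferentiableAt ℝ (fderiv ℝ X) z := fun hf ↦
    (hf.fderiv_right (m := 1) (by norm_num)).differentiableAt (by norm_num)
  have hσ' : DifferentiableAt ℝ (fderiv ℝ σ) z :=
    (hσ.fderiv_right (m := 1) (by norm_num)).differentiableAt (by norm_num)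
  have hX1 := (hX.differentiableAt (by norm_num)).hasFDerivAt
  have hY1 := (hY.differentiableAt (by norm_num)).hasFDerivAt
  have hX2 := (hD hX).hasFDerivAt
  have hY2 := (hD hY).hasFDerivAt
  have hdiv : ∀ {X : E → E}, ContDiffAt ℝ 2 X z → ∀ v, fderiv ℝ (modelDiv σ X) z v
      = traceCLM E (fderiv ℝ (fderiv ℝ X) z v) + fderiv ℝ (fderiv ℝ σ) z v (X z)
        + fderiv ℝ σ z (fderiv ℝ X z v) := by
    intro X hX v
    have h1 := ((traceCLM E).hasFDerivAt.comp z (hD hX).hasFDerivAt).fun_add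
      (hσ'.hasFDerivAt.clm_apply (hX.differentiableAt (by norm_num)).hasFDerivAt)
    have h2 := congrArg (fun L ↦ L v) h1.fderiv
    simp only [add_apply, ContinuousLinearMap.comp_apply,
      ContinuousLinearMap.flip_apply] at h2
    refine Eq.trans h2 ?_
    ring
  have hbr := (hY2.clm_apply hX1).fun_sub (hX2.clm_apply hY1)
  have hbr' : fderiv ℝ (lieBracket ℝ X Y) z = _ := hbr.fderiv
  have hsymm : ∀ {X : E → E}, ContDiffAt ℝ 2 X z → ∀ v,
      (fderiv ℝ (fderiv ℝ X) z).flip v = fderiv ℝ (fderiv ℝ X) z v := by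
    intro X hX v
    ext u
    exact (hX.isSymmSndFDerivAt (by simp)) u v
  rw [hdiv hY, hdiv hX, modelDiv, hbr', hsymm hX, hsymm hY, second_symm hσ (Y z) (X z)]
  simp only [lieBracket, map_sub, map_add]
  rw [traceCLM_comp_comm (fderiv ℝ Y z)]
  ring

/-- For constant covectors the Jacobi identity reads `[Bα, Bβ] = B dg` with `g = β(Bα)`. With `Z`
the modular field, the divergence of both sides gives `dg(Z) = d(βZ)(Bα) - d(αZ)(Bβ)`, which is `L_Z
B = 0` evaluated on `α, β`. -/
theorem poissonAt_modelModular (hB : ∀ z (α : E →L[ℝ] ℝ), α (B z α) = 0) (hs : ContDiffAt ℝ ∞ B z)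
    (hJ : ∀ᶠ w in nhds z, JacobiAt B w) {σ : E → ℝ} (hσ : ContDiffAt ℝ ∞ σ z) :
    PoissonAt B (modelModular B σ) z := by
  intro α β
  have hs3 : ContDiffAt ℝ 3 B z := hs.of_le ENat.LEInfty.out
  have hd : ∀ᶠ w in nhds z, DifferentiableAt ℝ B w :=
    (hs3.eventually (by simp)).mono fun w hw ↦ hw.differentiableAt (by norm_num)
  have hZ := (contDiffAt_modelModular hs hσ).differentiableAt (by simp)
  set Z := modelModular B σ with hZdef
  have hham : ∀ α : E →L[ℝ] ℝ, ContDiffAt ℝ ∞ (fun z ↦ B z α) z :=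
    fun α ↦ hs.clm_apply contDiffAt_const
  have hdivα : ∀ α : E →L[ℝ] ℝ, modelDiv σ (fun z ↦ B z α) =ᶠ[nhds z] fun z ↦ α (Z z) := by
    intro α
    filter_upwards [hd] with w hw
    have := modelDiv_ham hB hw σ (f := α) α.contDiff.contDiffAt
    simpa using this
  set g : E → ℝ := fun z ↦ β (B z α) with hg
  have hgs : ContDiffAt ℝ ∞ g z := β.contDiff.contDiffAt.comp z (hham α)
  have hgd : ∀ w, DifferentiableAt ℝ B w → ∀ v, fderiv ℝ g w v = β (fderiv ℝ B w v α) := by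
    intro w hw v
    have := (β.hasFDerivAt.comp w (hw.hasFDerivAt.clm_apply (hasFDerivAt_const α w))).fderiv
    have h2 := congrArg (fun L ↦ L v) this
    simpa [Function.comp_def] using h2
  have hbr : lieBracket ℝ (fun z ↦ B z α) (fun z ↦ B z β) =ᶠ[nhds z]
      fun z ↦ B z (fderiv ℝ g z) := by
    filter_upwards [hd, hJ] with w hw hJw
    refine (SeparatingDual.eq_iff_forall_dual_eq (R := ℝ)).2 fun δ ↦ ?_
    have hc : ∀ α : E →L[ℝ] ℝ, fderiv ℝ (fun z ↦ B z α) w = (fderiv ℝ B w).flip α := by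
      intro α
      have := (hw.hasFDerivAt.clm_apply (hasFDerivAt_const α w)).fderiv
      simpa using this
    rw [lieBracket, hc, hc, skew_of_alt (hB w), hgd w hw]
    have h1 := hJw α β δ
    have h2 := fderiv_skew hB hw (B w β) δ α
    simp only [map_sub, ContinuousLinearMap.flip_apply]
    linarith
  have h1 : modelDiv σ (lieBracket ℝ (fun z ↦ B z α) (fun z ↦ B z β)) z = fderiv ℝ g z (Z z) := by
    rw [← modelDiv_ham hB hd.self_of_nhds σ (hgs.of_le ENat.LEInfty.out), modelDiv,
      modelDiv, hbr.fderiv_eq, hbr.self_of_nhds]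
  rw [modelDiv_lieBracket (hσ.of_le ENat.LEInfty.out)
    ((hham α).of_le ENat.LEInfty.out) ((hham β).of_le ENat.LEInfty.out),
    (hdivα α).fderiv_eq, (hdivα β).fderiv_eq, hgd z hd.self_of_nhds] at h1
  have h3 : ∀ α : E →L[ℝ] ℝ, fderiv ℝ (fun z ↦ α (Z z)) z = α ∘L fderiv ℝ Z z :=
    fun α ↦ (α.hasFDerivAt.comp z hZ.hasFDerivAt).fderiv
  rw [h3, h3] at h1
  rw [← h1, skew_of_alt (hB z) (α ∘L fderiv ℝ Z z) β]
  simp only [ContinuousLinearMap.comp_apply]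
  ring

end Model

/-! ### The coupling decomposition in coordinates. -/

section CouplingModel

set_option maxSynthPendingDepth 3

variable {E : Type*} [NormedAddCommGroup E] [NormedSpace ℝ E]

/-- The algebraic relations between a bivector `B`, the connection `γ` of the coupling decomposition
along the fixed subspace `F`, and the inverse `b` of `B` on the annihilator of `F`. -/
structure CouplingAt (F : Submodule ℝ E) (B : (E →L[ℝ] ℝ) →L[ℝ] E) (γ : E →L[ℝ] E)
    (b : E →L[ℝ] E →L[ℝ] ℝ) : Prop where
  alt : ∀ α : E →L[ℝ] ℝ, α (B α) = 0
  mem : ∀ v, γ v ∈ F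
  eq_self : ∀ v ∈ F, γ v = v
  map_sharp : ∀ ξ : E →L[ℝ] ℝ, (∀ v ∈ F, ξ v = 0) → γ (B ξ) = 0
  flat_eq_zero : ∀ u, ∀ v ∈ F, b u v = 0
  sharp_flat : ∀ u, B (b u) = u - γ u

namespace CouplingAt

variable {F : Submodule ℝ E} {B : (E →L[ℝ] ℝ) →L[ℝ] E} {γ : E →L[ℝ] E}
  {b : E →L[ℝ] E →L[ℝ] ℝ}

theorem skew (h : CouplingAt F B γ b) (α β : E →L[ℝ] ℝ) : β (B α) = - α (B β) := skew_of_alt h.alt α β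

theorem flat_conn (h : CouplingAt F B γ b) (u v : E) : b u (γ v) = 0 := h.flat_eq_zero u _ (h.mem v)

theorem flat_sub (h : CouplingAt F B γ b) (u v : E) : b u (v - γ v) = b u v := by
  rw [map_sub, h.flat_conn, sub_zero]

/-- The covector `b u` only sees `v - γ v = B(b v)`, so `b u v` is a value of the skew form `B` on
the covectors `b u, b v`. -/
theorem flat_skew (h : CouplingAt F B γ b) (u v : E) : b u v = - b v u := by
  rw [← h.flat_sub u v, ← h.sharp_flat v, h.skew, h.sharp_flat, h.flat_sub]

theorem flat_alt (h : CouplingAt F B γ b) (u : E) : b u u = 0 := by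
  have := h.flat_skew u u; linarith

theorem flat_sharp (h : CouplingAt F B γ b) (ξ : E →L[ℝ] ℝ) (hξ : ∀ v ∈ F, ξ v = 0) : b (B ξ) = ξ := by
  ext u
  rw [h.flat_skew, h.skew, h.sharp_flat, neg_neg, map_sub, hξ _ (h.mem u), sub_zero]

/-- The mixed component of `B` is zero: up to sign, `B` pairs `α ∘ γ` and `b u` to `α(γ(u - γ u)) =
0`. Hence the horizontal part of `B(α ∘ γ)`, which is `B(b(B(α ∘ γ)))`, vanishes. -/
theorem conn_sharp_conn (h : CouplingAt F B γ b) (α : E →L[ℝ] ℝ) : γ (B (α ∘L γ)) = B (α ∘L γ) := by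
  refine (SeparatingDual.eq_iff_forall_dual_eq (R := ℝ)).2 fun β ↦ ?_
  have h1 : β (B (b (B (α ∘L γ)))) = 0 := by
    rw [h.skew, h.flat_skew, h.skew, h.sharp_flat]
    simp [h.eq_self _ (h.mem _)]
  rw [h.sharp_flat, map_sub, sub_eq_zero] at h1
  exact h1.symm

end CouplingAt

/-- The leaf-tangent part of a bivector. -/
def leafSharp (γ : E → E →L[ℝ] E) (B : E → (E →L[ℝ] ℝ) →L[ℝ] E) (z : E) : (E →L[ℝ] ℝ) →L[ℝ] E :=
  γ z ∘L B z ∘L (ContinuousLinearMap.compL ℝ E E ℝ).flip (γ z)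

theorem leafSharp_apply (γ : E → E →L[ℝ] E) (B : E → (E →L[ℝ] ℝ) →L[ℝ] E) (z : E) (α : E →L[ℝ] ℝ) :
    leafSharp γ B z α = γ z (B z (α ∘L γ z)) := rfl

theorem fderiv_mem_of_eventually_mem [FiniteDimensional ℝ E] {V : Type*} [NormedAddCommGroup V]
    [NormedSpace ℝ V] {F : Submodule ℝ E} {U : V → E} {U' : V →L[ℝ] E} {z : V}
    (hU : ∀ᶠ w in nhds z, U w ∈ F) (hd : HasFDerivAt U U' z) (v : V) : U' v ∈ F := by
  obtain ⟨G, hG⟩ := F.exists_isCompl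
  let q : E →L[ℝ] G := (G.projectionOnto F hG.symm).toContinuousLinearMap
  have hq : ∀ u, q u = 0 ↔ u ∈ F := fun u ↦ Submodule.projectionOnto_apply_eq_zero_iff _
  have h0 : (fun w ↦ q (U w)) =ᶠ[nhds z] fun _ ↦ 0 := hU.mono fun w hw ↦ (hq _).2 hw
  have h1 : HasFDerivAt (fun w ↦ q (U w)) (q.comp U') z := q.hasFDerivAt.comp z hd
  have h2 : q.comp U' = 0 := h1.fderiv.symm.trans (h0.fderiv_eq.trans (fderiv_const_apply 0))
  exact (hq _).1 (congrArg (fun L ↦ L v) h2)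

variable [FiniteDimensional ℝ E] {F : Submodule ℝ E} {B : E → (E →L[ℝ] ℝ) →L[ℝ] E}
  {γ : E → E →L[ℝ] E} {b : E → E →L[ℝ] E →L[ℝ] ℝ} {z : E}

section Derivatives

theorem fderiv_conn_mem (hc : ∀ᶠ w in nhds z, CouplingAt F (B w) (γ w) (b w))
    (hγ : DifferentiableAt ℝ γ z) (v u : E) : fderiv ℝ γ z v u ∈ F := by
  have h := fderiv_mem_of_eventually_mem (F := F) (U := fun w ↦ γ w u)
    (hc.mono fun w hw ↦ hw.mem u) (hγ.hasFDerivAt.clm_apply (hasFDerivAt_const u z)) v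
  simpa using h

theorem fderiv_conn_eq_zero (hc : ∀ᶠ w in nhds z, CouplingAt F (B w) (γ w) (b w))
    (hγ : DifferentiableAt ℝ γ z) (v : E) {u : E} (hu : u ∈ F) : fderiv ℝ γ z v u = 0 := by
  have h := hγ.hasFDerivAt.clm_apply (hasFDerivAt_const u z)
  have h2 : (fun w ↦ γ w u) =ᶠ[nhds z] fun _ ↦ u := hc.mono fun w hw ↦ hw.eq_self u hu
  have h3 := congrArg (fun L ↦ L v) (h.fderiv.symm.trans (h2.fderiv_eq.trans (fderiv_const_apply u)))
  simpa using h3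

/-- The identity `γ(B ξ) = 0` may be differentiated with `ξ` constant, because the annihilator of
`F` does not vary in a foliated chart. -/
theorem fderiv_conn_sharp (hc : ∀ᶠ w in nhds z, CouplingAt F (B w) (γ w) (b w))
    (hB : DifferentiableAt ℝ B z) (hγ : DifferentiableAt ℝ γ z) (v : E) {ξ : E →L[ℝ] ℝ}
    (hξ : ∀ u ∈ F, ξ u = 0) : γ z (fderiv ℝ B z v ξ) = - fderiv ℝ γ z v (B z ξ) := by
  have h := hγ.hasFDerivAt.clm_apply (hB.hasFDerivAt.clm_apply (hasFDerivAt_const ξ z))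
  have h2 : (fun w ↦ γ w (B w ξ)) =ᶠ[nhds z] fun _ ↦ 0 := hc.mono fun w hw ↦ hw.map_sharp ξ hξ
  have h3 := congrArg (fun L ↦ L v) (h.fderiv.symm.trans (h2.fderiv_eq.trans (fderiv_const_apply 0)))
  simp at h3
  exact eq_neg_of_add_eq_zero_left h3

theorem differentiableAt_leafSharp (hB : DifferentiableAt ℝ B z) (hγ : DifferentiableAt ℝ γ z) :
    DifferentiableAt ℝ (leafSharp γ B) z := by
  have : DifferentiableAt ℝ (fun w ↦ (ContinuousLinearMap.compL ℝ E E ℝ).flip (γ w)) z :=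
    ((ContinuousLinearMap.compL ℝ E E ℝ).flip.differentiableAt).comp z hγ
  exact hγ.clm_comp (hB.clm_comp this)

theorem contDiffAt_leafSharp {n : ℕ∞ω} (hB : ContDiffAt ℝ n B z) (hγ : ContDiffAt ℝ n γ z) :
    ContDiffAt ℝ n (leafSharp γ B) z := by
  have : ContDiffAt ℝ n (fun w ↦ (ContinuousLinearMap.compL ℝ E E ℝ).flip (γ w)) z :=
    ((ContinuousLinearMap.compL ℝ E E ℝ).flip.contDiff.contDiffAt).comp z hγ
  exact hγ.clm_comp (hB.clm_comp this)

/-- The outer `γ` in `P` can be dropped before differentiating, by `conn_sharp_conn`. -/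
theorem fderiv_leafSharp (hc : ∀ᶠ w in nhds z, CouplingAt F (B w) (γ w) (b w))
    (hB : DifferentiableAt ℝ B z) (hγ : DifferentiableAt ℝ γ z) (v : E) (α : E →L[ℝ] ℝ) :
    fderiv ℝ (leafSharp γ B) z v α
      = fderiv ℝ B z v (α ∘L γ z) + B z (α ∘L fderiv ℝ γ z v) := by
  have h0 := (differentiableAt_leafSharp hB hγ).hasFDerivAt.clm_apply (hasFDerivAt_const α z)
  have h1 : HasFDerivAt (fun w ↦ α ∘L γ w) _ z :=
    ((ContinuousLinearMap.compL ℝ E E ℝ) α).hasFDerivAt.comp z hγ.hasFDerivAt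
  have h := hB.hasFDerivAt.clm_apply h1
  have h2 : (fun w ↦ leafSharp γ B w α) =ᶠ[nhds z] fun w ↦ B w (α ∘L γ w) :=
    hc.mono fun w hw ↦ hw.conn_sharp_conn α
  have h3 := congrArg (fun L ↦ L v) (h0.fderiv.symm.trans (h2.fderiv_eq.trans h.fderiv))
  simp at h3
  rw [h3, add_comm]

/-- The derivative of `P` has values in `F`, so applying `γ` does not change it. But `γ` kills `B(α
∘ Dγ(v))`, because `α ∘ Dγ(v)` annihilates `F`. -/
theorem fderiv_leafSharp' (hc : ∀ᶠ w in nhds z, CouplingAt F (B w) (γ w) (b w))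
    (hB : DifferentiableAt ℝ B z) (hγ : DifferentiableAt ℝ γ z) (v : E) (α : E →L[ℝ] ℝ) :
    fderiv ℝ (leafSharp γ B) z v α = γ z (fderiv ℝ B z v (α ∘L γ z)) := by
  have h0 := fderiv_mem_of_eventually_mem (F := F) (U := fun w ↦ leafSharp γ B w α)
    (hc.mono fun w hw ↦ hw.mem _) ((differentiableAt_leafSharp hB hγ).hasFDerivAt.clm_apply
      (hasFDerivAt_const α z)) v
  simp at h0
  have hz := hc.self_of_nhds
  rw [← hz.eq_self _ h0, fderiv_leafSharp hc hB hγ, map_add,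
    hz.map_sharp (α ∘L fderiv ℝ γ z v), add_zero]
  intro u hu
  simp [fderiv_conn_eq_zero hc hγ v hu]

/-- Term by term this is the Jacobi identity of `B` for the covectors `α ∘ γ`, `β ∘ γ`, `δ ∘ γ`. -/
theorem jacobiAt_leafSharp (hc : ∀ᶠ w in nhds z, CouplingAt F (B w) (γ w) (b w))
    (hB : DifferentiableAt ℝ B z) (hγ : DifferentiableAt ℝ γ z) (hJ : JacobiAt B z) :
    JacobiAt (leafSharp γ B) z := by
  intro α β δ
  have hz := hc.self_of_nhds
  simp only [fderiv_leafSharp' hc hB hγ, leafSharp_apply, hz.conn_sharp_conn]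
  exact hJ (α ∘L γ z) (β ∘L γ z) (δ ∘L γ z)

/-- Decompose `X = B η + γ X` with `η = b X` in the annihilator of `F`. The derivative of `B` along
`γ X` is the one along `X`, given by `L_X B = 0`, minus the one along `B η`, given by the Jacobi
identity for `η, α ∘ γ, β ∘ γ`. The terms of the latter that contain `γ(DB η)` are turned by
`fderiv_conn_sharp` into the derivative of `γ` in `D(γ X)`. -/
theorem poissonAt_leafSharp (hc : ∀ᶠ w in nhds z, CouplingAt F (B w) (γ w) (b w))
    (hB : DifferentiableAt ℝ B z) (hγ : DifferentiableAt ℝ γ z)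
    (hs : ∀ z (α : E →L[ℝ] ℝ), α (B z α) = 0)
    (hJ : JacobiAt B z) {X : E → E}
    (hX : DifferentiableAt ℝ X z) (hP : PoissonAt B X z) :
    PoissonAt (leafSharp γ B) (fun w ↦ γ w (X w)) z := by
  intro α β
  have hz := hc.self_of_nhds
  have hD : ∀ v, fderiv ℝ (fun w ↦ γ w (X w)) z v = fderiv ℝ γ z v (X z) + γ z (fderiv ℝ X z v) := by
    intro v
    have := congrArg (fun L ↦ L v) (hγ.hasFDerivAt.clm_apply hX.hasFDerivAt).fderiv
    simp at this
    rw [this, add_comm]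
  set a := α ∘L γ z with ha
  set d := β ∘L γ z with hd
  have hη := hz.flat_eq_zero (X z)
  have hBη := hz.sharp_flat (X z)
  set η := b z (X z)
  have hγX : ∀ v, fderiv ℝ γ z v (X z) = fderiv ℝ γ z v (B z η) := by
    intro v
    rw [hBη, map_sub, fderiv_conn_eq_zero hc hγ v (hz.mem _), sub_zero]
  have e1 : β (leafSharp γ B z (α ∘L fderiv ℝ (fun w ↦ γ w (X w)) z))
      = - α (fderiv ℝ γ z (B z d) (X z)) - a (fderiv ℝ X z (B z d)) := by
    rw [leafSharp_apply]
    change d (B z _) = _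
    rw [hz.skew]
    simp only [ContinuousLinearMap.comp_apply]
    rw [hd, hz.conn_sharp_conn, hD, map_add]
    simp only [ha, ContinuousLinearMap.comp_apply]
    ring
  have e2 : β (fderiv ℝ (fun w ↦ γ w (X w)) z (leafSharp γ B z α))
      = β (fderiv ℝ γ z (B z a) (X z)) + d (fderiv ℝ X z (B z a)) := by
    rw [leafSharp_apply, hz.conn_sharp_conn, hD, map_add]; rfl
  have e3 : β (fderiv ℝ (leafSharp γ B) z (γ z (X z)) α)
      = d (fderiv ℝ B z (X z) a) - d (fderiv ℝ B z (B z η) a) := by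
    rw [fderiv_leafSharp' hc hB hγ, hBη, map_sub]
    simp [hd, ha]
  have e4 : d (fderiv ℝ B z (X z) a) = - a (fderiv ℝ X z (B z d)) + d (fderiv ℝ X z (B z a)) :=
    (hP a d).trans (by rw [hz.skew (a ∘L fderiv ℝ X z) d]; rfl)
  have e5 := hJ η a d
  have e6 : η (fderiv ℝ B z (B z a) d) = β (fderiv ℝ γ z (B z a) (B z η)) := by
    rw [fderiv_skew hs hB]
    change - β (γ z _) = _
    rw [fderiv_conn_sharp hc hB hγ _ hη, map_neg, neg_neg]
  have e7 : a (fderiv ℝ B z (B z d) η) = - α (fderiv ℝ γ z (B z d) (B z η)) := by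
    change α (γ z _) = _
    rw [fderiv_conn_sharp hc hB hγ _ hη, map_neg]
  rw [e1, e2, e3, hγX, hγX]
  linarith

/-- The endomorphism `v ↦ B(α ∘ γ'(v))`. -/
def connDefect (B : E → (E →L[ℝ] ℝ) →L[ℝ] E) (γ : E → E →L[ℝ] E) (z : E) (α : E →L[ℝ] ℝ) : E →L[ℝ] E :=
  B z ∘L (ContinuousLinearMap.compL ℝ E E ℝ α) ∘L fderiv ℝ γ z

theorem connDefect_apply (B : E → (E →L[ℝ] ℝ) →L[ℝ] E) (γ : E → E →L[ℝ] E) (z : E) (α : E →L[ℝ] ℝ) (v : E) :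
    connDefect B γ z α v = B z (α ∘L fderiv ℝ γ z v) := rfl

/-- The divergence of `P α` has one more term than that of `B` applied to the frozen covector `α ∘
γ(z)`, namely the trace of `v ↦ B(α ∘ Dγ(v))`. The hypothesis on `σ` and `s` compensates for it. -/
theorem conn_modelModular (hc : ∀ᶠ w in nhds z, CouplingAt F (B w) (γ w) (b w))
    (hB : DifferentiableAt ℝ B z) (hγ : DifferentiableAt ℝ γ z) {σ s : E → ℝ}
    (hσ : ∀ α : E →L[ℝ] ℝ, fderiv ℝ σ z (B z (α ∘L γ z))
      = fderiv ℝ s z (B z (α ∘L γ z)) + traceCLM E (connDefect B γ z α)) :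
    γ z (modelModular B σ z) = modelModular (leafSharp γ B) s z := by
  refine (SeparatingDual.eq_iff_forall_dual_eq (R := ℝ)).2 fun α ↦ ?_
  have h1 : α (γ z (modelModular B σ z)) = (α ∘L γ z) (modelModular B σ z) := rfl
  rw [h1, apply_modelModular, apply_modelModular, hσ, leafSharp_apply, hc.self_of_nhds.conn_sharp_conn]
  have h2 : (fderiv ℝ (leafSharp γ B) z).flip α
      = (fderiv ℝ B z).flip (α ∘L γ z) + connDefect B γ z α := by
    ext v
    simp [fderiv_leafSharp hc hB hγ, connDefect_apply]
  rw [h2, map_add]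
  ring

/-- Differentiating `B ∘ b = id - γ` along `w = B(α ∘ γ)` expresses `Db(w)` through `DB(w)`. The
Jacobi identity for `α ∘ γ, b u, b v` trades `DB(w)` for derivatives along `u - γ u` and `v - γ v`,
and there `fderiv_conn_sharp` turns `γ ∘ DB` into `Dγ`. -/
theorem fderiv_flat (hc : ∀ᶠ w in nhds z, CouplingAt F (B w) (γ w) (b w))
    (hB : DifferentiableAt ℝ B z) (hγ : DifferentiableAt ℝ γ z) (hb : DifferentiableAt ℝ b z)
    (hs : ∀ z (α : E →L[ℝ] ℝ), α (B z α) = 0) (hJ : JacobiAt B z) (α : E →L[ℝ] ℝ) (u v : E) :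
    fderiv ℝ b z (B z (α ∘L γ z)) u v
      = b z (connDefect B γ z α (u - γ z u)) v + b z u (connDefect B γ z α (v - γ z v)) := by
  have hz := hc.self_of_nhds
  set w := B z (α ∘L γ z) with hw
  have hT : ∀ x y, b z (connDefect B γ z α x) y = α (fderiv ℝ γ z x y) := by
    intro x y
    rw [connDefect_apply, hz.flat_sharp]
    · rfl
    · intro u hu; simp [fderiv_conn_eq_zero hc hγ x hu]
  have hsub : ∀ x y, fderiv ℝ γ z x (y - γ z y) = fderiv ℝ γ z x y := fun x y ↦ by
    rw [map_sub, fderiv_conn_eq_zero hc hγ x (hz.mem y), sub_zero]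
  have h1 : B z (fderiv ℝ b z w u) = - fderiv ℝ B z w (b z u) - fderiv ℝ γ z w u := by
    have h := hB.hasFDerivAt.clm_apply (hb.hasFDerivAt.clm_apply (hasFDerivAt_const u z))
    have h' := (hasFDerivAt_const u z).fun_sub (hγ.hasFDerivAt.clm_apply (hasFDerivAt_const u z))
    have h2 : (fun w ↦ B w (b w u)) =ᶠ[nhds z] fun w ↦ u - γ w u :=
      hc.mono fun w hw ↦ hw.sharp_flat u
    have h3 := congrArg (fun L ↦ L w) (h.fderiv.symm.trans (h2.fderiv_eq.trans h'.fderiv))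
    simp at h3
    rw [eq_sub_of_add_eq h3]
    abel
  have h0 : ∀ v ∈ F, fderiv ℝ b z w u v = 0 := by
    intro v hv
    have h := (hb.hasFDerivAt.clm_apply (hasFDerivAt_const u z)).clm_apply (hasFDerivAt_const v z)
    have h2 : (fun w ↦ b w u v) =ᶠ[nhds z] fun w ↦ 0 := hc.mono fun w hw ↦ hw.flat_eq_zero u v hv
    have h3 := congrArg (fun L ↦ L w) (h.fderiv.symm.trans (h2.fderiv_eq.trans (fderiv_const_apply 0)))
    simpa using h3
  have h2 : fderiv ℝ b z w u v = b z v (fderiv ℝ B z w (b z u)) := by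
    have e1 : fderiv ℝ b z w u v = fderiv ℝ b z w u (v - γ z v) := by
      rw [map_sub, h0 _ (hz.mem v), sub_zero]
    rw [e1, ← hz.sharp_flat v, hz.skew, h1, map_sub, map_neg,
      hz.flat_eq_zero _ _ (fderiv_conn_mem hc hγ w u)]
    ring
  have h3 := hJ (α ∘L γ z) (b z u) (b z v)
  have h4 : ∀ u v, (α ∘L γ z) (fderiv ℝ B z u (b z v)) = - α (fderiv ℝ γ z u v) := by
    intro u v
    change α (γ z _) = _
    rw [fderiv_conn_sharp hc hB hγ _ (hz.flat_eq_zero v), hz.sharp_flat, hsub, map_neg]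
  rw [h4, fderiv_skew hs hB _ (α ∘L γ z), h4, hz.sharp_flat, hz.sharp_flat] at h3
  rw [h2, hT, hz.flat_skew u (connDefect B γ z α _), hT]
  linarith

end Derivatives

end CouplingModel

/-! ### The forms `θ ^ r ∧ γ^*τ` and their variation. -/

section CouplingForm

variable {W V : Type*} [AddCommGroup W] [Module ℝ W] [AddCommGroup V] [Module ℝ V] {k : ℕ}

/-- A form of a given degree as an element of the graded space of forms. -/
def Forms.single (η : W [⋀^Fin k]→ₗ[ℝ] ℝ) : Forms W :=
  Pi.single (M := fun m ↦ W [⋀^Fin m]→ₗ[ℝ] ℝ) k η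

@[simp] theorem Forms.single_same (η : W [⋀^Fin k]→ₗ[ℝ] ℝ) : Forms.single η k = η :=
  Pi.single_eq_same (M := fun m ↦ W [⋀^Fin m]→ₗ[ℝ] ℝ) k η

theorem Forms.single_of_ne (η : W [⋀^Fin k]→ₗ[ℝ] ℝ) {m : ℕ} (h : m ≠ k) : Forms.single η m = 0 :=
  Pi.single_eq_of_ne (M := fun m ↦ W [⋀^Fin m]→ₗ[ℝ] ℝ) h η

theorem pullForms_single (g : V →ₗ[ℝ] W) (η : W [⋀^Fin k]→ₗ[ℝ] ℝ) :
    pullForms g (Forms.single η) = Forms.single (η.compLinearMap g) := by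
  refine Forms.ext fun m ↦ ?_
  by_cases h : m = k
  · subst h; simp [pullForms]
  · simp [pullForms, Forms.single_of_ne _ h]

/-- The degree `n` part of `θ ^ r ∧ γ^* τ`. -/
def couplingForm (θ : W →ₗ[ℝ] Dual ℝ W) (γ : W →ₗ[ℝ] V) (τ : V [⋀^Fin k]→ₗ[ℝ] ℝ) (r n : ℕ) :
    W [⋀^Fin n]→ₗ[ℝ] ℝ :=
  ((wedgeTwo θ ^ r) (Forms.single (τ.compLinearMap γ))) n

theorem couplingForm_comp {W' : Type*} [AddCommGroup W'] [Module ℝ W'] (g : W' →ₗ[ℝ] W)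
    (θ : W →ₗ[ℝ] Dual ℝ W) (γ : W →ₗ[ℝ] V) (τ : V [⋀^Fin k]→ₗ[ℝ] ℝ) (r n : ℕ) (v : Fin n → W') :
    couplingForm θ γ τ r n (fun i ↦ g (v i))
      = couplingForm (g.dualMap ∘ₗ θ ∘ₗ g) (γ ∘ₗ g) τ r n v := by
  have h := pullForms_wedgeTwo_pow g θ r (Forms.single (τ.compLinearMap γ))
  rw [pullForms_single] at h
  exact congrArg (fun η : Forms W' ↦ η n v) h

/-- Multilinearity and alternation pass to the pointwise derivative by uniqueness of derivatives, so
no topology on the space of forms is needed. -/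
theorem exists_alternating_deriv {η : ℝ → W [⋀^Fin k]→ₗ[ℝ] ℝ} {f : (Fin k → W) → ℝ}
    (h : ∀ v, HasDerivAt (fun t ↦ η t v) (f v) 0) : ∃ η' : W [⋀^Fin k]→ₗ[ℝ] ℝ, ∀ v, η' v = f v := by
  refine ⟨{ toFun := f, map_update_add' := ?_, map_update_smul' := ?_,
            map_eq_zero_of_eq' := ?_ }, fun v ↦ rfl⟩
  · intro _ v i x y
    have h1 := (h (Function.update v i x)).fun_add (h (Function.update v i y))
    have h2 := h (Function.update v i (x + y))
    have h3 : ∀ t, η t (Function.update v i (x + y))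
      = η t (Function.update v i x) + η t (Function.update v i y) := fun t ↦
        (η t).map_update_add v i x y
    simp only [h3] at h2
    convert h2.unique h1
  · intro _ v i c x
    have h1 := (h (Function.update v i x)).const_mul c
    have h2 := h (Function.update v i (c • x))
    have h3 : ∀ t, η t (Function.update v i (c • x)) = c * η t (Function.update v i x) := fun t ↦
      (η t).map_update_smul v i c x
    simp only [h3] at h2
    convert h2.unique h1
    rfl
  · intro v i j hv hij
    have h2 := h v
    refine h2.unique ((hasDerivAt_const (0 : ℝ) (0 : ℝ)).congr_of_eventuallyEq
      (.of_forall fun t ↦ ?_))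
    exact (η t).map_eq_zero_of_eq v hv hij

theorem HasFormDeriv.single {η : ℝ → W [⋀^Fin k]→ₗ[ℝ] ℝ} {η' : W [⋀^Fin k]→ₗ[ℝ] ℝ}
    (h : ∀ v, HasDerivAt (fun t ↦ η t v) (η' v) 0) :
    HasFormDeriv (fun t ↦ Forms.single (η t)) (Forms.single η') := by
  intro m v
  by_cases hm : m = k
  · subst hm; simpa using h v
  · simpa [Forms.single_of_ne _ hm] using hasDerivAt_const (0 : ℝ) (0 : ℝ)

end CouplingForm

section CouplingFormDeriv

variable {W V : Type*} [NormedAddCommGroup W] [NormedSpace ℝ W] [FiniteDimensional ℝ W]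
  [NormedAddCommGroup V] [NormedSpace ℝ V] [FiniteDimensional ℝ V] {k : ℕ}

/-- If `(θ, γ)` is deformed infinitesimally by an endomorphism `S`, then a top-degree part of
`θ ^ r ∧ γ^* τ` is multiplied by the trace of `S`. -/
theorem hasDerivAt_couplingForm {θ : ℝ → W →ₗ[ℝ] Dual ℝ W} {γ : ℝ → W →ₗ[ℝ] V}
    (S : W →ₗ[ℝ] W) (hθ : ∀ u v, HasDerivAt (fun t ↦ θ t u v) (θ 0 (S u) v + θ 0 u (S v)) 0)
    (hγ : ∀ u, HasDerivAt (fun t ↦ γ t u) (γ 0 (S u)) 0) (τ : V [⋀^Fin k]→ₗ[ℝ] ℝ) (r : ℕ)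
    (v : Fin (finrank ℝ W) → W) :
    HasDerivAt (fun t ↦ couplingForm (θ t) (γ t) τ r _ v)
      (LinearMap.trace ℝ W S * couplingForm (θ 0) (γ 0) τ r _ v) 0 := by
  -- The given pair `(θ t, γ t)` and the pullback of `(θ 0, γ 0)` by `g t` have the same 1-jet at
  -- `0`, so their coupling forms have the same derivative. In top degree the second family is
  -- `det(1 + tS)` times a constant.
  let g : ℝ → W →ₗ[ℝ] W := fun t ↦ 1 + t • S
  have hg0 : g 0 = LinearMap.id := by simp [g]; rfl
  have hg : ∀ u, HasDerivAt (fun t ↦ g t u) (S u) 0 := fun u ↦ by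
    simpa [g] using ((hasDerivAt_id (0 : ℝ)).smul_const (S u)).const_add u
  have hγg : ∀ u, HasDerivAt (fun t ↦ γ 0 (g t u)) (γ 0 (S u)) 0 := fun u ↦
    (LinearMap.toContinuousLinearMap (γ 0)).hasFDerivAt.comp_hasDerivAt (0 : ℝ) (hg u)
  have hθg : ∀ u v, HasDerivAt (fun t ↦ ((g t).dualMap ∘ₗ θ 0 ∘ₗ g t) u v)
      (θ 0 (S u) v + θ 0 u (S v)) 0 := by
    intro u v
    let L : W →L[ℝ] W →L[ℝ] ℝ := LinearMap.toContinuousLinearMap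
      ((LinearMap.toContinuousLinearMap : (W →ₗ[ℝ] ℝ) ≃ₗ[ℝ] W →L[ℝ] ℝ).toLinearMap ∘ₗ θ 0)
    have h1 := (L.hasFDerivAt.comp_hasDerivAt (0 : ℝ) (hg u)).clm_apply (hg v)
    have h2 : HasDerivAt (fun t ↦ θ 0 (g t u) (g t v)) (θ 0 (S u) (g 0 v) + θ 0 (g 0 u) (S v)) 0 := h1
    simpa [hg0] using h2
  have hτ : ∀ v : Fin k → W, HasDerivAt (fun t ↦ (τ.compLinearMap (γ t)) v)
      (∑ i, τ (Function.update (fun j ↦ γ 0 (v j)) i (γ 0 (S (v i))))) 0 := fun v ↦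
    hasDerivAt_alternating τ fun i ↦ hγ (v i)
  have hτg : ∀ v : Fin k → W, HasDerivAt (fun t ↦ (τ.compLinearMap (γ 0 ∘ₗ g t)) v)
      (∑ i, τ (Function.update (fun j ↦ γ 0 (v j)) i (γ 0 (S (v i))))) 0 := fun v ↦ by
    have := hasDerivAt_alternating τ fun i ↦ hγg (v i)
    simpa [hg0] using this
  obtain ⟨η', hη'⟩ := exists_alternating_deriv hτ
  let θ' : W →ₗ[ℝ] Dual ℝ W := θ 0 ∘ₗ S + S.dualMap ∘ₗ θ 0
  obtain ⟨ζ, h1, h2⟩ := exists_hasFormDeriv_pow (HasFormDeriv.single fun v ↦ (hη' v) ▸ hτ v)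
    (HasFormDeriv.single fun v ↦ (hη' v) ▸ hτg v) (by simp [hg0])
    (θ' := θ') hθ hθg (by ext; simp [hg0]) r
  have h3 := h2 (finrank ℝ W) v
  have h4 : ∀ t, (wedgeTwo ((g t).dualMap ∘ₗ θ 0 ∘ₗ g t) ^ r)
      (Forms.single (τ.compLinearMap (γ 0 ∘ₗ g t))) (finrank ℝ W) v
        = LinearMap.det (1 + t • S) * couplingForm (θ 0) (γ 0) τ r _ v := fun t ↦
    (couplingForm_comp (g t) (θ 0) (γ 0) τ r _ v).symm.trans
      (top_comp_eq_det_mul (finBasis ℝ W) _ (g t) v)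
  simp only [h4] at h3
  have h5 := (hasDerivAt_det_one_add_smul S).mul_const (couplingForm (θ 0) (γ 0) τ r _ v)
  rw [← h3.unique h5]
  exact h1 _ v

end CouplingFormDeriv

/-! ### Smooth dependence of these forms on parameters. -/

section CouplingFormSmooth

variable {W V Z : Type*} [AddCommGroup W] [Module ℝ W] 
  [NormedAddCommGroup V] [NormedSpace ℝ V] [FiniteDimensional ℝ V]
  [NormedAddCommGroup Z] [NormedSpace ℝ Z] {k : ℕ} {n : ℕ∞ω} {z : Z}

theorem contDiffAt_wedge {η : Z → Forms W} (h : ∀ m v, ContDiffAt ℝ n (fun w ↦ η w m v) z)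
    {a : Z → Dual ℝ W} (ha : ∀ u, ContDiffAt ℝ n (fun w ↦ a w u) z) (m : ℕ) (v : Fin m → W) :
    ContDiffAt ℝ n (fun w ↦ wedge (a w) (η w) m v) z := by
  rcases m with _ | m
  · simpa using contDiffAt_const
  · simp only [wedge_succ_apply]
    exact ContDiffAt.sum fun i _ ↦ contDiffAt_const.mul ((ha _).mul (h m _))

theorem contDiffAt_wedgeTwo {η : Z → Forms W} (h : ∀ m v, ContDiffAt ℝ n (fun w ↦ η w m v) z)
    {θ : Z → W →ₗ[ℝ] Dual ℝ W} (hθ : ∀ u v, ContDiffAt ℝ n (fun w ↦ θ w u v) z) (m : ℕ)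
    (v : Fin m → W) :
    ContDiffAt ℝ n (fun w ↦ wedgeTwo (θ w) (η w) m v) z := by
  rcases m with _ | m
  · simpa using contDiffAt_const
  · simp only [wedgeTwo_succ_apply]
    exact ContDiffAt.sum fun i _ ↦ contDiffAt_const.mul (contDiffAt_wedge h (hθ _) m _)

theorem contDiffAt_couplingForm {θ : Z → W →ₗ[ℝ] Dual ℝ W}
    (hθ : ∀ u v, ContDiffAt ℝ n (fun w ↦ θ w u v) z) {γ : Z → W →ₗ[ℝ] V}
    (hγ : ∀ u, ContDiffAt ℝ n (fun w ↦ γ w u) z) (τ : V [⋀^Fin k]→ₗ[ℝ] ℝ) (r m : ℕ)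
    (v : Fin m → W) :
    ContDiffAt ℝ n (fun w ↦ couplingForm (θ w) (γ w) τ r m v) z := by
  have key : ∀ m v, ContDiffAt ℝ n
      (fun w ↦ (wedgeTwo (θ w) ^ r) (Forms.single (τ.compLinearMap (γ w))) m v) z := by
    induction r with
    | zero =>
      intro m v
      by_cases hm : m = k
      · subst hm
        simp only [pow_zero, Module.End.one_apply, Forms.single_same]
        exact (toContAlt τ).contDiff.contDiffAt.comp z (contDiffAt_pi.2 fun i ↦ hγ (v i))
      · simpa [Forms.single_of_ne _ hm] using contDiffAt_const
    | succ r ih =>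
      simp only [pow_succ', Module.End.mul_apply]
      exact contDiffAt_wedgeTwo ih hθ
  exact key m v

end CouplingFormSmooth

/-! ### Variation of the coupling form along `P♯α`; smoothness of `γ` and `b`. -/

section CouplingModelForm

set_option maxSynthPendingDepth 3

variable {E : Type*} [NormedAddCommGroup E] [NormedSpace ℝ E] [FiniteDimensional ℝ E]
  {F : Submodule ℝ E} {B : E → (E →L[ℝ] ℝ) →L[ℝ] E}
  {γ : E → E →L[ℝ] E} {b : E → E →L[ℝ] E →L[ℝ] ℝ} {z : E} {k : ℕ}

/-- The map `b : E → E*`, with values in the algebraic dual. -/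
def flatLin (b : E →L[ℝ] E →L[ℝ] ℝ) : E →ₗ[ℝ] Dual ℝ E :=
  ContinuousLinearMap.coeLM ℝ ∘ₗ b.toLinearMap

theorem flatLin_apply (b : E →L[ℝ] E →L[ℝ] ℝ) (u v : E) : flatLin b u v = b u v := rfl

theorem contDiffAt_couplingForm_model (hγ : ContDiffAt ℝ ∞ γ z) (hb : ContDiffAt ℝ ∞ b z)
    (τ : E [⋀^Fin k]→ₗ[ℝ] ℝ) (r m : ℕ) (v : Fin m → E) :
    ContDiffAt ℝ ∞ (fun w ↦ couplingForm (flatLin (b w)) (γ w).toLinearMap τ r m v) z :=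
  contDiffAt_couplingForm (fun _ _ ↦ (hb.clm_apply contDiffAt_const).clm_apply contDiffAt_const)
    (fun _ ↦ hγ.clm_apply contDiffAt_const) τ r m v

theorem fderiv_couplingForm (hc : ∀ᶠ w in nhds z, CouplingAt F (B w) (γ w) (b w))
    (hB : DifferentiableAt ℝ B z) (hγ : ContDiffAt ℝ ∞ γ z) (hb : ContDiffAt ℝ ∞ b z)
    (hs : ∀ z (α : E →L[ℝ] ℝ), α (B z α) = 0) (hJ : JacobiAt B z) (α : E →L[ℝ] ℝ)
    (τ : E [⋀^Fin k]→ₗ[ℝ] ℝ) (r : ℕ) (v : Fin (finrank ℝ E) → E) :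
    fderiv ℝ (fun w ↦ couplingForm (flatLin (b w)) (γ w).toLinearMap τ r _ v) z
        (B z (α ∘L γ z))
      = traceCLM E (connDefect B γ z α)
        * couplingForm (flatLin (b z)) (γ z).toLinearMap τ r _ v := by
  have hz := hc.self_of_nhds
  have hγd := hγ.differentiableAt (by simp)
  have hbd := hb.differentiableAt (by simp)
  set T := connDefect B γ z α with hT
  set w := B z (α ∘L γ z) with hw
  -- The first summand accounts for the variation of `b` and is killed by `γ`, since `γ ∘ T = 0`.
  -- The second accounts for the variation of `γ` and is invisible to `b`, since it takes values in
  -- `F`.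
  let S : E →L[ℝ] E := T ∘L (ContinuousLinearMap.id ℝ E - γ z) + fderiv ℝ γ z w
  have hS : ∀ u, S u = T (u - γ z u) + fderiv ℝ γ z w u := fun u ↦ rfl
  have hγT : ∀ u, γ z (T u) = 0 := by
    intro u
    rw [hT, connDefect_apply]
    exact hz.map_sharp _ fun u hu ↦ by simp [fderiv_conn_eq_zero hc hγd _ hu]
  have hline : HasDerivAt (fun t : ℝ ↦ z + t • w) w 0 := by
    simpa using ((hasDerivAt_id (0 : ℝ)).smul_const w).const_add z
  have hz0 : z + (0 : ℝ) • w = z := by simp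
  have hbl : HasDerivAt (fun t : ℝ ↦ b (z + t • w)) (fderiv ℝ b z w) 0 :=
    HasFDerivAt.comp_hasDerivAt (0 : ℝ) (by rw [hz0]; exact hbd.hasFDerivAt) hline
  have hγl : HasDerivAt (fun t : ℝ ↦ γ (z + t • w)) (fderiv ℝ γ z w) 0 :=
    HasFDerivAt.comp_hasDerivAt (0 : ℝ) (by rw [hz0]; exact hγd.hasFDerivAt) hline
  -- The corrections have trace zero: `tr(Tγ) = tr(γT) = 0`, and `tr(γ Dγ(w)) = tr(Dγ(w) γ) = 0`
  -- because `Dγ(w)` vanishes on `F`.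
  have htr : LinearMap.trace ℝ E S.toLinearMap = traceCLM E T := by
    have e1 : S = T - T ∘L γ z + γ z ∘L fderiv ℝ γ z w := by
      ext u
      rw [hS, map_sub]
      change _ = _ + γ z (fderiv ℝ γ z w u)
      rw [hz.eq_self _ (fderiv_conn_mem hc hγd w u)]; rfl
    have e2 : γ z ∘L T = 0 := by ext u; exact hγT u
    have e3 : fderiv ℝ γ z w ∘L γ z = 0 := by
      ext u; exact fderiv_conn_eq_zero hc hγd w (hz.mem u)
    rw [← traceCLM_apply, e1, map_add, map_sub, traceCLM_comp_comm T (γ z), traceCLM_comp_comm (γ z) (fderiv ℝ γ z w), e2,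
      e3]
    simp
  have h1 := hasDerivAt_couplingForm (θ := fun t ↦ flatLin (b (z + t • w)))
    (γ := fun t ↦ (γ (z + t • w)).toLinearMap) S.toLinearMap
    (fun u v ↦ by
      have h := (hbl.clm_apply (hasDerivAt_const (0 : ℝ) u)).clm_apply (hasDerivAt_const (0 : ℝ) v)
      simp only [hz0, map_zero, add_zero] at h
      simp only [hz0, flatLin_apply, ContinuousLinearMap.coe_coe, hS]
      refine h.congr_deriv ?_
      rw [fderiv_flat hc hB hγd hbd hs hJ, map_add (b z u), hz.flat_eq_zero u _ (fderiv_conn_mem hc hγd w v),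
        add_zero, map_add (b z), add_apply, hz.flat_skew (fderiv ℝ γ z w u),
        hz.flat_eq_zero v _ (fderiv_conn_mem hc hγd w u), neg_zero, add_zero])
    (fun u ↦ by
      have h := hγl.clm_apply (hasDerivAt_const (0 : ℝ) u)
      simp only [hz0, map_zero, add_zero] at h
      simp only [hz0, ContinuousLinearMap.coe_coe, hS]
      refine h.congr_deriv ?_
      rw [map_add, hγT, zero_add, hz.eq_self _ (fderiv_conn_mem hc hγd w u)])
    τ r v
  simp only [hz0, htr] at h1
  have h2 := (contDiffAt_couplingForm_model hγ hb τ r _ v).differentiableAt (by simp)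
  have h3 : HasDerivAt (fun t : ℝ ↦ couplingForm (flatLin (b (z + t • w)))
      (γ (z + t • w)).toLinearMap τ r _ v) _ 0 :=
    HasFDerivAt.comp_hasDerivAt (l := fun w ↦ couplingForm (flatLin (b w)) (γ w).toLinearMap τ r _ v)
      (0 : ℝ) (by rw [hz0]; exact h2.hasFDerivAt) hline
  exact h3.unique h1

/-- The connection and the inverse of a smooth bivector are smooth. -/
theorem contDiffAt_conn_flat (hc : ∀ᶠ w in nhds z, CouplingAt F (B w) (γ w) (b w))
    (hB : ContDiffAt ℝ ∞ B z) : ContDiffAt ℝ ∞ γ z ∧ ContDiffAt ℝ ∞ b z := by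
  obtain ⟨G, hG⟩ := F.exists_isCompl
  let q : E →L[ℝ] G := (G.projectionOnto F hG.symm).toContinuousLinearMap
  have hq : ∀ u, q u = 0 ↔ u ∈ F := fun u ↦ Submodule.projectionOnto_apply_eq_zero_iff _
  let j : G →L[ℝ] E := G.subtypeL
  have hqj : ∀ u, q (j u) = u := fun u ↦ Submodule.projectionOnto_apply_left _ u
  have hjq : ∀ ξ : E →L[ℝ] ℝ, (∀ v ∈ F, ξ v = 0) → (ξ ∘L j) ∘L q = ξ := by
    intro ξ hξ
    ext u
    have : u - j (q u) ∈ F := (hq _).1 (by rw [map_sub, hqj, sub_self])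
    have h := hξ _ this
    rw [map_sub, sub_eq_zero] at h
    exact h.symm
  let qT : (G →L[ℝ] ℝ) →L[ℝ] E →L[ℝ] ℝ := (ContinuousLinearMap.compL ℝ E G ℝ).flip q
  let jT : (E →L[ℝ] ℝ) →L[ℝ] G →L[ℝ] ℝ := (ContinuousLinearMap.compL ℝ G E ℝ).flip j
  -- The dual of a fixed complement `G` is the annihilator of `F`, and on it `B` becomes a smooth
  -- family of maps `A w : G* → G`. Up to the constant maps `q` and its transpose, `b` is the
  -- inverse of `A`, hence smooth; then so is `γ = id - B ∘ b`.
  let A : E → (G →L[ℝ] ℝ) →L[ℝ] G := fun w ↦ q ∘L B w ∘L qT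
  have hA : ContDiffAt ℝ ∞ A z := contDiffAt_const.clm_comp (hB.clm_comp contDiffAt_const)
  have hinv : ∀ w, CouplingAt F (B w) (γ w) (b w) →
      A w ∘L (jT ∘L b w ∘L j) = ContinuousLinearMap.id ℝ G ∧
      (jT ∘L b w ∘L j) ∘L A w = ContinuousLinearMap.id ℝ (G →L[ℝ] ℝ) := by
    intro w hw
    constructor
    · ext u
      change ((q (B w ((b w (j u) ∘L j) ∘L q)) : G) : E) = u
      rw [hjq _ (hw.flat_eq_zero _), hw.sharp_flat, map_sub, hqj, (hq _).2 (hw.mem _), sub_zero]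
    · ext θ u
      change b w (j (q (B w (θ ∘L q)))) (j u) = θ u
      have h1 : ∀ v ∈ F, (θ ∘L q) v = 0 := fun v hv ↦ by simp [(hq v).2 hv]
      have h2 : b w (j (q (B w (θ ∘L q)))) = b w (B w (θ ∘L q)) := by
        ext x
        have : B w (θ ∘L q) - j (q (B w (θ ∘L q))) ∈ F :=
          (hq _).1 (by rw [map_sub, hqj, sub_self])
        have h := hw.flat_eq_zero x _ this
        rw [map_sub, sub_eq_zero] at h
        rw [hw.flat_skew, ← h, ← hw.flat_skew]
      rw [h2, hw.flat_sharp _ h1]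
      simp [hqj]
  have hb' : ∀ w, CouplingAt F (B w) (γ w) (b w) → b w = qT ∘L (A w).inverse ∘L q := by
    intro w hw
    rw [ContinuousLinearMap.inverse_eq (hinv w hw).1 (hinv w hw).2]
    ext u v
    change b w u v = b w (j (q u)) (j (q v))
    have h1 : ∀ u v, b w u (j (q v)) = b w u v := by
      intro u v
      have : v - j (q v) ∈ F := (hq _).1 (by rw [map_sub, hqj, sub_self])
      have h := hw.flat_eq_zero u _ this
      rw [map_sub, sub_eq_zero] at h
      exact h.symm
    rw [h1, hw.flat_skew (j (q u)), h1, ← hw.flat_skew]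
  have hz := hc.self_of_nhds
  have hbs : ContDiffAt ℝ ∞ b z := by
    let e : (G →L[ℝ] ℝ) ≃L[ℝ] G := ContinuousLinearEquiv.equivOfInverse (A z) (jT ∘L b z ∘L j)
      (fun x ↦ congrArg (fun L ↦ L x) (hinv z hz).2) (fun x ↦ congrArg (fun L ↦ L x) (hinv z hz).1)
    have h1 : ContDiffAt ℝ ∞ (fun w ↦ (A w).inverse) z :=
      ContDiffAt.comp (g := ContinuousLinearMap.inverse) z (contDiffAt_map_inverse e) hA
    have h2 : ContDiffAt ℝ ∞ (fun w ↦ qT ∘L (A w).inverse ∘L q) z :=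
      contDiffAt_const.clm_comp (h1.clm_comp contDiffAt_const)
    exact h2.congr_of_eventuallyEq (hc.mono hb')
  refine ⟨?_, hbs⟩
  have h1 : ContDiffAt ℝ ∞ (fun w ↦ ContinuousLinearMap.id ℝ E - B w ∘L b w) z :=
    contDiffAt_const.sub (hB.clm_comp hbs)
  refine h1.congr_of_eventuallyEq (hc.mono fun w hw ↦ ?_)
  ext u
  simp [hw.sharp_flat]

end CouplingModelForm

/-! ### Contraction with a bivector in a basis. -/

section LeafContraction

open AlternatingMap

variable {V : Type*} [AddCommGroup V] [Module ℝ V]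

theorem sum_apply_form {ι : Type*} {m : ℕ} (s : Finset ι) (η : ι → V [⋀^Fin m]→ₗ[ℝ] ℝ)
    (v : Fin m → V) : (∑ i ∈ s, η i) v = ∑ i ∈ s, η i v := by
  classical
  induction s using Finset.induction_on with
  | empty => simp
  | insert i s hi ih => rw [Finset.sum_insert hi, Finset.sum_insert hi, AlternatingMap.add_apply, ih]

theorem pairing_apply {m : ℕ} (τ : V [⋀^Fin (m + 2)]→ₗ[ℝ] ℝ) (w : Fin m → V) (u v : V) :
    pairing τ w u v = τ (Matrix.vecCons u (Matrix.vecCons v w)) := rfl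

theorem contract_apply {m : ℕ} (N : Dual ℝ V →ₗ[ℝ] V) (τ : V [⋀^Fin (m + 2)]→ₗ[ℝ] ℝ)
    (w : Fin m → V) : contract N τ w = 2⁻¹ * LinearMap.trace ℝ V (N ∘ₗ pairing τ w) := rfl

theorem contract_conj {V' : Type*} [AddCommGroup V'] [Module ℝ V'] (e : V ≃ₗ[ℝ] V') {m : ℕ}
    (N : Dual ℝ V →ₗ[ℝ] V) (τ : V' [⋀^Fin (m + 2)]→ₗ[ℝ] ℝ) (w : Fin m → V) :
    contract N (τ.compLinearMap e.toLinearMap) w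
      = contract (e.toLinearMap ∘ₗ N ∘ₗ e.toLinearMap.dualMap) τ (fun i ↦ e (w i)) := by
  rw [contract_apply, contract_apply]
  congr 1
  have h : e.toLinearMap.dualMap ∘ₗ pairing τ (fun i ↦ e (w i)) ∘ₗ e.toLinearMap
      = pairing (τ.compLinearMap e.toLinearMap) w := by
    ext u v
    simp only [LinearMap.comp_apply, LinearMap.dualMap_apply, pairing_apply,
      AlternatingMap.compLinearMap_apply]
    congr 1
    ext i
    refine Fin.cases rfl (fun i ↦ ?_) i
    exact Fin.cases rfl (fun i ↦ rfl) i
  rw [← h, ← LinearMap.trace_conj' _ e]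
  congr 1
  ext u
  simp [LinearEquiv.conj_apply]

theorem contract_eq_sum {ι : Type*} [Fintype ι] [DecidableEq ι] (f : Basis ι ℝ V) {m : ℕ}
    (N : Dual ℝ V →ₗ[ℝ] V) (τ : V [⋀^Fin (m + 2)]→ₗ[ℝ] ℝ) (w : Fin m → V) :
    contract N τ w = ∑ a, ∑ c, 2⁻¹ * f.coord c (N (f.coord a))
      * τ (Matrix.vecCons (f c) (Matrix.vecCons (f a) w)) := by
  have h : ∀ β : Dual ℝ V, β = ∑ a, β (f a) • f.coord a := fun β ↦ (f.sum_dual_apply_smul_coord β).symm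
  rw [contract_apply, LinearMap.trace_eq_matrix_trace ℝ f, Matrix.trace, Finset.mul_sum,
    Finset.sum_comm]
  refine Finset.sum_congr rfl fun c _ ↦ ?_
  simp only [Matrix.diag_apply, LinearMap.toMatrix_apply, LinearMap.comp_apply]
  rw [h (pairing τ w (f c)), map_sum, map_sum, Finsupp.finsetSum_apply, Finset.mul_sum]
  refine Finset.sum_congr rfl fun a _ ↦ ?_
  rw [map_smul, map_smul, Finsupp.smul_apply, pairing_apply, Basis.coord_apply, smul_eq_mul]
  ring

/-- The algebraic core of `i_Z τ = -d i_P τ`: the `r a c` stand for the differentials of the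
coefficients of `i_P τ`, and `ζ` for their divergence. Since `r a c ∧ vol` exceeds the top degree,
its value on `f c, f a, v` is zero, which removes `r a c (v i)` in favour of `r a c (f a)` and `r a
c (f c)`. By skewness of `r` the two resulting sums agree, which absorbs the factor `2⁻¹`. -/
theorem sum_coeff_contract [FiniteDimensional ℝ V] {ι : Type*} [Fintype ι] [DecidableEq ι]
    (f : Basis ι ℝ V) {m : ℕ}
    (hm : finrank ℝ V = m + 2) (vol : V [⋀^Fin (m + 2)]→ₗ[ℝ] ℝ) (r : ι → ι → Dual ℝ V)
    (hr : ∀ a c, r a c = - r c a) (ζ : V) (hζ : ∀ c, f.coord c ζ = ∑ a, r c a (f a))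
    (v : Fin (m + 1) → V) :
    ∑ i : Fin (m + 1), (-1) ^ (i : ℕ) * ∑ a, ∑ c, 2⁻¹ * r a c (v i)
        * vol (Matrix.vecCons (f c) (Matrix.vecCons (f a) (i.removeNth v)))
      = - vol (Matrix.vecCons ζ v) := by
  have key : ∀ (a c : ι), ∑ i : Fin (m + 1), (-1) ^ (i : ℕ) * (r a c (v i)
        * vol (Matrix.vecCons (f c) (Matrix.vecCons (f a) (i.removeNth v))))
      = r a c (f a) * vol (Matrix.vecCons (f c) v) - r a c (f c) * vol (Matrix.vecCons (f a) v) := by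
    intro a c
    have h := sum_wedge_top_eq_zero hm (r a c) vol (Matrix.vecCons (f c) (Matrix.vecCons (f a) v))
    rw [Fin.sum_univ_succ, Fin.sum_univ_succ] at h
    have e1 : (Fin.succ (0 : Fin (m + 2))).removeNth (Matrix.vecCons (f c) (Matrix.vecCons (f a) v))
        = Matrix.vecCons (f c) v := by
      ext i
      refine Fin.cases rfl (fun i ↦ ?_) i
      simp [Fin.removeNth, Fin.succAbove]
    have e2 : ∀ i : Fin (m + 1), i.succ.succ.removeNth (Matrix.vecCons (f c) (Matrix.vecCons (f a) v))
        = Matrix.vecCons (f c) (Matrix.vecCons (f a) (i.removeNth v)) := by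
      intro i
      ext j
      refine Fin.cases (by simp [Fin.removeNth]) (fun j ↦ ?_) j
      refine Fin.cases (by simp [Fin.removeNth]) (fun j ↦ ?_) j
      simp [Fin.removeNth]
    have e0 : (0 : Fin (m + 3)).removeNth (Matrix.vecCons (f c) (Matrix.vecCons (f a) v))
        = Matrix.vecCons (f a) v := by
      ext i; simp [Fin.removeNth]
    simp only [e0, e1, e2] at h
    simp only [Fin.val_succ, Fin.val_zero, pow_zero, Matrix.cons_val_zero, Matrix.cons_val_succ,
      pow_succ, one_mul, mul_neg, mul_one, neg_neg] at h
    have h0 : (Matrix.vecCons (f c) (Matrix.vecCons (f a) v) : Fin (m + 3) → V) 0 = f c := rfl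
    linarith
  have hζ' : ζ = ∑ c, (∑ a, r c a (f a)) • f c := by
    conv_lhs => rw [← f.sum_repr ζ]
    exact Finset.sum_congr rfl fun c _ ↦ by rw [← hζ]; rfl
  have hvol : vol (Matrix.vecCons ζ v) = ∑ c, ∑ a, r c a (f a) * vol (Matrix.vecCons (f c) v) := by
    have : ∀ u, vol (Matrix.vecCons u v) = vol.curryLeft u v := fun u ↦ rfl
    rw [this, hζ', map_sum, sum_apply_form]
    refine Finset.sum_congr rfl fun c _ ↦ ?_
    rw [map_smul, AlternatingMap.smul_apply, smul_eq_mul, Finset.sum_mul]; rfl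
  have hL : ∑ i : Fin (m + 1), (-1) ^ (i : ℕ) * ∑ a, ∑ c, 2⁻¹ * r a c (v i)
        * vol (Matrix.vecCons (f c) (Matrix.vecCons (f a) (i.removeNth v)))
      = ∑ a, ∑ c, 2⁻¹ * (r a c (f a) * vol (Matrix.vecCons (f c) v)
        - r a c (f c) * vol (Matrix.vecCons (f a) v)) := by
    simp only [← key, Finset.mul_sum]
    rw [Finset.sum_comm]
    refine Finset.sum_congr rfl fun a _ ↦ ?_
    rw [Finset.sum_comm]
    refine Finset.sum_congr rfl fun c _ ↦ Finset.sum_congr rfl fun i _ ↦ ?_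
    ring
  have hA : ∑ a, ∑ c, r a c (f a) * vol (Matrix.vecCons (f c) v) = - vol (Matrix.vecCons ζ v) := by
    rw [hvol, Finset.sum_comm, ← Finset.sum_neg_distrib]
    refine Finset.sum_congr rfl fun c _ ↦ ?_
    rw [← Finset.sum_neg_distrib]
    refine Finset.sum_congr rfl fun a _ ↦ ?_
    rw [hr]; simp
  rw [hL]
  simp only [mul_sub, Finset.sum_sub_distrib]
  simp only [← Finset.mul_sum]
  rw [hA, ← hvol]
  ring

end LeafContraction

/-! ### The relation `i_Z τ = -d i_P τ` in coordinates. -/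

section LeafModel

set_option maxSynthPendingDepth 3

variable {E : Type*} [NormedAddCommGroup E] [NormedSpace ℝ E] [FiniteDimensional ℝ E]
  {F : Submodule ℝ E}

/-- A bivector on `E`, restricted to a bivector on a subspace by means of a projection. -/
def restrictSharp (pr : E →L[ℝ] F) (P : (E →L[ℝ] ℝ) →L[ℝ] E) : Dual ℝ F →ₗ[ℝ] F :=
  (pr ∘L P ∘L (ContinuousLinearMap.compL ℝ E F ℝ).flip pr).toLinearMap
    ∘ₗ LinearMap.toContinuousLinearMap.toLinearMap

theorem restrictSharp_apply (pr : E →L[ℝ] F) (P : (E →L[ℝ] ℝ) →L[ℝ] E) (β : Dual ℝ F) :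
    restrictSharp pr P β = pr (P (LinearMap.toContinuousLinearMap β ∘L pr)) := rfl

variable {P : E → (E →L[ℝ] ℝ) →L[ℝ] E} {z : E} {m : ℕ}

/-- In a basis of `F`, the form `i_P(c vol)` is a combination of constant forms `ψ a b` with
coefficients `g a b / 2`, so its exterior derivative only involves the differentials of the `g a b`
and `sum_coeff_contract` applies. The function `s` plays the role of `log |c|`, and `pr` extends
forms on `F` to `E`. -/
theorem extDeriv_contract (hm : finrank ℝ F = m + 2) (pr : E →L[ℝ] F) (hpr : ∀ v : F, pr v = v)
    (hP : DifferentiableAt ℝ P z) (hs : ∀ z (α : E →L[ℝ] ℝ), α (P z α) = 0)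
    (hF : ∀ᶠ w in nhds z, ∀ α, P w α ∈ F) {c : E → ℝ} (hc : DifferentiableAt ℝ c z)
    {s : E → ℝ} (hsc : c z • fderiv ℝ s z = fderiv ℝ c z)
    (vol : F [⋀^Fin (m + 2)]→ₗ[ℝ] ℝ) :
    DifferentiableAt ℝ (fun w ↦ toContAlt ((contract (restrictSharp pr (P w)) (c w • vol)).compLinearMap
      pr.toLinearMap)) z ∧ ∀ v : Fin (m + 1) → F,
    _root_.extDeriv (fun w ↦ toContAlt ((contract (restrictSharp pr (P w)) (c w • vol)).compLinearMap
      pr.toLinearMap)) z (fun i ↦ v i)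
      = - (c z • vol) (Matrix.vecCons (pr (modelModular P s z)) v) := by
  let f := finBasis ℝ F
  let fc : Fin (finrank ℝ F) → E →L[ℝ] ℝ := fun a ↦ LinearMap.toContinuousLinearMap (f.coord a) ∘L pr
  let g : Fin (finrank ℝ F) → Fin (finrank ℝ F) → E → ℝ := fun a b w ↦ fc b (P w (fc a)) * c w
  let ψ : Fin (finrank ℝ F) → Fin (finrank ℝ F) → E [⋀^Fin m]→L[ℝ] ℝ := fun a b ↦
    toContAlt (((vol.curryLeft (f b)).curryLeft (f a)).compLinearMap pr.toLinearMap)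
  have hω : (fun w ↦ toContAlt ((contract (restrictSharp pr (P w)) (c w • vol)).compLinearMap
      pr.toLinearMap)) = fun w ↦ ∑ a, ∑ b, (2⁻¹ * g a b w) • ψ a b := by
    funext w
    ext v
    simp only [toContAlt_apply, AlternatingMap.compLinearMap_apply, contract_eq_sum f,
      ContinuousAlternatingMap.sum_apply, ContinuousAlternatingMap.smul_apply, ψ, smul_eq_mul]
    refine Finset.sum_congr rfl fun a _ ↦ Finset.sum_congr rfl fun b _ ↦ ?_
    rw [AlternatingMap.smul_apply, smul_eq_mul, restrictSharp_apply]
    change 2⁻¹ * (fc b (P w (fc a))) * (c w * _) = 2⁻¹ * (fc b (P w (fc a)) * c w) * _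
    rw [mul_assoc, mul_assoc, mul_assoc]; rfl
  have hgd : ∀ a b, HasFDerivAt (g a b)
      (fc b (P z (fc a)) • fderiv ℝ c z + c z • (fc b ∘L (fderiv ℝ P z).flip (fc a))) z := by
    intro a b
    have h1 : HasFDerivAt (fun w ↦ fc b (P w (fc a))) (fc b ∘L (fderiv ℝ P z).flip (fc a)) z := by
      have h2 := hP.hasFDerivAt.clm_apply (hasFDerivAt_const (fc a) z)
      have h3 : HasFDerivAt (fun w ↦ fc b (P w (fc a))) _ z := (fc b).hasFDerivAt.comp z h2
      refine h3.congr_fderiv ?_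
      ext v; simp
    exact h1.mul hc.hasFDerivAt
  have hωd : HasFDerivAt (fun w ↦ ∑ a, ∑ b, (2⁻¹ * g a b w) • ψ a b)
      (∑ a, ∑ b, ((2⁻¹ : ℝ) • (fc b (P z (fc a)) • fderiv ℝ c z
        + c z • (fc b ∘L (fderiv ℝ P z).flip (fc a)))).smulRight (ψ a b)) z := by
    refine HasFDerivAt.fun_sum fun a _ ↦ HasFDerivAt.fun_sum fun b _ ↦ ?_
    exact ((hgd a b).const_mul 2⁻¹).smul_const (ψ a b)
  rw [hω]
  refine ⟨hωd.differentiableAt, fun v ↦ ?_⟩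
  let ι : F →L[ℝ] E := F.subtypeL
  let r : Fin (finrank ℝ F) → Fin (finrank ℝ F) → Dual ℝ F := fun a b ↦
    ((fderiv ℝ (g a b) z) ∘L ι).toLinearMap
  have hr : ∀ a b, r a b = - r b a := by
    intro a b
    have : g a b = fun w ↦ - g b a w := by
      funext w
      change fc b (P w (fc a)) * c w = - (fc a (P w (fc b)) * c w)
      rw [skew_of_alt (hs w)]; ring
    ext u
    change fderiv ℝ (g a b) z u = - fderiv ℝ (g b a) z u
    rw [this, fderiv_fun_neg]; rfl
  have hPF : ∀ v α, fderiv ℝ P z v α ∈ F := by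
    intro v α
    have h := fderiv_mem_of_eventually_mem (F := F) (U := fun w ↦ P w α)
      (hF.mono fun w hw ↦ hw α) (hP.hasFDerivAt.clm_apply (hasFDerivAt_const α z)) v
    simpa using h
  have hprF : ∀ u ∈ F, (pr u : E) = u := fun u hu ↦ congrArg Subtype.val (hpr ⟨u, hu⟩)
  have hζ : ∀ a, f.coord a (c z • pr (modelModular P s z)) = ∑ b, r a b (f b) := by
    intro a
    have h1 : f.coord a (c z • pr (modelModular P s z)) = c z * fc a (modelModular P s z) := by
      rw [map_smul]; rfl
    -- The derivative of `P` takes values in `F`, so its trace over `E` is a trace over `F`.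
    have htr : traceCLM E ((fderiv ℝ P z).flip (fc a)) = ∑ b, fc b (fderiv ℝ P z (f b) (fc a)) := by
      have e1 : (fderiv ℝ P z).flip (fc a) = ι ∘L (pr ∘L (fderiv ℝ P z).flip (fc a)) := by
        ext v; exact (hprF _ (hPF v (fc a))).symm
      have e2 : traceCLM E ((fderiv ℝ P z).flip (fc a))
          = LinearMap.trace ℝ F ((pr ∘L (fderiv ℝ P z).flip (fc a)) ∘L ι).toLinearMap := by
        conv_lhs => rw [e1]
        exact LinearMap.trace_comp_comm' (pr ∘L (fderiv ℝ P z).flip (fc a)).toLinearMap ι.toLinearMap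
      rw [e2, LinearMap.trace_eq_matrix_trace ℝ f, Matrix.trace]
      refine Finset.sum_congr rfl fun b _ ↦ ?_
      simp only [Matrix.diag_apply, LinearMap.toMatrix_apply]
      rfl
    have hsum : P z (fc a) = ∑ b, fc b (P z (fc a)) • (f b : E) := by
      have h2 := f.sum_repr (pr (P z (fc a)))
      have h3 := congrArg Subtype.val h2
      rw [hprF _ (hF.self_of_nhds _)] at h3
      rw [← h3]
      conv_rhs => rw [h3]
      simp only [Submodule.coe_sum, Submodule.coe_smul]
      rfl
    rw [h1, apply_modelModular, htr, mul_add]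
    have h4 : c z * fderiv ℝ s z (P z (fc a)) = fderiv ℝ c z (P z (fc a)) := by
      rw [← hsc]; rfl
    have h5 : fderiv ℝ c z (P z (fc a)) = ∑ b, fc b (P z (fc a)) * fderiv ℝ c z (f b) := by
      conv_lhs => rw [hsum]
      simp [map_sum]
    rw [h4, h5, Finset.mul_sum, ← Finset.sum_add_distrib]
    refine Finset.sum_congr rfl fun b _ ↦ ?_
    change _ = fderiv ℝ (g a b) z (f b)
    rw [(hgd a b).fderiv]
    simp only [add_apply, smul_apply, smul_eq_mul]
    rw [add_comm]; rfl
  have key := sum_coeff_contract f hm vol r hr _ hζ v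
  have h6 : (c z • vol) (Matrix.vecCons (pr (modelModular P s z)) v)
      = vol (Matrix.vecCons (c z • pr (modelModular P s z)) v) :=
    (vol.map_vecCons_smul v (c z) _).symm
  rw [h6, ← key, extDeriv_apply hωd.differentiableAt]
  refine Finset.sum_congr rfl fun i _ ↦ ?_
  rw [fderiv_continuousAlternatingMap_apply_const_apply hωd.differentiableAt, hωd.fderiv]
  simp only [_root_.sum_apply, ContinuousAlternatingMap.sum_apply,
    zsmul_eq_mul, Int.cast_pow, Int.cast_neg, Int.cast_one]
  congr 1
  refine Finset.sum_congr rfl fun a _ ↦ Finset.sum_congr rfl fun b _ ↦ ?_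
  change (2⁻¹ * _) * _ = 2⁻¹ * fderiv ℝ (g a b) z (v i) * _
  rw [(hgd a b).fderiv]
  congr 1
  change vol (Matrix.vecCons (f b) (Matrix.vecCons (f a) fun j ↦ pr (v (i.succAbove j)))) = _
  simp only [hpr]
  rfl

end LeafModel

/-! ### Functions, vector fields and Lie brackets in a chart. -/

section Charts

set_option maxSynthPendingDepth 3

variable {E : Type*} [NormedAddCommGroup E] [NormedSpace ℝ E]
  {M : Type*} [TopologicalSpace M] [ChartedSpace E M]
  {φ : OpenPartialHomeomorph M E} {z : E}

/-- The derivative of a chart `φ` at the point with coordinates `z`. -/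
def chartD (φ : OpenPartialHomeomorph M E) (z : E) :
    TangentSpace 𝓘(ℝ, E) (φ.symm z) →ₗ[ℝ] E :=
  (mfderiv 𝓘(ℝ, E) 𝓘(ℝ, E) φ (φ.symm z)).toLinearMap

/-- The derivative of the inverse of a chart `φ` at the point with coordinates `z`. -/
def chartI (φ : OpenPartialHomeomorph M E) (z : E) :
    E →ₗ[ℝ] TangentSpace 𝓘(ℝ, E) (φ.symm z) :=
  (mfderiv 𝓘(ℝ, E) 𝓘(ℝ, E) φ.symm z).toLinearMap

/-- The coordinate expression of a vector field. -/
def chartField (φ : OpenPartialHomeomorph M E) (X : ∀ x : M, TangentSpace 𝓘(ℝ, E) x) (z : E) : E :=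
  chartD φ z (X (φ.symm z))

variable [IsManifold 𝓘(ℝ, E) ∞ M]

theorem mdifferentiableAt_chart (hφ : φ ∈ IsManifold.maximalAtlas 𝓘(ℝ, E) ∞ M) (hz : z ∈ φ.target) :
    MDifferentiableAt 𝓘(ℝ, E) 𝓘(ℝ, E) φ (φ.symm z) :=
  (contMDiffAt_of_mem_maximalAtlas hφ (φ.map_target hz)).mdifferentiableAt (by simp)

theorem mdifferentiableAt_chart_symm (hφ : φ ∈ IsManifold.maximalAtlas 𝓘(ℝ, E) ∞ M) (hz : z ∈ φ.target) :
    MDifferentiableAt 𝓘(ℝ, E) 𝓘(ℝ, E) φ.symm z :=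
  (contMDiffAt_symm_of_mem_maximalAtlas hφ hz).mdifferentiableAt (by simp)

theorem chartD_comp_chartI (hφ : φ ∈ IsManifold.maximalAtlas 𝓘(ℝ, E) ∞ M) (hz : z ∈ φ.target) :
    (mfderiv 𝓘(ℝ, E) 𝓘(ℝ, E) φ (φ.symm z)).comp
        (mfderiv 𝓘(ℝ, E) 𝓘(ℝ, E) φ.symm z) = ContinuousLinearMap.id ℝ E := by
  have h3 : mfderiv 𝓘(ℝ, E) 𝓘(ℝ, E) (φ ∘ φ.symm) z = mfderiv 𝓘(ℝ, E) 𝓘(ℝ, E) id z :=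
    Filter.EventuallyEq.mfderiv_eq (φ.eventually_right_inverse hz)
  exact (mfderiv_comp z (mdifferentiableAt_chart hφ hz)
    (mdifferentiableAt_chart_symm hφ hz)).symm.trans (h3.trans mfderiv_id)

theorem chartI_comp_chartD (hφ : φ ∈ IsManifold.maximalAtlas 𝓘(ℝ, E) ∞ M) (hz : z ∈ φ.target) :
    (mfderiv 𝓘(ℝ, E) 𝓘(ℝ, E) φ.symm z).comp
        (mfderiv 𝓘(ℝ, E) 𝓘(ℝ, E) φ (φ.symm z)) = ContinuousLinearMap.id ℝ E := by
  have hd'' : MDifferentiableAt 𝓘(ℝ, E) 𝓘(ℝ, E) φ.symm (φ (φ.symm z)) := by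
    rw [φ.right_inv hz]; exact mdifferentiableAt_chart_symm hφ hz
  have h3 := mfderiv_comp (φ.symm z) hd'' (mdifferentiableAt_chart hφ hz)
  rw [φ.right_inv hz] at h3
  have h4 : mfderiv 𝓘(ℝ, E) 𝓘(ℝ, E) (φ.symm ∘ φ) (φ.symm z)
      = mfderiv 𝓘(ℝ, E) 𝓘(ℝ, E) id (φ.symm z) :=
    Filter.EventuallyEq.mfderiv_eq (φ.eventually_left_inverse (φ.map_target hz))
  exact h3.symm.trans (h4.trans mfderiv_id)

theorem chartD_chartI (hφ : φ ∈ IsManifold.maximalAtlas 𝓘(ℝ, E) ∞ M) (hz : z ∈ φ.target) (v : E) :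
    chartD φ z (chartI φ z v) = v :=
  congrArg (fun L ↦ L v) (chartD_comp_chartI hφ hz)

theorem chartI_chartD (hφ : φ ∈ IsManifold.maximalAtlas 𝓘(ℝ, E) ∞ M) (hz : z ∈ φ.target)
    (v : TangentSpace 𝓘(ℝ, E) (φ.symm z)) : chartI φ z (chartD φ z v) = v :=
  congrArg (fun L ↦ L v) (chartI_comp_chartD hφ hz)

/-- The derivative of a chart as an isomorphism. -/
def chartEquiv (hφ : φ ∈ IsManifold.maximalAtlas 𝓘(ℝ, E) ∞ M) (hz : z ∈ φ.target) :
    TangentSpace 𝓘(ℝ, E) (φ.symm z) ≃ₗ[ℝ] E :=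
  LinearEquiv.ofLinearMap (chartD φ z) (chartI φ z) (LinearMap.ext (chartD_chartI hφ hz))
    (LinearMap.ext (chartI_chartD hφ hz))

theorem chartSymm_inverse (hφ : φ ∈ IsManifold.maximalAtlas 𝓘(ℝ, E) ∞ M) (hz : z ∈ φ.target)
    (v : TangentSpace 𝓘(ℝ, E) (φ.symm z)) :
    ((mfderiv 𝓘(ℝ, E) 𝓘(ℝ, E) φ.symm z).inverse v : E) = chartD φ z v :=
  congrArg (fun L ↦ L v)
    (ContinuousLinearMap.inverse_eq (chartI_comp_chartD hφ hz) (chartD_comp_chartI hφ hz))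

theorem chart_isInvertible (hφ : φ ∈ IsManifold.maximalAtlas 𝓘(ℝ, E) ∞ M) (hz : z ∈ φ.target) :
    (mfderiv 𝓘(ℝ, E) 𝓘(ℝ, E) φ (φ.symm z)).IsInvertible :=
  .of_inverse (chartD_comp_chartI hφ hz) (chartI_comp_chartD hφ hz)

theorem chartSymm_isInvertible (hφ : φ ∈ IsManifold.maximalAtlas 𝓘(ℝ, E) ∞ M) (hz : z ∈ φ.target) :
    (mfderiv 𝓘(ℝ, E) 𝓘(ℝ, E) φ.symm z).IsInvertible :=
  .of_inverse (chartI_comp_chartD hφ hz) (chartD_comp_chartI hφ hz)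

theorem contDiffAt_chart (hφ : φ ∈ IsManifold.maximalAtlas 𝓘(ℝ, E) ∞ M) (hz : z ∈ φ.target)
    {f : M → ℝ} (hf : ContMDiffAt 𝓘(ℝ, E) 𝓘(ℝ) ∞ f (φ.symm z)) : ContDiffAt ℝ ∞ (f ∘ φ.symm) z :=
  contMDiffAt_iff_contDiffAt.1 (hf.comp z (contMDiffAt_symm_of_mem_maximalAtlas hφ hz))

theorem contMDiffAt_of_chart (hφ : φ ∈ IsManifold.maximalAtlas 𝓘(ℝ, E) ∞ M) (hz : z ∈ φ.target)
    {f : M → ℝ} (hf : ContDiffAt ℝ ∞ (f ∘ φ.symm) z) : ContMDiffAt 𝓘(ℝ, E) 𝓘(ℝ) ∞ f (φ.symm z) := by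
  have h1 : ContMDiffAt 𝓘(ℝ, E) 𝓘(ℝ) ∞ ((f ∘ φ.symm) ∘ φ) (φ.symm z) :=
    ContMDiffAt.comp (φ.symm z) (by rw [φ.right_inv hz]; exact hf.contMDiffAt)
      (contMDiffAt_of_mem_maximalAtlas hφ (φ.map_target hz))
  refine h1.congr_of_eventuallyEq ?_
  filter_upwards [φ.eventually_left_inverse (φ.map_target hz)] with y hy
  simp [hy]

theorem dAt_chart (hφ : φ ∈ IsManifold.maximalAtlas 𝓘(ℝ, E) ∞ M) (hz : z ∈ φ.target)
    {f : M → ℝ} (hf : ContMDiffAt 𝓘(ℝ, E) 𝓘(ℝ) ∞ f (φ.symm z)) (v : TangentSpace 𝓘(ℝ, E) (φ.symm z)) :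
    dAt E f (φ.symm z) v = fderiv ℝ (f ∘ φ.symm) z (chartD φ z v) := by
  have h1 := mfderiv_comp z (hf.mdifferentiableAt (by simp)) (mdifferentiableAt_chart_symm hφ hz)
  rw [mfderiv_eq_fderiv] at h1
  have h2 := congrArg (fun L ↦ L (chartD φ z v)) h1
  refine Eq.trans ?_ h2.symm
  change _ = mfderiv 𝓘(ℝ, E) 𝓘(ℝ) f (φ.symm z) (chartI φ z (chartD φ z v))
  rw [chartI_chartD hφ hz]
  rfl

theorem eventually_target (hz : z ∈ φ.target) : ∀ᶠ w in nhds z, w ∈ φ.target :=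
  φ.open_target.mem_nhds hz

variable [FiniteDimensional ℝ E]

theorem contDiffAt_chartField (hφ : φ ∈ IsManifold.maximalAtlas 𝓘(ℝ, E) ∞ M) (hz : z ∈ φ.target)
    (X : VField E M) : ContDiffAt ℝ ∞ (chartField φ X) z := by
  have : CompleteSpace E := FiniteDimensional.complete ℝ E
  have h1 : IsManifold 𝓘(ℝ, E) 1 M := inferInstance
  have h := ContMDiffAt.mpullback_vectorField_preimage (m := ∞) (n := ∞) (X.contMDiff (φ.symm z))
    (contMDiffAt_symm_of_mem_maximalAtlas hφ hz) (chartSymm_isInvertible hφ hz) (by simp)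
  rw [contMDiffAt_vectorSpace_iff_contDiffAt] at h
  refine h.congr_of_eventuallyEq ?_
  filter_upwards [eventually_target hz] with w hw
  rw [mpullback_apply]
  exact (chartSymm_inverse hφ hw _).symm

theorem contMDiffAt_section_of_chart (hφ : φ ∈ IsManifold.maximalAtlas 𝓘(ℝ, E) ∞ M) (hz : z ∈ φ.target)
    {X : ∀ x : M, TangentSpace 𝓘(ℝ, E) x} {V : E → E} (hV : ContDiffAt ℝ ∞ V z)
    (hX : ∀ᶠ w in nhds z, chartField φ X w = V w) :
    ContMDiffAt 𝓘(ℝ, E) (𝓘(ℝ, E).prod 𝓘(ℝ, E)) ∞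
      (fun x ↦ (⟨x, X x⟩ : Bundle.TotalSpace E (TangentSpace 𝓘(ℝ, E)))) (φ.symm z) := by
  have : CompleteSpace E := FiniteDimensional.complete ℝ E
  have h1 : IsManifold 𝓘(ℝ, E) 1 M := inferInstance
  have h := ContMDiffAt.mpullback_vectorField_preimage (I := 𝓘(ℝ, E)) (I' := 𝓘(ℝ, E)) (m := ∞) (n := ∞) (f := φ)
    (x₀ := φ.symm z) (V := fun w ↦ (V w : TangentSpace 𝓘(ℝ, E) w))
    (by rw [φ.right_inv hz]; exact contMDiffAt_vectorSpace_iff_contDiffAt.2 hV)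
    (contMDiffAt_of_mem_maximalAtlas hφ (φ.map_target hz)) (chart_isInvertible hφ hz) (by simp)
  refine h.congr_of_eventuallyEq ?_
  have hc := (φ.continuousAt (φ.map_target hz))
  rw [ContinuousAt, φ.right_inv hz] at hc
  filter_upwards [hc.eventually hX, φ.open_source.mem_nhds (φ.map_target hz)] with y hy hys
  have hw := φ.map_source hys
  have hl := φ.left_inv hys
  obtain ⟨w, hw', rfl⟩ : ∃ w ∈ φ.target, y = φ.symm w := ⟨φ y, hw, hl.symm⟩
  rw [φ.right_inv hw'] at hy
  congr 1
  have h2 : (mfderiv 𝓘(ℝ, E) 𝓘(ℝ, E) φ (φ.symm w)).inverse = mfderiv 𝓘(ℝ, E) 𝓘(ℝ, E) φ.symm w :=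
    ContinuousLinearMap.inverse_eq (chartD_comp_chartI hφ hw') (chartI_comp_chartD hφ hw')
  refine Eq.trans ?_ (congrArg (fun L ↦ L (V (φ (φ.symm w)))) h2).symm
  change _ = chartI φ w (V (φ (φ.symm w)))
  rw [φ.right_inv hw', ← hy]
  exact (chartI_chartD hφ hw' _).symm

theorem chartD_mlieBracket (hφ : φ ∈ IsManifold.maximalAtlas 𝓘(ℝ, E) ∞ M) (hz : z ∈ φ.target)
    {X Y : ∀ x : M, TangentSpace 𝓘(ℝ, E) x}
    (hX : ContMDiff 𝓘(ℝ, E) (𝓘(ℝ, E).prod 𝓘(ℝ, E)) ∞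
      (fun x ↦ (⟨x, X x⟩ : Bundle.TotalSpace E (TangentSpace 𝓘(ℝ, E)))))
    (hY : ContMDiff 𝓘(ℝ, E) (𝓘(ℝ, E).prod 𝓘(ℝ, E)) ∞
      (fun x ↦ (⟨x, Y x⟩ : Bundle.TotalSpace E (TangentSpace 𝓘(ℝ, E))))) :
    chartD φ z (mlieBracket 𝓘(ℝ, E) X Y (φ.symm z))
      = lieBracket ℝ (chartField φ X) (chartField φ Y) z := by
  have : CompleteSpace E := FiniteDimensional.complete ℝ E
  have hM2 : IsManifold 𝓘(ℝ, E) (minSmoothness ℝ 2) M := by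
    simp only [minSmoothness_of_isRCLikeNormedField]; infer_instance
  have h := mpullback_mlieBracket (I := 𝓘(ℝ, E)) (I' := 𝓘(ℝ, E)) (n := ∞) (f := φ.symm)
    (x₀ := z) (hX.mdifferentiableAt (by simp)) (hY.mdifferentiableAt (by simp))
    (contMDiffAt_symm_of_mem_maximalAtlas hφ hz)
    (by simp only [minSmoothness_of_isRCLikeNormedField]; exact ENat.LEInfty.out)
  rw [mpullback_apply] at h
  have hev : ∀ U : ∀ x : M, TangentSpace 𝓘(ℝ, E) x,
      (mpullback 𝓘(ℝ, E) 𝓘(ℝ, E) φ.symm U : E → E) =ᶠ[nhds z] chartField φ U := by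
    intro U
    filter_upwards [eventually_target hz] with w hw
    rw [mpullback_apply]
    exact chartSymm_inverse hφ hw _
  refine ((chartSymm_inverse hφ hz _).symm.trans h).trans ?_
  rw [← mlieBracketWithin_univ, mlieBracketWithin_eq_lieBracketWithin]
  refine (congrFun lieBracketWithin_univ z).trans ?_
  exact Filter.EventuallyEq.lieBracket_vectorField_eq (hev X) (hev Y)

variable [T2Space M]

theorem exists_cutoff {x : M} {U : Set M} (hU : U ∈ nhds x) :
    ∃ χ : SFun E M, (∀ᶠ y in nhds x, χ y = 1) ∧ tsupport χ ⊆ U := by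
  obtain ⟨f, -, hf⟩ := (SmoothBumpFunction.nhds_basis_tsupport (I := 𝓘(ℝ, E)) x).mem_iff.1 hU
  exact ⟨⟨f, f.contMDiff⟩, f.eventuallyEq_one, hf⟩

/-- Applied to linear functions, this realizes every constant covector near a point as the
differential of a global function. It is what turns identities for global functions into tensorial
identities in coordinates. -/
theorem exists_extension (hφ : φ ∈ IsManifold.maximalAtlas 𝓘(ℝ, E) ∞ M) (hz : z ∈ φ.target)
    {g : E → ℝ} (hg : ContDiff ℝ ∞ g) : ∃ f : SFun E M, f ∘ φ.symm =ᶠ[nhds z] g := by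
  obtain ⟨χ, hχ, hs⟩ := exists_cutoff (E := E) (φ.open_source.mem_nhds (φ.map_target hz))
  refine ⟨⟨fun x ↦ χ x * g (φ x), contMDiff_of_tsupport fun x hx ↦ ?_⟩, ?_⟩
  · have hx' : x ∈ φ.source := by
      apply hs
      refine closure_mono ?_ hx
      intro y hy hy'
      apply hy
      simp [hy']
    exact χ.contMDiff.contMDiffAt.mul (hg.contMDiff.contMDiffAt.comp x
      (contMDiffAt_of_mem_maximalAtlas hφ hx'))
  · have hc := (φ.continuousAt_symm hz).eventually hχ
    filter_upwards [hc, eventually_target hz] with w hw hwt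
    change χ (φ.symm w) * g (φ (φ.symm w)) = g w
    rw [hw, φ.right_inv hwt, one_mul]

/-- The last two clauses make the extension of a vector `v ∈ F` tangent to the foliation on all of
`M`, not only near the point. -/
theorem exists_field_extension (hφ : φ ∈ IsManifold.maximalAtlas 𝓘(ℝ, E) ∞ M) (hz : z ∈ φ.target)
    (v : E) : ∃ X : VField E M, (∀ᶠ w in nhds z, chartField φ X w = v) ∧
      (∀ x ∉ φ.source, X x = 0) ∧ ∀ w ∈ φ.target, ∃ c : ℝ, chartField φ X w = c • v := by
  have : CompleteSpace E := FiniteDimensional.complete ℝ E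
  have h1 : IsManifold 𝓘(ℝ, E) 1 M := inferInstance
  obtain ⟨χ, hχ, hs⟩ := exists_cutoff (E := E) (φ.open_source.mem_nhds (φ.map_target hz))
  let V' : ∀ x : M, TangentSpace 𝓘(ℝ, E) x := mpullback 𝓘(ℝ, E) 𝓘(ℝ, E) φ fun _ ↦ v
  have hVV : ∀ w ∈ φ.target, chartField φ V' w = v := by
    intro w hw
    have h2 : (mfderiv 𝓘(ℝ, E) 𝓘(ℝ, E) φ (φ.symm w)).inverse = mfderiv 𝓘(ℝ, E) 𝓘(ℝ, E) φ.symm w :=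
      ContinuousLinearMap.inverse_eq (chartD_comp_chartI hφ hw) (chartI_comp_chartD hφ hw)
    have h3 : V' (φ.symm w) = chartI φ w v := congrArg (fun L ↦ L v) h2
    rw [chartField, h3, chartD_chartI hφ hw]
  have hV : ContMDiffOn 𝓘(ℝ, E) (𝓘(ℝ, E).prod 𝓘(ℝ, E)) ∞
      (fun x ↦ (⟨x, V' x⟩ : Bundle.TotalSpace E (TangentSpace 𝓘(ℝ, E)))) φ.source := by
    intro x hx
    refine ContMDiffAt.contMDiffWithinAt ?_
    have hx' := φ.map_source hx
    have := contMDiffAt_section_of_chart hφ hx' (X := V') (V := fun _ ↦ v) contDiffAt_const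
      ((eventually_target hx').mono hVV)
    rwa [φ.left_inv hx] at this
  have hsm := ContMDiffOn.smul_section_of_tsupport χ.contMDiff.contMDiffOn φ.open_source hs hV
  have hX : ∀ w ∈ φ.target, chartField φ (fun x ↦ χ x • V' x) w = χ (φ.symm w) • v := by
    intro w hw
    rw [chartField, map_smul]
    exact congrArg _ (hVV w hw)
  refine ⟨⟨fun x ↦ χ x • V' x, hsm⟩, ?_, ?_, fun w hw ↦ ⟨_, hX w hw⟩⟩
  · filter_upwards [(φ.continuousAt_symm hz).eventually hχ, eventually_target hz] with w hw hwt
    exact (hX w hwt).trans (by rw [hw, one_smul])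
  · intro x hx
    have : χ x = 0 := image_eq_zero_of_notMem_tsupport fun h ↦ hx (hs h)
    change χ x • V' x = 0
    rw [this, zero_smul]

end Charts

/-! ### Bivector fields and the Poisson conditions in a chart. -/

section ChartBivectors

set_option maxSynthPendingDepth 3

variable {E : Type*} [NormedAddCommGroup E] [NormedSpace ℝ E] [FiniteDimensional ℝ E]

theorem contDiffAt_of_forall_coord {V : Type*} [NormedAddCommGroup V] [NormedSpace ℝ V] {f : V → E}
    {z : V} {n : ℕ∞ω}
    (h : ∀ β : E →L[ℝ] ℝ, ContDiffAt ℝ n (fun w ↦ β (f w)) z) : ContDiffAt ℝ n f z := by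
  have : f = fun w ↦ ∑ i, coordCLM E i (f w) • finBasis ℝ E i :=
    funext fun w ↦ (sum_coordCLM_smul (f w)).symm
  rw [this]
  exact ContDiffAt.sum fun i _ ↦ (h _).smul contDiffAt_const

theorem contDiffAt_sharp_of_forall {V : Type*} [NormedAddCommGroup V] [NormedSpace ℝ V]
    {P : V → (E →L[ℝ] ℝ) →L[ℝ] E} {z : V} {n : ℕ∞ω}
    (h : ∀ α β : E →L[ℝ] ℝ, ContDiffAt ℝ n (fun w ↦ β (P w α)) z) : ContDiffAt ℝ n P z := by
  let ev : Fin (finrank ℝ E) → (E →L[ℝ] ℝ) →L[ℝ] ℝ := fun i ↦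
    ContinuousLinearMap.apply ℝ ℝ (finBasis ℝ E i)
  have : P = fun w ↦ ∑ i, (ev i).smulRight (P w (coordCLM E i)) := by
    funext w
    ext α
    conv_lhs => rw [← sum_smul_coordCLM α]
    simp [ev]
  rw [this]
  refine ContDiffAt.sum fun i _ ↦ ?_
  exact ((ContinuousLinearMap.smulRightL ℝ (E →L[ℝ] ℝ) E (ev i)).contDiff.contDiffAt).comp z
    (contDiffAt_of_forall_coord fun β ↦ h _ β)

variable {M : Type*} [TopologicalSpace M] [ChartedSpace E M]
  {φ : OpenPartialHomeomorph M E} {z : E}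

/-- The coordinate expression of a bivector field. -/
def chartSharp (φ : OpenPartialHomeomorph M E) (B : BivectorField E M) (z : E) :
    (E →L[ℝ] ℝ) →L[ℝ] E :=
  LinearMap.toContinuousLinearMap (chartD φ z ∘ₗ B.sharp (φ.symm z) ∘ₗ (chartD φ z).dualMap
    ∘ₗ ContinuousLinearMap.coeLM ℝ)

variable (B : BivectorField E M)

theorem chartSharp_apply (z : E) (α : E →L[ℝ] ℝ) :
    chartSharp φ B z α = chartD φ z (B.sharp (φ.symm z) (α.toLinearMap ∘ₗ chartD φ z)) := rfl

theorem chartSharp_alt (z : E) (α : E →L[ℝ] ℝ) : α (chartSharp φ B z α) = 0 :=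
  B.alt (φ.symm z) (α.toLinearMap ∘ₗ chartD φ z)

variable [IsManifold 𝓘(ℝ, E) ∞ M]

theorem exists_coord {x : M} (hx : x ∈ φ.source) : ∃ z ∈ φ.target, x = φ.symm z :=
  ⟨φ x, φ.map_source hx, (φ.left_inv hx).symm⟩

theorem chartD_ham (hφ : φ ∈ IsManifold.maximalAtlas 𝓘(ℝ, E) ∞ M) (hz : z ∈ φ.target)
    {f : M → ℝ} (hf : ContMDiffAt 𝓘(ℝ, E) 𝓘(ℝ) ∞ f (φ.symm z)) :
    chartField φ (B.ham f) z = chartSharp φ B z (fderiv ℝ (f ∘ φ.symm) z) := by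
  rw [chartField, BivectorField.ham, chartSharp_apply]
  congr 2
  ext v
  exact dAt_chart hφ hz hf v

theorem bracket_chart (hφ : φ ∈ IsManifold.maximalAtlas 𝓘(ℝ, E) ∞ M) (hz : z ∈ φ.target)
    {f g : M → ℝ} (hf : ContMDiffAt 𝓘(ℝ, E) 𝓘(ℝ) ∞ f (φ.symm z))
    (hg : ContMDiffAt 𝓘(ℝ, E) 𝓘(ℝ) ∞ g (φ.symm z)) :
    B.bracket f g (φ.symm z) = modelBracket (chartSharp φ B) (f ∘ φ.symm) (g ∘ φ.symm) z := by
  rw [BivectorField.bracket, dAt_chart hφ hz hg, modelBracket, ← chartD_ham B hφ hz hf]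
  rfl

theorem bracket_chart_eventually (hφ : φ ∈ IsManifold.maximalAtlas 𝓘(ℝ, E) ∞ M) (hz : z ∈ φ.target)
    {f g : M → ℝ} (hf : ContMDiff 𝓘(ℝ, E) 𝓘(ℝ) ∞ f)
    (hg : ContMDiff 𝓘(ℝ, E) 𝓘(ℝ) ∞ g) :
    B.bracket f g ∘ φ.symm =ᶠ[nhds z] modelBracket (chartSharp φ B) (f ∘ φ.symm) (g ∘ φ.symm) :=
  (eventually_target hz).mono fun _ hw ↦ bracket_chart B hφ hw (hf _) (hg _)

theorem contDiffAt_modelBracket {P : E → (E →L[ℝ] ℝ) →L[ℝ] E} {f g : E → ℝ} (hP : ContDiffAt ℝ ∞ P z)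
    (hf : ContDiffAt ℝ ∞ f z) (hg : ContDiffAt ℝ ∞ g z) : ContDiffAt ℝ ∞ (modelBracket P f g) z :=
  (hg.fderiv_right (m := ∞) (by simp)).clm_apply (hP.clm_apply (hf.fderiv_right (m := ∞) (by simp)))

theorem modelBracket_congr {P : E → (E →L[ℝ] ℝ) →L[ℝ] E} {f g f' g' : E → ℝ} (hf : f =ᶠ[nhds z] f')
    (hg : g =ᶠ[nhds z] g') : modelBracket P f g z = modelBracket P f' g' z := by
  rw [modelBracket, modelBracket, hf.fderiv_eq, hg.fderiv_eq]

theorem modelBracket_linear (P : E → (E →L[ℝ] ℝ) →L[ℝ] E) (α β : E →L[ℝ] ℝ) (w : E) :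
    modelBracket P α β w = β (P w α) := by
  simp [modelBracket]

theorem contMDiff_bracket_at {f g : M → ℝ} (hφ : φ ∈ IsManifold.maximalAtlas 𝓘(ℝ, E) ∞ M) (hz : z ∈ φ.target)
    (hP : ContDiffAt ℝ ∞ (chartSharp φ B) z) (hf : ContMDiff 𝓘(ℝ, E) 𝓘(ℝ) ∞ f)
    (hg : ContMDiff 𝓘(ℝ, E) 𝓘(ℝ) ∞ g) :
    ContMDiffAt 𝓘(ℝ, E) 𝓘(ℝ) ∞ (B.bracket f g) (φ.symm z) :=
  contMDiffAt_of_chart hφ hz ((contDiffAt_modelBracket hP (contDiffAt_chart hφ hz (hf _))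
    (contDiffAt_chart hφ hz (hg _))).congr_of_eventuallyEq (bracket_chart_eventually B hφ hz hf hg))

theorem jacobi_chart (hφ : φ ∈ IsManifold.maximalAtlas 𝓘(ℝ, E) ∞ M) (hz : z ∈ φ.target)
    (hP : ContDiffAt ℝ ∞ (chartSharp φ B) z) (f g h : SFun E M)
    (hs : ∀ f g : SFun E M, ContMDiff 𝓘(ℝ, E) 𝓘(ℝ) ∞ (B.bracket f g)) :
    B.bracket f (B.bracket g h) (φ.symm z) + B.bracket g (B.bracket h f) (φ.symm z)
        + B.bracket h (B.bracket f g) (φ.symm z)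
      = fderiv ℝ (h ∘ φ.symm) z (fderiv ℝ (chartSharp φ B) z (chartSharp φ B z (fderiv ℝ (f ∘ φ.symm) z))
          (fderiv ℝ (g ∘ φ.symm) z))
        + fderiv ℝ (f ∘ φ.symm) z (fderiv ℝ (chartSharp φ B) z (chartSharp φ B z (fderiv ℝ (g ∘ φ.symm) z))
          (fderiv ℝ (h ∘ φ.symm) z))
        + fderiv ℝ (g ∘ φ.symm) z (fderiv ℝ (chartSharp φ B) z (chartSharp φ B z (fderiv ℝ (h ∘ φ.symm) z))
          (fderiv ℝ (f ∘ φ.symm) z)) := by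
  have e : ∀ f g h : SFun E M, B.bracket f (B.bracket g h) (φ.symm z)
      = modelBracket (chartSharp φ B) (f ∘ φ.symm)
        (modelBracket (chartSharp φ B) (g ∘ φ.symm) (h ∘ φ.symm)) z := by
    intro f g h
    rw [bracket_chart B hφ hz (f.contMDiff _) (hs g h _)]
    exact modelBracket_congr Filter.EventuallyEq.rfl
      (bracket_chart_eventually B hφ hz g.contMDiff h.contMDiff)
  have hc : ∀ f : SFun E M, ContDiffAt ℝ 2 (f ∘ φ.symm) z := fun f ↦
    (contDiffAt_chart hφ hz (f.contMDiff _)).of_le ENat.LEInfty.out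
  rw [e, e, e]
  exact modelBracket_jacobi (chartSharp_alt B) (hP.differentiableAt (by simp)) (hc f) (hc g) (hc h)

theorem isPoisson_of_chart (h : ∀ x : M, ∃ φ ∈ IsManifold.maximalAtlas 𝓘(ℝ, E) ∞ M, x ∈ φ.source ∧
    ContDiffAt ℝ ∞ (chartSharp φ B) (φ x) ∧ JacobiAt (chartSharp φ B) (φ x)) : B.IsPoisson := by
  have hs : ∀ f g : SFun E M, ContMDiff 𝓘(ℝ, E) 𝓘(ℝ) ∞ (B.bracket f g) := by
    intro f g x
    obtain ⟨φ, hφ, hx, hc, -⟩ := h x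
    obtain ⟨z, hz, rfl⟩ := exists_coord hx
    rw [φ.right_inv hz] at hc
    exact contMDiff_bracket_at B hφ hz hc f.contMDiff g.contMDiff
  refine ⟨hs, fun f g k x ↦ ?_⟩
  obtain ⟨φ, hφ, hx, hc, hJ⟩ := h x
  obtain ⟨z, hz, rfl⟩ := exists_coord hx
  rw [φ.right_inv hz] at hc hJ
  rw [jacobi_chart B hφ hz hc f g k hs]
  exact hJ _ _ _

theorem lie_chart (hφ : φ ∈ IsManifold.maximalAtlas 𝓘(ℝ, E) ∞ M) (hz : z ∈ φ.target)
    (hP : ContDiffAt ℝ ∞ (chartSharp φ B) z) (f g : SFun E M)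
    (hs : ∀ f g : SFun E M, ContMDiff 𝓘(ℝ, E) 𝓘(ℝ) ∞ (B.bracket f g)) (X : VField E M) :
    dAt E (B.bracket f g) (φ.symm z) (X (φ.symm z))
        - B.bracket (VField.deriv X f) g (φ.symm z) - B.bracket f (VField.deriv X g) (φ.symm z)
      = fderiv ℝ (g ∘ φ.symm) z (fderiv ℝ (chartSharp φ B) z (chartField φ X z) (fderiv ℝ (f ∘ φ.symm) z))
        - fderiv ℝ (g ∘ φ.symm) z (chartSharp φ B z (fderiv ℝ (f ∘ φ.symm) z ∘L fderiv ℝ (chartField φ X) z))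
        - fderiv ℝ (g ∘ φ.symm) z (fderiv ℝ (chartField φ X) z (chartSharp φ B z (fderiv ℝ (f ∘ φ.symm) z))) := by
  have hc : ∀ f : SFun E M, ContDiffAt ℝ 2 (f ∘ φ.symm) z := fun f ↦
    (contDiffAt_chart hφ hz (f.contMDiff _)).of_le ENat.LEInfty.out
  have hX := contDiffAt_chartField hφ hz X
  have hd : ∀ f : SFun E M, VField.deriv X f ∘ φ.symm =ᶠ[nhds z]
      fun w ↦ fderiv ℝ (f ∘ φ.symm) w (chartField φ X w) := fun f ↦
    (eventually_target hz).mono fun w hw ↦ dAt_chart hφ hw (f.contMDiff _) _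
  rw [dAt_chart hφ hz (hs f g _), (bracket_chart_eventually B hφ hz f.contMDiff g.contMDiff).fderiv_eq,
    bracket_chart B hφ hz ((VField.deriv X f).contMDiff _) (g.contMDiff _),
    bracket_chart B hφ hz (f.contMDiff _) ((VField.deriv X g).contMDiff _),
    modelBracket_congr (hd f) Filter.EventuallyEq.rfl,
    modelBracket_congr Filter.EventuallyEq.rfl (hd g)]
  exact lie_modelBracket (chartSharp_alt B) (hP.differentiableAt (by simp)) (hc f) (hc g)
    (hX.differentiableAt (by simp))

theorem mem_poiss_of_chart (hB : B.IsPoisson) (X : VField E M)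
    (h : ∀ x : M, ∃ φ ∈ IsManifold.maximalAtlas 𝓘(ℝ, E) ∞ M, x ∈ φ.source ∧
    ContDiffAt ℝ ∞ (chartSharp φ B) (φ x) ∧ PoissonAt (chartSharp φ B) (chartField φ X) (φ x)) :
    X ∈ B.poiss := by
  intro f g x
  obtain ⟨φ, hφ, hx, hc, hJ⟩ := h x
  obtain ⟨z, hz, rfl⟩ := exists_coord hx
  rw [φ.right_inv hz] at hc hJ
  have h1 := lie_chart B hφ hz hc f g hB.smooth X
  rw [hJ] at h1
  linarith

variable [T2Space M]

/-- The coefficient `β(B α)` is locally the bracket of two global functions extending `α` and `β`.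
-/
theorem contDiffAt_chartSharp (hB : B.IsPoisson) (hφ : φ ∈ IsManifold.maximalAtlas 𝓘(ℝ, E) ∞ M)
    (hz : z ∈ φ.target) : ContDiffAt ℝ ∞ (chartSharp φ B) z := by
  refine contDiffAt_sharp_of_forall fun α β ↦ ?_
  obtain ⟨f, hf⟩ := exists_extension hφ hz α.contDiff
  obtain ⟨g, hg⟩ := exists_extension hφ hz β.contDiff
  refine (contDiffAt_chart hφ hz (hB.smooth f g _)).congr_of_eventuallyEq ?_
  refine Filter.EventuallyEq.trans ?_ (bracket_chart_eventually B hφ hz f.contMDiff g.contMDiff).symm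
  filter_upwards [hf.eventuallyEq_nhds, hg.eventuallyEq_nhds] with w hfw hgw
  rw [modelBracket_congr hfw hgw, modelBracket_linear]

theorem jacobiAt_chartSharp (hB : B.IsPoisson) (hφ : φ ∈ IsManifold.maximalAtlas 𝓘(ℝ, E) ∞ M)
    (hz : z ∈ φ.target) : JacobiAt (chartSharp φ B) z := by
  intro α β δ
  obtain ⟨f, hf⟩ := exists_extension hφ hz α.contDiff
  obtain ⟨g, hg⟩ := exists_extension hφ hz β.contDiff
  obtain ⟨h, hh⟩ := exists_extension hφ hz δ.contDiff
  have h1 := jacobi_chart B hφ hz (contDiffAt_chartSharp B hB hφ hz) f g h hB.smooth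
  rw [hB.jacobi, hf.fderiv_eq, hg.fderiv_eq, hh.fderiv_eq] at h1
  simpa using h1.symm

theorem poissonAt_chart (hB : B.IsPoisson) (hφ : φ ∈ IsManifold.maximalAtlas 𝓘(ℝ, E) ∞ M)
    (hz : z ∈ φ.target) {X : VField E M} (hX : X ∈ B.poiss) :
    PoissonAt (chartSharp φ B) (chartField φ X) z := by
  intro α β
  obtain ⟨f, hf⟩ := exists_extension hφ hz α.contDiff
  obtain ⟨g, hg⟩ := exists_extension hφ hz β.contDiff
  have h1 := lie_chart B hφ hz (contDiffAt_chartSharp B hB hφ hz) f g hB.smooth X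
  rw [hX f g, hf.fderiv_eq, hg.fderiv_eq] at h1
  simp only [ContinuousLinearMap.fderiv] at h1
  linarith

end ChartBivectors

/-! ### Divergence and modular vector fields in a chart. -/

section ChartVolume

set_option maxSynthPendingDepth 3

variable {E : Type*} [NormedAddCommGroup E] [NormedSpace ℝ E] [FiniteDimensional ℝ E]
  {M : Type*} [TopologicalSpace M] [ChartedSpace E M] [IsManifold 𝓘(ℝ, E) ∞ M]
  {φ : OpenPartialHomeomorph M E} {z : E}

/-- The density of a form of top degree in a chart. -/
def chartDensity (φ : OpenPartialHomeomorph M E) (Ω : TopForm E M) (z : E) : ℝ :=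
  Ω (φ.symm z) (fun i ↦ chartI φ z (finBasis ℝ E i))

theorem topForm_eq (hφ : φ ∈ IsManifold.maximalAtlas 𝓘(ℝ, E) ∞ M) (hz : z ∈ φ.target) (Ω : TopForm E M)
    (v : Fin (finrank ℝ E) → TangentSpace 𝓘(ℝ, E) (φ.symm z)) :
    Ω (φ.symm z) v = chartDensity φ Ω z * (finBasis ℝ E).det (fun i ↦ chartD φ z (v i)) := by
  have h := ((Ω (φ.symm z)).compLinearMap (chartI φ z)).eq_smul_basis_det (finBasis ℝ E)
  have h2 := congrArg (fun η ↦ η (fun i ↦ chartD φ z (v i))) h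
  simp only [AlternatingMap.compLinearMap_apply, chartI_chartD hφ hz, AlternatingMap.smul_apply,
    smul_eq_mul] at h2
  exact h2

theorem chartDensity_ne_zero (hφ : φ ∈ IsManifold.maximalAtlas 𝓘(ℝ, E) ∞ M) (hz : z ∈ φ.target)
    {Ω : TopForm E M} (hΩ : Ω (φ.symm z) ≠ 0) : chartDensity φ Ω z ≠ 0 := by
  intro h
  apply hΩ
  ext v
  rw [topForm_eq hφ hz, h, zero_mul]; rfl

theorem contDiffAt_topForm_apply (hφ : φ ∈ IsManifold.maximalAtlas 𝓘(ℝ, E) ∞ M) (hz : z ∈ φ.target)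
    {Ω : TopForm E M} (h : ContDiffAt ℝ ∞ (chartDensity φ Ω) z)
    (Y : Fin (finrank ℝ E) → VField E M) :
    ContMDiffAt 𝓘(ℝ, E) 𝓘(ℝ) ∞ (fun x ↦ Ω x (fun i ↦ Y i x)) (φ.symm z) := by
  refine contMDiffAt_of_chart hφ hz ?_
  have h1 : ContDiffAt ℝ ∞ (fun w ↦ (finBasis ℝ E).det (fun i ↦ chartField φ (Y i) w)) z :=
    (toContAlt (finBasis ℝ E).det).contDiff.contDiffAt.comp z
      (contDiffAt_pi.2 fun i ↦ contDiffAt_chartField hφ hz (Y i))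
  refine (h.mul h1).congr_of_eventuallyEq ?_
  filter_upwards [eventually_target hz] with w hw
  exact topForm_eq hφ hw Ω _

/-- Write `Ω = ρ vol`. The derivatives of the fields `Y i` along `X` cancel against one half of the
brackets; the other half contributes the trace of `DX`. `Real.log` is the logarithm of the absolute
value, so the sign of `ρ` does not matter. -/
theorem lieDerivTop_chart (hφ : φ ∈ IsManifold.maximalAtlas 𝓘(ℝ, E) ∞ M) (hz : z ∈ φ.target)
    {Ω : TopForm E M} (h : ContDiffAt ℝ ∞ (chartDensity φ Ω) z) (h0 : chartDensity φ Ω z ≠ 0)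
    (X : VField E M) (Y : Fin (finrank ℝ E) → VField E M) :
    lieDerivTop Ω X Y (φ.symm z)
      = modelDiv (fun w ↦ Real.log (chartDensity φ Ω w)) (chartField φ X) z
        * Ω (φ.symm z) (fun i ↦ Y i (φ.symm z)) := by
  set ρ := chartDensity φ Ω with hρ
  set vol := (finBasis ℝ E).det
  have hd := h.differentiableAt (by simp)
  have hX := contDiffAt_chartField hφ hz X
  have hY : ∀ i, HasFDerivAt (chartField φ (Y i)) (fderiv ℝ (chartField φ (Y i)) z) z := fun i ↦
    ((contDiffAt_chartField hφ hz (Y i)).differentiableAt (by simp)).hasFDerivAt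
  have e1 : dAt E (fun y ↦ Ω y (fun i ↦ Y i y)) (φ.symm z) (X (φ.symm z))
      = fderiv ℝ ρ z (chartField φ X z) * vol (fun i ↦ chartField φ (Y i) z)
        + ρ z * ∑ i, vol (Function.update (fun j ↦ chartField φ (Y j) z) i
          (fderiv ℝ (chartField φ (Y i)) z (chartField φ X z))) := by
    rw [dAt_chart hφ hz (contDiffAt_topForm_apply hφ hz h Y)]
    have h1 : (fun y ↦ Ω y (fun i ↦ Y i y)) ∘ φ.symm =ᶠ[nhds z]
        fun w ↦ ρ w * vol (fun i ↦ chartField φ (Y i) w) :=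
      (eventually_target hz).mono fun w hw ↦ topForm_eq hφ hw Ω _
    have h2 := hd.hasFDerivAt.mul (hasFDerivAt_alternating vol hY)
    rw [h1.fderiv_eq]
    refine (congrArg (fun L ↦ L (chartField φ X z)) h2.fderiv).trans ?_
    simp only [add_apply, smul_apply, smul_eq_mul, _root_.sum_apply]
    rw [add_comm, mul_comm (fderiv ℝ ρ z (chartField φ X z))]
    congr 2
  have e2 : ∀ i, Ω (φ.symm z) (Function.update (fun j ↦ Y j (φ.symm z)) i
        (mlieBracket 𝓘(ℝ, E) X (Y i) (φ.symm z)))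
      = ρ z * vol (Function.update (fun j ↦ chartField φ (Y j) z) i
          (fderiv ℝ (chartField φ (Y i)) z (chartField φ X z)))
        - ρ z * vol (Function.update (fun j ↦ chartField φ (Y j) z) i
          (fderiv ℝ (chartField φ X) z (chartField φ (Y i) z))) := by
    intro i
    rw [topForm_eq hφ hz]
    have h1 : (fun j ↦ chartD φ z (Function.update (fun j ↦ Y j (φ.symm z)) i
        (mlieBracket 𝓘(ℝ, E) X (Y i) (φ.symm z)) j))
        = Function.update (fun j ↦ chartField φ (Y j) z) i
          (lieBracket ℝ (chartField φ X) (chartField φ (Y i)) z) := by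
      rw [← chartD_mlieBracket hφ hz X.contMDiff (Y i).contMDiff]
      funext j
      by_cases hj : j = i
      · subst hj; simp
      · simp [hj, chartField]
    rw [h1, lieBracket, AlternatingMap.map_update_sub, mul_sub]
  rw [lieDerivTop, e1]
  simp only [e2, Finset.sum_sub_distrib, ← Finset.mul_sum]
  have e3 := sum_update_eq_trace_mul (finBasis ℝ E) vol (fderiv ℝ (chartField φ X) z).toLinearMap
    (fun j ↦ chartField φ (Y j) z)
  simp only [ContinuousLinearMap.coe_coe] at e3
  rw [e3, modelDiv, topForm_eq hφ hz, fderiv.log hd h0, traceCLM_apply]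
  simp only [smul_apply, smul_eq_mul]
  change _ = _ * (ρ z * vol fun i ↦ chartField φ (Y i) z)
  field_simp
  ring

variable (B : BivectorField E M)

theorem contMDiff_ham (h : ∀ x : M, ∃ φ ∈ IsManifold.maximalAtlas 𝓘(ℝ, E) ∞ M, x ∈ φ.source ∧
    ContDiffAt ℝ ∞ (chartSharp φ B) (φ x)) (f : SFun E M) :
    ContMDiff 𝓘(ℝ, E) (𝓘(ℝ, E).prod 𝓘(ℝ, E)) ∞
      (fun x ↦ (⟨x, B.ham f x⟩ : Bundle.TotalSpace E (TangentSpace 𝓘(ℝ, E)))) := by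
  intro x
  obtain ⟨φ, hφ, hx, hc⟩ := h x
  obtain ⟨z, hz, rfl⟩ := exists_coord hx
  rw [φ.right_inv hz] at hc
  refine contMDiffAt_section_of_chart hφ hz
    (V := fun w ↦ chartSharp φ B w (fderiv ℝ (f ∘ φ.symm) w)) ?_
    ((eventually_target hz).mono fun w hw ↦ chartD_ham B hφ hw (f.contMDiff _))
  exact hc.clm_apply ((contDiffAt_chart hφ hz (f.contMDiff _)).fderiv_right (by simp))

variable [T2Space M]

theorem contDiffAt_chartDensity (hφ : φ ∈ IsManifold.maximalAtlas 𝓘(ℝ, E) ∞ M) (hz : z ∈ φ.target)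
    {Ω : TopForm E M} (hΩ : IsVolumeForm Ω) : ContDiffAt ℝ ∞ (chartDensity φ Ω) z := by
  choose X hX _ _ using fun v ↦ exists_field_extension hφ hz v
  refine (contDiffAt_chart hφ hz (hΩ.smooth (fun i ↦ X (finBasis ℝ E i)) _)).congr_of_eventuallyEq ?_
  have hX' : ∀ᶠ w in nhds z, ∀ i, chartField φ (X (finBasis ℝ E i)) w = finBasis ℝ E i :=
    Filter.eventually_all.2 fun i ↦ hX _
  filter_upwards [hX', eventually_target hz] with w hw hwt
  change Ω _ _ = Ω _ _
  congr 1
  funext i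
  exact (congrArg (chartI φ w) (hw i).symm).trans (chartI_chartD hφ hwt _)

theorem exists_chartAt (x : M) : ∃ φ ∈ IsManifold.maximalAtlas 𝓘(ℝ, E) ∞ M, x ∈ φ.source :=
  ⟨chartAt E x, IsManifold.chart_mem_maximalAtlas x, mem_chart_source E x⟩

variable {B}

theorem contMDiff_ham_of_isPoisson (hB : B.IsPoisson) (f : SFun E M) :
    ContMDiff 𝓘(ℝ, E) (𝓘(ℝ, E).prod 𝓘(ℝ, E)) ∞
      (fun x ↦ (⟨x, B.ham f x⟩ : Bundle.TotalSpace E (TangentSpace 𝓘(ℝ, E)))) :=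
  contMDiff_ham B (fun x ↦ by
    obtain ⟨φ, hφ, hx⟩ := exists_chartAt (E := E) x
    exact ⟨φ, hφ, hx, contDiffAt_chartSharp B hB hφ (φ.map_source hx)⟩) f

/-- The coordinate expression of the modular vector field. -/
def chartModular (φ : OpenPartialHomeomorph M E) (B : BivectorField E M) (Ω : TopForm E M) : E → E :=
  modelModular (chartSharp φ B) (fun w ↦ Real.log (chartDensity φ Ω w))

theorem lieDerivTop_ham (hB : B.IsPoisson) {Ω : TopForm E M} (hΩ : IsVolumeForm Ω)
    (hφ : φ ∈ IsManifold.maximalAtlas 𝓘(ℝ, E) ∞ M) (hz : z ∈ φ.target) (f : SFun E M)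
    (Y : Fin (finrank ℝ E) → VField E M) :
    lieDerivTop Ω (B.ham f) Y (φ.symm z) = fderiv ℝ (f ∘ φ.symm) z (chartModular φ B Ω z)
      * Ω (φ.symm z) (fun i ↦ Y i (φ.symm z)) := by
  let X : VField E M := ⟨B.ham f, contMDiff_ham_of_isPoisson hB f⟩
  refine (lieDerivTop_chart hφ hz (contDiffAt_chartDensity hφ hz hΩ)
    (chartDensity_ne_zero hφ hz (hΩ.ne_zero _)) X Y).trans ?_
  have h1 : chartField φ X =ᶠ[nhds z] fun w ↦ chartSharp φ B w (fderiv ℝ (f ∘ φ.symm) w) :=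
    (eventually_target hz).mono fun w hw ↦ chartD_ham B hφ hw (f.contMDiff _)
  rw [modelDiv, h1.fderiv_eq, h1.self_of_nhds]
  rw [chartModular, ← modelDiv_ham (chartSharp_alt B)
    ((contDiffAt_chartSharp B hB hφ hz).differentiableAt (by simp)) _
    ((contDiffAt_chart hφ hz (f.contMDiff _)).of_le ENat.LEInfty.out)]
  rfl

theorem exists_basis_fields (x : M) {Ω : TopForm E M} (h : Ω x ≠ 0) :
    ∃ Y : Fin (finrank ℝ E) → VField E M, Ω x (fun i ↦ Y i x) ≠ 0 := by
  obtain ⟨φ, hφ, hx⟩ := exists_chartAt (E := E) x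
  obtain ⟨z, hz, rfl⟩ := exists_coord hx
  choose X hX _ _ using fun v ↦ exists_field_extension hφ hz v
  refine ⟨fun i ↦ X (finBasis ℝ E i), ?_⟩
  have h1 : ∀ i, X (finBasis ℝ E i) (φ.symm z) = chartI φ z (finBasis ℝ E i) := fun i ↦ by
    exact (chartI_chartD hφ hz _).symm.trans
      (congrArg (chartI φ z) (hX (finBasis ℝ E i)).self_of_nhds)
  simp only [h1]
  exact chartDensity_ne_zero hφ hz h

theorem eq_of_forall_fderiv (hφ : φ ∈ IsManifold.maximalAtlas 𝓘(ℝ, E) ∞ M) (hz : z ∈ φ.target) {u v : E}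
    (h : ∀ f : SFun E M, fderiv ℝ (f ∘ φ.symm) z u = fderiv ℝ (f ∘ φ.symm) z v) : u = v := by
  refine (SeparatingDual.eq_iff_forall_dual_eq (R := ℝ)).2 fun α ↦ ?_
  obtain ⟨f, hf⟩ := exists_extension hφ hz α.contDiff
  have := h f
  rw [hf.fderiv_eq] at this
  simpa using this

/-- The vector at each point is taken from one chart. The Lie derivatives of `Ω` determine it, so it
has the expected expression in every chart, and smoothness and the Poisson property follow from the
coordinate formula. -/
theorem exists_isModularField (hB : B.IsPoisson) {Ω : TopForm E M} (hΩ : IsVolumeForm Ω) :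
    ∃ Z : VField E M, IsModularField B Ω Z ∧ Z ∈ B.poiss ∧
      ∀ φ ∈ IsManifold.maximalAtlas 𝓘(ℝ, E) ∞ M, ∀ z ∈ φ.target,
        chartField φ Z z = chartModular φ B Ω z := by
  have h : ∀ x : M, ∃ v : TangentSpace 𝓘(ℝ, E) x, ∀ (f : SFun E M) (Y : Fin (finrank ℝ E) → VField E M),
      lieDerivTop Ω (B.ham f) Y x = dAt E f x v * Ω x (fun i ↦ Y i x) := by
    intro x
    obtain ⟨φ, hφ, hx⟩ := exists_chartAt (E := E) x
    obtain ⟨z, hz, rfl⟩ := exists_coord hx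
    refine ⟨chartI φ z (chartModular φ B Ω z), fun f Y ↦ ?_⟩
    rw [lieDerivTop_ham hB hΩ hφ hz, dAt_chart hφ hz (f.contMDiff _), chartD_chartI hφ hz]
  choose Z hZ using h
  have hc : ∀ φ ∈ IsManifold.maximalAtlas 𝓘(ℝ, E) ∞ M, ∀ z ∈ φ.target,
        chartField φ Z z = chartModular φ B Ω z := by
    intro φ hφ z hz
    obtain ⟨Y, hY⟩ := exists_basis_fields _ (hΩ.ne_zero (φ.symm z))
    refine eq_of_forall_fderiv hφ hz fun f ↦ ?_
    have h1 := hZ (φ.symm z) f Y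
    rw [lieDerivTop_ham hB hΩ hφ hz, dAt_chart hφ hz (f.contMDiff _)] at h1
    exact (mul_right_cancel₀ hY h1).symm
  have hlog : ∀ φ ∈ IsManifold.maximalAtlas 𝓘(ℝ, E) ∞ M, ∀ z ∈ φ.target,
      ContDiffAt ℝ ∞ (fun w ↦ Real.log (chartDensity φ Ω w)) z := fun φ hφ z hz ↦
    (contDiffAt_chartDensity hφ hz hΩ).log (chartDensity_ne_zero hφ hz (hΩ.ne_zero _))
  have hs : ContMDiff 𝓘(ℝ, E) (𝓘(ℝ, E).prod 𝓘(ℝ, E)) ∞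
      (fun x ↦ (⟨x, Z x⟩ : Bundle.TotalSpace E (TangentSpace 𝓘(ℝ, E)))) := by
    intro x
    obtain ⟨φ, hφ, hx⟩ := exists_chartAt (E := E) x
    obtain ⟨z, hz, rfl⟩ := exists_coord hx
    exact contMDiffAt_section_of_chart hφ hz
      (contDiffAt_modelModular (contDiffAt_chartSharp B hB hφ hz) (hlog φ hφ z hz))
      ((eventually_target hz).mono (hc φ hφ))
  refine ⟨⟨Z, hs⟩, fun f Y x ↦ hZ x f Y, ?_, hc⟩
  refine mem_poiss_of_chart B hB _ fun x ↦ ?_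
  obtain ⟨φ, hφ, hx⟩ := exists_chartAt (E := E) x
  refine ⟨φ, hφ, hx, contDiffAt_chartSharp B hB hφ (φ.map_source hx), ?_⟩
  have hz := φ.map_source hx
  have h1 := poissonAt_modelModular (chartSharp_alt B) (contDiffAt_chartSharp B hB hφ hz)
    ((eventually_target hz).mono fun w hw ↦ jacobiAt_chartSharp B hB hφ hw) (hlog φ hφ _ hz)
  have h2 : chartField φ Z =ᶠ[nhds (φ x)] chartModular φ B Ω := (eventually_target hz).mono (hc φ hφ)
  intro α β
  have h3 := h1 α β
  change β (fderiv ℝ (chartSharp φ B) (φ x) (chartField φ Z (φ x)) α)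
    = β (chartSharp φ B (φ x) (α ∘L fderiv ℝ (chartField φ Z) (φ x)))
      + β (fderiv ℝ (chartField φ Z) (φ x) (chartSharp φ B (φ x) α))
  rw [h2.fderiv_eq, h2.self_of_nhds]
  exact h3

/-- The modular vector fields of two volume forms differ by a Hamiltonian vector field. -/
theorem sub_mem_hamFields {Ω Ω' : TopForm E M} (hΩ : IsVolumeForm Ω)
    (hΩ' : IsVolumeForm Ω') {Z Z' : VField E M}
    (hZ : ∀ φ ∈ IsManifold.maximalAtlas 𝓘(ℝ, E) ∞ M, ∀ z ∈ φ.target,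
        chartField φ Z z = chartModular φ B Ω z)
    (hZ' : ∀ φ ∈ IsManifold.maximalAtlas 𝓘(ℝ, E) ∞ M, ∀ z ∈ φ.target,
        chartField φ Z' z = chartModular φ B Ω' z) : Z' - Z ∈ B.hamFields := by
  have h : ∀ x, ∃ a : ℝ, Ω' x = a • Ω x := by
    intro x
    obtain ⟨φ, hφ, hx⟩ := exists_chartAt (E := E) x
    obtain ⟨z, hz, rfl⟩ := exists_coord hx
    have h0 := chartDensity_ne_zero hφ hz (hΩ.ne_zero _)
    refine ⟨chartDensity φ Ω' z / chartDensity φ Ω z, ?_⟩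
    ext v
    rw [AlternatingMap.smul_apply, topForm_eq hφ hz, topForm_eq hφ hz, smul_eq_mul]
    field_simp
  choose a ha using h
  have ha' : ∀ φ : OpenPartialHomeomorph M E, ∀ w, chartDensity φ Ω' w = a (φ.symm w) * chartDensity φ Ω w := by
    intro φ w
    rw [chartDensity, ha]; rfl
  have ha0 : ∀ x, a x ≠ 0 := by
    intro x hx
    have := ha x
    rw [hx, zero_smul] at this
    exact hΩ'.ne_zero x this
  have hlog : ∀ {Ω : TopForm E M}, IsVolumeForm Ω → ∀ φ ∈ IsManifold.maximalAtlas 𝓘(ℝ, E) ∞ M, ∀ z ∈ φ.target,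
      ContDiffAt ℝ ∞ (fun w ↦ Real.log (chartDensity φ Ω w)) z := fun hΩ φ hφ z hz ↦
    (contDiffAt_chartDensity hφ hz hΩ).log (chartDensity_ne_zero hφ hz (hΩ.ne_zero _))
  -- The Hamiltonian is `-log |a|`, where `Ω' = a Ω`; in a chart it is a difference of
  -- log-densities, hence smooth. The minus sign comes from the skewness of `B`.
  have hrep : ∀ φ ∈ IsManifold.maximalAtlas 𝓘(ℝ, E) ∞ M, ∀ z ∈ φ.target,
      (fun x ↦ - Real.log (a x)) ∘ φ.symm =ᶠ[nhds z]
        fun w ↦ Real.log (chartDensity φ Ω w) - Real.log (chartDensity φ Ω' w) := by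
    intro φ hφ z hz
    filter_upwards [eventually_target hz] with w hw
    rw [ha', Real.log_mul (ha0 _) (chartDensity_ne_zero hφ hw (hΩ.ne_zero _))]
    simp
  have hs : ContMDiff 𝓘(ℝ, E) 𝓘(ℝ) ∞ (fun x ↦ - Real.log (a x)) := by
    intro x
    obtain ⟨φ, hφ, hx⟩ := exists_chartAt (E := E) x
    obtain ⟨z, hz, rfl⟩ := exists_coord hx
    exact contMDiffAt_of_chart hφ hz (((hlog hΩ φ hφ z hz).sub (hlog hΩ' φ hφ z hz)).congr_of_eventuallyEq
      (hrep φ hφ z hz))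
  refine ⟨⟨_, hs⟩, fun x ↦ ?_⟩
  obtain ⟨φ, hφ, hx⟩ := exists_chartAt (E := E) x
  obtain ⟨z, hz, rfl⟩ := exists_coord hx
  apply (chartEquiv hφ hz).injective
  change chartD φ z (Z' (φ.symm z) - Z (φ.symm z)) = chartField φ (B.ham _) z
  refine Eq.trans ?_ (chartD_ham B hφ hz (hs _)).symm
  rw [map_sub]
  change chartField φ Z' z - chartField φ Z z = _
  rw [hZ φ hφ z hz, hZ' φ hφ z hz, (hrep φ hφ z hz).fderiv_eq,
    fderiv_fun_sub ((hlog hΩ φ hφ z hz).differentiableAt (by simp))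
      ((hlog hΩ' φ hφ z hz).differentiableAt (by simp))]
  refine (SeparatingDual.eq_iff_forall_dual_eq (R := ℝ)).2 fun α ↦ ?_
  rw [map_sub, chartModular, chartModular, apply_modelModular, apply_modelModular,
    skew_of_alt (chartSharp_alt B z) _ α]
  simp only [sub_apply]
  ring

end ChartVolume

/-! ### The coupling decomposition in foliated charts. -/

section FoliatedCharts

set_option maxSynthPendingDepth 3

variable {E : Type*} [NormedAddCommGroup E] [NormedSpace ℝ E] [FiniteDimensional ℝ E]
  {M : Type*} [TopologicalSpace M] [ChartedSpace E M] [IsManifold 𝓘(ℝ, E) ∞ M]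
  {k : ℕ} {𝒱 : RegularFoliation E M k} {B : BivectorField E M}
  {φ : OpenPartialHomeomorph M E} {F : Submodule ℝ E} {z : E}

/-- `φ` is a foliated chart, with leaf direction `F`. -/
structure IsFoliatedChart (𝒱 : RegularFoliation E M k) (φ : OpenPartialHomeomorph M E)
    (F : Submodule ℝ E) : Prop where
  mem_atlas : φ ∈ IsManifold.maximalAtlas 𝓘(ℝ, E) ∞ M
  finrank_eq : finrank ℝ F = k
  mem_iff : ∀ z ∈ φ.target, ∀ v, v ∈ 𝒱.tangent (φ.symm z) ↔ chartD φ z v ∈ F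

theorem exists_isFoliatedChart (𝒱 : RegularFoliation E M k) (x : M) :
    ∃ φ F, IsFoliatedChart 𝒱 φ F ∧ x ∈ φ.source := by
  obtain ⟨φ, hφ, hx, F, hk, hF⟩ := 𝒱.exists_chart x
  exact ⟨φ, F, ⟨hφ, hk, fun z hz v ↦ hF _ (φ.map_target hz) v⟩, hx⟩

namespace IsFoliatedChart

theorem chartI_mem (hc : IsFoliatedChart 𝒱 φ F) (hz : z ∈ φ.target) {v : E} (hv : v ∈ F) :
    chartI φ z v ∈ 𝒱.tangent (φ.symm z) := by
  rw [hc.mem_iff z hz, chartD_chartI hc.mem_atlas hz]; exact hv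

/-- The isomorphism between a tangent space of the foliation and the leaf direction. -/
def tangentEquiv (hc : IsFoliatedChart 𝒱 φ F) (hz : z ∈ φ.target) : 𝒱.tangent (φ.symm z) ≃ₗ[ℝ] F :=
  LinearEquiv.ofLinearMap
    ((chartD φ z ∘ₗ (𝒱.tangent (φ.symm z)).subtype).codRestrict F
      fun v ↦ (hc.mem_iff z hz v).1 v.2)
    ((chartI φ z ∘ₗ F.subtype).codRestrict _ fun v ↦ hc.chartI_mem hz v.2)
    (LinearMap.ext fun v ↦ Subtype.ext (chartD_chartI hc.mem_atlas hz _))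
    (LinearMap.ext fun v ↦ Subtype.ext (chartI_chartD hc.mem_atlas hz _))

theorem chartField_mem (hc : IsFoliatedChart 𝒱 φ F) (hz : z ∈ φ.target) (X : 𝒱.tangentFields) :
    chartField φ (X : VField E M) z ∈ F :=
  (hc.mem_iff z hz _).1 (X.2 _)

theorem exists_tangentField [T2Space M] (hc : IsFoliatedChart 𝒱 φ F) (hz : z ∈ φ.target) {v : E}
    (hv : v ∈ F) :
    ∃ X : 𝒱.tangentFields, ∀ᶠ w in nhds z, chartField φ (X : VField E M) w = v := by
  obtain ⟨X, hX, h0, h1⟩ := exists_field_extension hc.mem_atlas hz v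
  refine ⟨⟨X, fun x ↦ ?_⟩, hX⟩
  by_cases hx : x ∈ φ.source
  · obtain ⟨w, hw, rfl⟩ := exists_coord hx
    rw [hc.mem_iff w hw]
    obtain ⟨c, hc'⟩ := h1 w hw
    exact (congrArg (· ∈ F) hc').mpr (F.smul_mem c hv)
  · rw [h0 x hx]; exact Submodule.zero_mem _

end IsFoliatedChart

variable (h : IsCoupling 𝒱 B)

/-- By definition `B♯` maps `𝕍⁰` onto `ℍ`; a linear section of this map is composed with the
projection onto `ℍ`. The choice is made point by point, and smoothness is recovered from
`contDiffAt_conn_flat`. -/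
theorem exists_flat (h : IsCoupling 𝒱 B) : ∃ b : ∀ x : M, TangentSpace 𝓘(ℝ, E) x →ₗ[ℝ] Dual ℝ (TangentSpace 𝓘(ℝ, E) x),
    ∀ x, (∀ u, ∀ v ∈ 𝒱.tangent x, b x u v = 0) ∧
      ∀ u, B.sharp x (b x u) = u - (h.connection x u : TangentSpace 𝓘(ℝ, E) x) := by
  have key : ∀ x, ∃ b : TangentSpace 𝓘(ℝ, E) x →ₗ[ℝ] Dual ℝ (TangentSpace 𝓘(ℝ, E) x),
    (∀ u, ∀ v ∈ 𝒱.tangent x, b u v = 0) ∧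
      ∀ u, B.sharp x (b u) = u - (h.connection x u : TangentSpace 𝓘(ℝ, E) x) := by
    intro x
    let L : (𝒱.tangent x).dualAnnihilator →ₗ[ℝ] horizontal 𝒱 B x :=
      (B.sharp x ∘ₗ (𝒱.tangent x).dualAnnihilator.subtype).codRestrict _
        fun ξ ↦ Submodule.mem_map_of_mem ξ.2
    have hL : Function.Surjective L := by
      rintro ⟨_, ξ, hξ, rfl⟩
      exact ⟨⟨ξ, hξ⟩, rfl⟩
    obtain ⟨s, hs⟩ := L.exists_rightInverse_of_surjective (LinearMap.range_eq_top.2 hL)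
    let p := (horizontal 𝒱 B x).projectionOnto (𝒱.tangent x) (h.isCompl x).symm
    refine ⟨(𝒱.tangent x).dualAnnihilator.subtype ∘ₗ s ∘ₗ p, fun u v hv ↦ ?_, fun u ↦ ?_⟩
    · exact (Submodule.mem_dualAnnihilator _).1 (s (p u)).2 v hv
    · have h1 : L (s (p u)) = p u := congrArg (fun f ↦ f (p u)) hs
      have h2 := congrArg Subtype.val h1
      refine Eq.trans h2 (eq_sub_of_add_eq' ?_)
      exact Submodule.projection_add_projection_eq_self (h.isCompl x) u
  choose b hb using key
  exact ⟨b, hb⟩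

/-- The coordinate expression of the connection. -/
def chartConn (φ : OpenPartialHomeomorph M E) (h : IsCoupling 𝒱 B) (z : E) : E →L[ℝ] E :=
  LinearMap.toContinuousLinearMap (chartD φ z ∘ₗ (𝒱.tangent (φ.symm z)).subtype
    ∘ₗ h.connection (φ.symm z) ∘ₗ chartI φ z)

theorem chartConn_apply (z v : E) : chartConn φ h z v
    = chartD φ z (h.connection (φ.symm z) (chartI φ z v)) := rfl

/-- The coordinate expression of a field of bilinear forms. -/
def chartFlat (φ : OpenPartialHomeomorph M E)
    (b : ∀ x : M, TangentSpace 𝓘(ℝ, E) x →ₗ[ℝ] Dual ℝ (TangentSpace 𝓘(ℝ, E) x)) (z : E) :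
    E →L[ℝ] E →L[ℝ] ℝ :=
  LinearMap.toContinuousLinearMap (LinearMap.toContinuousLinearMap.toLinearMap
    ∘ₗ (chartI φ z).dualMap ∘ₗ b (φ.symm z) ∘ₗ chartI φ z)

theorem connection_eq_self {x : M} {v : TangentSpace 𝓘(ℝ, E) x} (hv : v ∈ 𝒱.tangent x) :
    (h.connection x v : TangentSpace 𝓘(ℝ, E) x) = v :=
  congrArg Subtype.val (Submodule.projectionOnto_apply_left (h.isCompl x) ⟨v, hv⟩)

theorem connection_sharp {x : M} {ξ : Dual ℝ (TangentSpace 𝓘(ℝ, E) x)}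
    (hξ : ∀ v ∈ 𝒱.tangent x, ξ v = 0) : h.connection x (B.sharp x ξ) = 0 :=
  (Submodule.projectionOnto_apply_eq_zero_iff (h.isCompl x)).2
    (Submodule.mem_map_of_mem ((Submodule.mem_dualAnnihilator _).2 hξ))

theorem couplingAt_chart (hc : IsFoliatedChart 𝒱 φ F) (hz : z ∈ φ.target)
    {b : ∀ x : M, TangentSpace 𝓘(ℝ, E) x →ₗ[ℝ] Dual ℝ (TangentSpace 𝓘(ℝ, E) x)}
    (hb : ∀ x, (∀ u, ∀ v ∈ 𝒱.tangent x, b x u v = 0) ∧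
      ∀ u, B.sharp x (b x u) = u - (h.connection x u : TangentSpace 𝓘(ℝ, E) x)) :
    CouplingAt F (chartSharp φ B z) (chartConn φ h z) (chartFlat φ b z) where
  alt := chartSharp_alt B z
  mem v := (hc.mem_iff z hz _).1 (h.connection _ _).2
  eq_self v hv := by
    rw [chartConn_apply, connection_eq_self h (hc.chartI_mem hz hv), chartD_chartI hc.mem_atlas hz]
  map_sharp ξ hξ := by
    rw [chartConn_apply, chartSharp_apply, chartI_chartD hc.mem_atlas hz, connection_sharp h]
    · simp
    · intro v hv
      exact hξ _ ((hc.mem_iff z hz v).1 hv)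
  flat_eq_zero u v hv := (hb _).1 _ _ (hc.chartI_mem hz hv)
  sharp_flat u := by
    rw [chartSharp_apply, chartConn_apply]
    have h1 : (chartFlat φ b z u).toLinearMap ∘ₗ chartD φ z = b (φ.symm z) (chartI φ z u) := by
      ext v
      exact congrArg (b (φ.symm z) (chartI φ z u)) (chartI_chartD hc.mem_atlas hz v)
    rw [h1, (hb _).2, map_sub, chartD_chartI hc.mem_atlas hz]

theorem chartSharp_leafPart (hφ : φ ∈ IsManifold.maximalAtlas 𝓘(ℝ, E) ∞ M) (hz : z ∈ φ.target) :
    chartSharp φ h.leafPart.toBivectorField z = leafSharp (chartConn φ h) (chartSharp φ B) z := by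
  ext α
  rw [leafSharp_apply, chartConn_apply, chartSharp_apply, chartSharp_apply, chartI_chartD hφ hz]
  refine congrArg (fun ξ ↦ chartD φ z (h.connection (φ.symm z) (B.sharp (φ.symm z) ξ))) ?_
  ext v
  change _ = α (chartD φ z (h.connection _ (chartI φ z (chartD φ z v))))
  rw [chartI_chartD hφ hz]
  rfl

/-- The covectors `df` and `df ∘ γ` agree on `𝕍`, and `γ ∘ B♯` kills their difference. Hence `γ`
sends Hamiltonian fields to Hamiltonian fields. -/
theorem leafPart_ham (f : M → ℝ) (x : M) :
    h.leafPart.toBivectorField.ham f x = (h.connection x (B.ham f x) : TangentSpace 𝓘(ℝ, E) x) := by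
  let ξ : Dual ℝ (TangentSpace 𝓘(ℝ, E) x) := dAt E f x ∘ₗ (𝒱.tangent x).subtype ∘ₗ h.connection x
  have h1 : h.connection x (B.sharp x (dAt E f x - ξ)) = 0 := by
    refine connection_sharp h fun v hv ↦ ?_
    change dAt E f x v - dAt E f x (h.connection x v) = 0
    rw [connection_eq_self h hv, sub_self]
  rw [map_sub, map_sub, sub_eq_zero] at h1
  exact congrArg Subtype.val h1.symm

variable [T2Space M]

theorem contDiffAt_chartConn_chartFlat (hc : IsFoliatedChart 𝒱 φ F) (hz : z ∈ φ.target)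
    {b : ∀ x : M, TangentSpace 𝓘(ℝ, E) x →ₗ[ℝ] Dual ℝ (TangentSpace 𝓘(ℝ, E) x)}
    (hb : ∀ x, (∀ u, ∀ v ∈ 𝒱.tangent x, b x u v = 0) ∧
      ∀ u, B.sharp x (b x u) = u - (h.connection x u : TangentSpace 𝓘(ℝ, E) x)) :
    ContDiffAt ℝ ∞ (chartConn φ h) z ∧ ContDiffAt ℝ ∞ (chartFlat φ b) z :=
  contDiffAt_conn_flat ((eventually_target hz).mono fun w hw ↦ couplingAt_chart h hc hw hb)
    (contDiffAt_chartSharp B h.poisson hc.mem_atlas hz)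

theorem contDiffAt_chartConn (hc : IsFoliatedChart 𝒱 φ F) (hz : z ∈ φ.target) :
    ContDiffAt ℝ ∞ (chartConn φ h) z := by
  obtain ⟨b, hb⟩ := exists_flat h
  exact (contDiffAt_chartConn_chartFlat h hc hz hb).1

theorem contDiffAt_chartSharp_leafPart (hc : IsFoliatedChart 𝒱 φ F) (hz : z ∈ φ.target) :
    ContDiffAt ℝ ∞ (chartSharp φ h.leafPart.toBivectorField) z :=
  (contDiffAt_leafSharp (contDiffAt_chartSharp B h.poisson hc.mem_atlas hz)
    (contDiffAt_chartConn h hc hz)).congr_of_eventuallyEq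
      ((eventually_target hz).mono fun _ hw ↦ chartSharp_leafPart h hc.mem_atlas hw)

theorem leafPart_isPoisson : h.leafPart.toBivectorField.IsPoisson := by
  obtain ⟨b, hb⟩ := exists_flat h
  refine isPoisson_of_chart _ fun x ↦ ?_
  obtain ⟨φ, F, hc, hx⟩ := exists_isFoliatedChart 𝒱 x
  have hz := φ.map_source hx
  refine ⟨φ, hc.mem_atlas, hx, contDiffAt_chartSharp_leafPart h hc hz, ?_⟩
  have hev := (eventually_target hz).mono fun w hw ↦ couplingAt_chart h hc hw hb
  have h1 := jacobiAt_leafSharp hev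
    ((contDiffAt_chartSharp B h.poisson hc.mem_atlas hz).differentiableAt (by simp))
    ((contDiffAt_chartConn h hc hz).differentiableAt (by simp))
    (jacobiAt_chartSharp B h.poisson hc.mem_atlas hz)
  have h2 : chartSharp φ h.leafPart.toBivectorField =ᶠ[nhds (φ x)]
      leafSharp (chartConn φ h) (chartSharp φ B) :=
    (eventually_target hz).mono fun _ hw ↦ chartSharp_leafPart h hc.mem_atlas hw
  intro α β δ
  rw [h2.fderiv_eq, h2.self_of_nhds]
  exact h1 α β δ

theorem chartField_connection (hφ : φ ∈ IsManifold.maximalAtlas 𝓘(ℝ, E) ∞ M) (hz : z ∈ φ.target)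
    (X : ∀ x : M, TangentSpace 𝓘(ℝ, E) x) :
    chartField φ (fun x ↦ (h.connection x (X x) : TangentSpace 𝓘(ℝ, E) x)) z
      = chartConn φ h z (chartField φ X z) := by
  rw [chartConn_apply, chartField, chartField, chartI_chartD hφ hz]

/-- The vertical part `γ X` of a vector field. -/
def verticalPart (X : VField E M) : VField E M :=
  ⟨fun x ↦ (h.connection x (X x) : TangentSpace 𝓘(ℝ, E) x), fun x ↦ by
    obtain ⟨φ, F, hc, hx⟩ := exists_isFoliatedChart 𝒱 x
    obtain ⟨z, hz, rfl⟩ := exists_coord hx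
    exact contMDiffAt_section_of_chart hc.mem_atlas hz
      ((contDiffAt_chartConn h hc hz).clm_apply (contDiffAt_chartField hc.mem_atlas hz X))
      ((eventually_target hz).mono fun w hw ↦ chartField_connection h hc.mem_atlas hw X)⟩

theorem verticalPart_mem_poiss {X : VField E M} (hX : X ∈ B.poiss) :
    verticalPart h X ∈ h.leafPart.poiss := by
  refine ⟨?_, fun x ↦ (h.connection x (X x)).2⟩
  obtain ⟨b, hb⟩ := exists_flat h
  refine mem_poiss_of_chart _ (leafPart_isPoisson h) _ fun x ↦ ?_
  obtain ⟨φ, F, hc, hx⟩ := exists_isFoliatedChart 𝒱 x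
  have hz := φ.map_source hx
  refine ⟨φ, hc.mem_atlas, hx, contDiffAt_chartSharp_leafPart h hc hz, ?_⟩
  have hev := (eventually_target hz).mono fun w hw ↦ couplingAt_chart h hc hw hb
  have h1 := poissonAt_leafSharp hev
    ((contDiffAt_chartSharp B h.poisson hc.mem_atlas hz).differentiableAt (by simp))
    ((contDiffAt_chartConn h hc hz).differentiableAt (by simp)) (chartSharp_alt B)
    (jacobiAt_chartSharp B h.poisson hc.mem_atlas hz)
    ((contDiffAt_chartField hc.mem_atlas hz X).differentiableAt (by simp))
    (poissonAt_chart B h.poisson hc.mem_atlas hz hX)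
  have h2 : chartSharp φ h.leafPart.toBivectorField =ᶠ[nhds (φ x)]
      leafSharp (chartConn φ h) (chartSharp φ B) :=
    (eventually_target hz).mono fun _ hw ↦ chartSharp_leafPart h hc.mem_atlas hw
  have h3 : chartField φ (verticalPart h X) =ᶠ[nhds (φ x)]
      fun w ↦ chartConn φ h w (chartField φ X w) :=
    (eventually_target hz).mono fun w hw ↦ chartField_connection h hc.mem_atlas hw X
  intro α β
  rw [h2.fderiv_eq, h2.self_of_nhds, h3.fderiv_eq, h3.self_of_nhds]
  exact h1 α β

/-- The map `X ↦ γ X` on Poisson vector fields. -/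
def verticalMap : B.poiss →ₗ[ℝ] h.leafPart.poiss where
  toFun X := ⟨verticalPart h X, verticalPart_mem_poiss h X.2⟩
  map_add' X Y := by
    refine Subtype.ext (ContMDiffSection.ext fun x ↦ ?_)
    exact congrArg Subtype.val (map_add (h.connection x) ((X : VField E M) x) ((Y : VField E M) x))
  map_smul' c X := by
    refine Subtype.ext (ContMDiffSection.ext fun x ↦ ?_)
    exact congrArg Subtype.val (map_smul (h.connection x) c ((X : VField E M) x))

/-- The map induced by the connection on cohomology. -/
def verticalClass : B.H1 →ₗ[ℝ] h.leafPart.H1 :=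
  Submodule.mapQ _ _ (verticalMap h) (by
    rintro X ⟨f, hf⟩
    refine ⟨f, fun x ↦ ?_⟩
    rw [leafPart_ham]
    exact congrArg (fun v ↦ (h.connection x v : TangentSpace 𝓘(ℝ, E) x)) (hf x))

theorem verticalClass_mk (X : B.poiss) : verticalClass h (BivectorField.H1.mk B X)
    = LeafBivector.H1.mk h.leafPart (verticalMap h X) := rfl

end FoliatedCharts

/-! ### Degrees and scaling of the coupling forms. -/

section Degree

variable {W V : Type*} [AddCommGroup W] [Module ℝ W] [AddCommGroup V] [Module ℝ V] {k : ℕ}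

theorem wedgeTwo_apply_eq_zero (θ : W →ₗ[ℝ] Dual ℝ W) (η : Forms W) {m : ℕ}
    (h : ∀ j, j + 2 = m → η j = 0) : wedgeTwo θ η m = 0 := by
  rcases m with _ | m
  · rfl
  · ext v
    rw [wedgeTwo_succ_apply]
    refine Finset.sum_eq_zero fun i _ ↦ ?_
    rcases m with _ | m
    · simp
    · rw [wedge_succ_apply, h m rfl]
      simp

theorem wedgeTwo_pow_single_of_ne (θ : W →ₗ[ℝ] Dual ℝ W) (η : W [⋀^Fin k]→ₗ[ℝ] ℝ) (r : ℕ) :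
    ∀ {m : ℕ}, m ≠ k + 2 * r → (wedgeTwo θ ^ r) (Forms.single η) m = 0 := by
  induction r with
  | zero => intro m hm; simpa using Forms.single_of_ne η (by simpa using hm)
  | succ r ih =>
    intro m hm
    rw [pow_succ', Module.End.mul_apply]
    exact wedgeTwo_apply_eq_zero θ _ fun j hj ↦ ih (by omega)

theorem couplingForm_smul (θ : W →ₗ[ℝ] Dual ℝ W) (γ : W →ₗ[ℝ] V) {V' : Type*} [AddCommGroup V']
    [Module ℝ V'] (γ' : W →ₗ[ℝ] V') (τ : V [⋀^Fin k]→ₗ[ℝ] ℝ)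
    (τ' : V' [⋀^Fin k]→ₗ[ℝ] ℝ) (c : ℝ) (h : τ'.compLinearMap γ' = c • τ.compLinearMap γ) (r n : ℕ) :
    couplingForm θ γ' τ' r n = c • couplingForm θ γ τ r n := by
  have h1 : Forms.single (c • τ.compLinearMap γ) = c • Forms.single (τ.compLinearMap γ) :=
    Forms.ext fun m ↦ by
      by_cases hm : m = k
      · subst hm; simp [Forms.smul_apply]
      · simp [Forms.smul_apply, Forms.single_of_ne _ hm]
  rw [couplingForm, h, h1, map_smul]
  rfl

end Degree

/-! ### The coupling volume form and its modular vector field. -/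

section CouplingVolume

set_option maxSynthPendingDepth 3

variable {E : Type*} [NormedAddCommGroup E] [NormedSpace ℝ E] [FiniteDimensional ℝ E]

/-- The kernel of `b` is `F`, so its rank is `n - k`, with `n` the dimension of `E`; this is even,
and the division by two is exact. Every `v` has the same image under `b` as the horizontal vector `v
- γ v`, and contraction with the latter kills `γ^*vol`; so `exists_wedgeTwo_pow` applies. The power
lives in degree `n` only, and a nonzero form of top degree does not vanish on a basis. -/
theorem couplingForm_ne_zero {F : Submodule ℝ E} {B : (E →L[ℝ] ℝ) →L[ℝ] E} {γ : E →L[ℝ] E}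
    {b : E →L[ℝ] E →L[ℝ] ℝ} (hz : CouplingAt F B γ b) {k : ℕ} (hk : finrank ℝ F = k)
    (vol : E [⋀^Fin k]→ₗ[ℝ] ℝ) (hvol : vol.compLinearMap γ.toLinearMap ≠ 0) :
    finrank ℝ E = k + 2 * ((finrank ℝ E - k) / 2) ∧
      couplingForm (flatLin b) γ.toLinearMap vol ((finrank ℝ E - k) / 2) _ (finBasis ℝ E) ≠ 0 := by
  have hker : LinearMap.ker (flatLin b) = F := by
    ext u
    rw [LinearMap.mem_ker]
    constructor
    · intro hu
      have h1 : b u = 0 := by ext v; exact congrArg (fun f ↦ f v) hu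
      have h2 := hz.sharp_flat u
      rw [h1, map_zero] at h2
      rw [sub_eq_zero.1 h2.symm]
      exact hz.mem u
    · intro hu
      ext v
      rw [flatLin_apply, hz.flat_skew, hz.flat_eq_zero v u hu]
      simp
  have hrank := LinearMap.finrank_range_add_finrank_ker (flatLin b)
  rw [hker, hk] at hrank
  obtain ⟨s, hs, -, hne⟩ := exists_wedgeTwo_pow (finrank ℝ E - k) (flatLin b) hz.flat_alt (by omega)
  have hs' : (finrank ℝ E - k) / 2 = s := by omega
  have hn : finrank ℝ E = k + 2 * s := by omega
  rw [hs']
  refine ⟨hn, fun h0 ↦ ?_⟩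
  refine hne (Forms.single (vol.compLinearMap γ.toLinearMap)) (fun h1 ↦ hvol ?_) (fun v ↦ ⟨v - γ v, ?_, ?_⟩) ?_
  · have := congrArg (fun η : Forms E ↦ η k) h1
    simpa using this
  · ext u
    rw [flatLin_apply, flatLin_apply, hz.flat_skew, hz.flat_skew (v - γ v), hz.flat_sub]
  · refine Forms.ext fun m ↦ ?_
    rw [contr_apply]
    by_cases hm : m + 1 = k
    · subst hm
      ext w
      rw [Forms.single_same, AlternatingMap.curryLeft_apply_apply, AlternatingMap.compLinearMap_apply]
      refine AlternatingMap.map_coord_zero _ 0 ?_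
      change γ (v - γ v) = 0
      rw [map_sub, hz.eq_self _ (hz.mem v), sub_self]
    · rw [Forms.single_of_ne _ hm]; rfl
  · refine Forms.ext fun m ↦ ?_
    by_cases hm : m = k + 2 * s
    · have hm' : m = finrank ℝ E := hm.trans hn.symm
      subst hm'
      rw [Forms.zero_apply]
      exact (AlternatingMap.map_basis_eq_zero_iff (finBasis ℝ E)
        (couplingForm (flatLin b) γ.toLinearMap vol s (finrank ℝ E))).1 h0
    · exact wedgeTwo_pow_single_of_ne _ _ s hm

variable {M : Type*} [TopologicalSpace M] [ChartedSpace E M] [IsManifold 𝓘(ℝ, E) ∞ M]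
  {k : ℕ} {𝒱 : RegularFoliation E M k} {B : BivectorField E M}
  {φ : OpenPartialHomeomorph M E} {F : Submodule ℝ E} {z : E} (h : IsCoupling 𝒱 B)
  {b : ∀ x : M, TangentSpace 𝓘(ℝ, E) x →ₗ[ℝ] Dual ℝ (TangentSpace 𝓘(ℝ, E) x)}

/-- The standard volume form on the leaf direction of a foliated chart. -/
def IsFoliatedChart.vol (hc : IsFoliatedChart 𝒱 φ F) : F [⋀^Fin k]→ₗ[ℝ] ℝ :=
  (finBasisOfFinrankEq ℝ F hc.finrank_eq).det

/-- The density of a foliated form of top degree in a foliated chart. -/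
def leafDensity (hc : IsFoliatedChart 𝒱 φ F) (τ : 𝒱.Form k) (z : E) : ℝ :=
  τ (φ.symm z) (fun i ↦ h.connection _ (chartI φ z (finBasisOfFinrankEq ℝ F hc.finrank_eq i)))

theorem leafForm_eq (hc : IsFoliatedChart 𝒱 φ F) (hz : z ∈ φ.target) (τ : 𝒱.Form k) :
    τ (φ.symm z) = (leafDensity h hc τ z • hc.vol).compLinearMap (hc.tangentEquiv hz).toLinearMap := by
  have h1 := ((τ (φ.symm z)).compLinearMap (hc.tangentEquiv hz).symm.toLinearMap).eq_smul_basis_det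
    (finBasisOfFinrankEq ℝ F hc.finrank_eq)
  have h2 : ((τ (φ.symm z)).compLinearMap (hc.tangentEquiv hz).symm.toLinearMap)
      (finBasisOfFinrankEq ℝ F hc.finrank_eq) = leafDensity h hc τ z := by
    -- The connection in `leafDensity` is the identity on these vectors; it only places them in `𝕍`
    -- without a proof that `z` lies in the chart domain.
    rw [AlternatingMap.compLinearMap_apply, leafDensity]
    congr 1
    funext i
    refine Subtype.ext ?_
    exact (connection_eq_self h (hc.chartI_mem hz (Submodule.coe_mem _))).symm
  rw [h2] at h1
  change _ = leafDensity h hc τ z • hc.vol at h1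
  rw [← h1]
  ext v
  simp

theorem leafDensity_ne_zero (hc : IsFoliatedChart 𝒱 φ F) (hz : z ∈ φ.target) {τ : 𝒱.Form k}
    (hτ : τ (φ.symm z) ≠ 0) : leafDensity h hc τ z ≠ 0 := by
  intro h0
  apply hτ
  rw [leafForm_eq h hc hz τ, h0, zero_smul]
  rfl

theorem contDiffAt_leafDensity [T2Space M] (hc : IsFoliatedChart 𝒱 φ F) (hz : z ∈ φ.target)
    {τ : 𝒱.Form k}
    (hτ : 𝒱.IsLeafVolume τ) : ContDiffAt ℝ ∞ (leafDensity h hc τ) z := by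
  choose X hX using fun i ↦ hc.exists_tangentField hz
    (v := (finBasisOfFinrankEq ℝ F hc.finrank_eq i : E)) (Submodule.coe_mem _)
  refine (contDiffAt_chart hc.mem_atlas hz (hτ.smooth X _)).congr_of_eventuallyEq ?_
  filter_upwards [Filter.eventually_all.2 hX, eventually_target hz] with w hw hwt
  change τ (φ.symm w) _ = τ (φ.symm w) _
  congr 1
  funext i
  refine Subtype.ext ?_
  refine (connection_eq_self h (hc.chartI_mem hwt (Submodule.coe_mem _))).trans ?_
  exact (congrArg (chartI φ w) (hw i).symm).trans (chartI_chartD hc.mem_atlas hwt _)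

/-- The form of top degree defined by a leaf-wise form and a field of bilinear forms. -/
def couplingVolume (h : IsCoupling 𝒱 B) (b : ∀ x : M, TangentSpace 𝓘(ℝ, E) x →ₗ[ℝ] Dual ℝ (TangentSpace 𝓘(ℝ, E) x))
    (τ : 𝒱.Form k) : TopForm E M := fun x ↦
  couplingForm (b x) (h.connection x) (τ x) ((finrank ℝ E - k) / 2) (finrank ℝ E)

/-- The coordinate expression of the coupling volume form of the standard leaf-wise volume. -/
def modelVolume (h : IsCoupling 𝒱 B) (b : ∀ x : M, TangentSpace 𝓘(ℝ, E) x →ₗ[ℝ] Dual ℝ (TangentSpace 𝓘(ℝ, E) x))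
    (hc : IsFoliatedChart 𝒱 φ F) (pr : E →L[ℝ] F) (z : E) : ℝ :=
  couplingForm (flatLin (chartFlat φ b z)) (chartConn φ h z).toLinearMap
    (hc.vol.compLinearMap pr.toLinearMap) ((finrank ℝ E - k) / 2) _ (finBasis ℝ E)

/-- Naturality under the chart and linearity in `τ` split off a factor that does not depend on `τ`.
Its logarithmic derivative along `P♯α` is the trace found in `fderiv_couplingForm`. -/
theorem chartDensity_couplingVolume (hc : IsFoliatedChart 𝒱 φ F) {pr : E →L[ℝ] F}
    (hpr : ∀ v : F, pr v = v) (hz : z ∈ φ.target) (τ : 𝒱.Form k) :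
    chartDensity φ (couplingVolume h b τ) z = leafDensity h hc τ z * modelVolume h b hc pr z := by
  have h1 := couplingForm_comp (chartI φ z) (b (φ.symm z)) (h.connection (φ.symm z)) (τ (φ.symm z))
    ((finrank ℝ E - k) / 2) (finrank ℝ E) (finBasis ℝ E)
  refine h1.trans ?_
  have h2 : (τ (φ.symm z)).compLinearMap (h.connection (φ.symm z) ∘ₗ chartI φ z)
      = leafDensity h hc τ z • (hc.vol.compLinearMap pr.toLinearMap).compLinearMap
        (chartConn φ h z).toLinearMap := by
    ext v
    rw [leafForm_eq h hc hz τ]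
    simp only [AlternatingMap.compLinearMap_apply, AlternatingMap.smul_apply, smul_eq_mul]
    congr 2
    funext i
    exact (hpr (hc.tangentEquiv hz (h.connection _ (chartI φ z (v i))))).symm
  have h3 := couplingForm_smul ((chartI φ z).dualMap ∘ₗ b (φ.symm z) ∘ₗ chartI φ z) _ _ _ _ _ h2
    ((finrank ℝ E - k) / 2) (finrank ℝ E)
  rw [h3]
  rfl

theorem modelVolume_ne_zero (hb : ∀ x, (∀ u, ∀ v ∈ 𝒱.tangent x, b x u v = 0) ∧
      ∀ u, B.sharp x (b x u) = u - (h.connection x u : TangentSpace 𝓘(ℝ, E) x))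
    (hc : IsFoliatedChart 𝒱 φ F) {pr : E →L[ℝ] F}
    (hpr : ∀ v : F, pr v = v) (hz : z ∈ φ.target) : modelVolume h b hc pr z ≠ 0 := by
  have hcz := couplingAt_chart h hc hz hb
  refine (couplingForm_ne_zero hcz hc.finrank_eq _ fun h0 ↦ ?_).2
  have h1 := congrArg (fun η ↦ η (fun i ↦ (finBasisOfFinrankEq ℝ F hc.finrank_eq i : E))) h0
  simp only [AlternatingMap.compLinearMap_apply, ContinuousLinearMap.coe_coe,
    hcz.eq_self _ (Submodule.coe_mem _), hpr] at h1
  have h2 : hc.vol (fun i ↦ finBasisOfFinrankEq ℝ F hc.finrank_eq i) = 1 := Basis.det_self _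
  rw [h2] at h1
  simp at h1

theorem exists_projection (F : Submodule ℝ E) : ∃ pr : E →L[ℝ] F, ∀ v : F, pr v = v := by
  obtain ⟨G, hG⟩ := F.exists_isCompl
  exact ⟨(F.projectionOnto G hG).toContinuousLinearMap,
    fun v ↦ Submodule.projectionOnto_apply_left hG v⟩

variable [T2Space M]

theorem contDiffAt_modelVolume (hb : ∀ x, (∀ u, ∀ v ∈ 𝒱.tangent x, b x u v = 0) ∧
      ∀ u, B.sharp x (b x u) = u - (h.connection x u : TangentSpace 𝓘(ℝ, E) x))
    (hc : IsFoliatedChart 𝒱 φ F) (pr : E →L[ℝ] F) (hz : z ∈ φ.target) :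
    ContDiffAt ℝ ∞ (modelVolume h b hc pr) z := by
  obtain ⟨h1, h2⟩ := contDiffAt_chartConn_chartFlat h hc hz hb
  exact contDiffAt_couplingForm_model h1 h2 _ _ _ _

theorem isVolumeForm_couplingVolume (hb : ∀ x, (∀ u, ∀ v ∈ 𝒱.tangent x, b x u v = 0) ∧
      ∀ u, B.sharp x (b x u) = u - (h.connection x u : TangentSpace 𝓘(ℝ, E) x))
    {τ : 𝒱.Form k} (hτ : 𝒱.IsLeafVolume τ) :
    IsVolumeForm (couplingVolume h b τ) where
  smooth X x := by
    obtain ⟨φ, F, hc, hx⟩ := exists_isFoliatedChart 𝒱 x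
    obtain ⟨z, hz, rfl⟩ := exists_coord hx
    obtain ⟨pr, hpr⟩ := exists_projection F
    refine contDiffAt_topForm_apply hc.mem_atlas hz ?_ X
    refine ((contDiffAt_leafDensity h hc hz hτ).mul
      (contDiffAt_modelVolume h hb hc pr hz)).congr_of_eventuallyEq ?_
    exact (eventually_target hz).mono fun w hw ↦ chartDensity_couplingVolume h hc hpr hw τ
  ne_zero x h0 := by
    obtain ⟨φ, F, hc, hx⟩ := exists_isFoliatedChart 𝒱 x
    obtain ⟨z, hz, rfl⟩ := exists_coord hx
    obtain ⟨pr, hpr⟩ := exists_projection F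
    have h1 := chartDensity_couplingVolume (b := b) h hc hpr hz τ
    rw [chartDensity, h0] at h1
    exact mul_ne_zero (leafDensity_ne_zero h hc hz (hτ.ne_zero _))
      (modelVolume_ne_zero h hb hc hpr hz) h1.symm

/-- The vertical part of the modular vector field of the coupling volume form is the model modular
vector field of the leaf-tangent part. -/
theorem chartConn_chartModular (hb : ∀ x, (∀ u, ∀ v ∈ 𝒱.tangent x, b x u v = 0) ∧
      ∀ u, B.sharp x (b x u) = u - (h.connection x u : TangentSpace 𝓘(ℝ, E) x))
    (hc : IsFoliatedChart 𝒱 φ F) (hz : z ∈ φ.target) {τ : 𝒱.Form k} (hτ : 𝒱.IsLeafVolume τ) :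
    chartConn φ h z (chartModular φ B (couplingVolume h b τ) z)
      = modelModular (leafSharp (chartConn φ h) (chartSharp φ B))
        (fun w ↦ Real.log (leafDensity h hc τ w)) z := by
  obtain ⟨pr, hpr⟩ := exists_projection F
  have hev := (eventually_target hz).mono fun w hw ↦ couplingAt_chart h hc hw hb
  have hB := (contDiffAt_chartSharp B h.poisson hc.mem_atlas hz).differentiableAt (by simp)
  obtain ⟨hγ, hbs⟩ := contDiffAt_chartConn_chartFlat h hc hz hb
  refine conn_modelModular hev hB (hγ.differentiableAt (by simp)) fun α ↦ ?_
  have hρ : (fun w ↦ Real.log (chartDensity φ (couplingVolume h b τ) w)) =ᶠ[nhds z]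
      fun w ↦ Real.log (leafDensity h hc τ w) + Real.log (modelVolume h b hc pr w) := by
    filter_upwards [eventually_target hz] with w hw
    rw [chartDensity_couplingVolume h hc hpr hw, Real.log_mul
      (leafDensity_ne_zero h hc hw (hτ.ne_zero _)) (modelVolume_ne_zero h hb hc hpr hw)]
  have hK0 := modelVolume_ne_zero h hb hc hpr hz
  have hK := (contDiffAt_modelVolume h hb hc pr hz).differentiableAt (by simp)
  have hl := ((contDiffAt_leafDensity h hc hz hτ).log
    (leafDensity_ne_zero h hc hz (hτ.ne_zero _))).differentiableAt (by simp)
  have h1 := fderiv_couplingForm hev hB hγ hbs (chartSharp_alt B)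
    (jacobiAt_chartSharp B h.poisson hc.mem_atlas hz) α (hc.vol.compLinearMap pr.toLinearMap)
    ((finrank ℝ E - k) / 2) (finBasis ℝ E)
  change fderiv ℝ (modelVolume h b hc pr) z _ = _ * modelVolume h b hc pr z at h1
  rw [hρ.fderiv_eq, fderiv_fun_add hl (hK.log hK0), add_apply, fderiv.log hK hK0, smul_apply, h1,
    smul_eq_mul]
  field_simp

end CouplingVolume

/-! ### The foliated exterior derivative in a chart. -/

section ExteriorDerivative

set_option maxSynthPendingDepth 3

variable {E : Type*} [NormedAddCommGroup E] [NormedSpace ℝ E]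
  {M : Type*} [TopologicalSpace M] [ChartedSpace E M] [IsManifold 𝓘(ℝ, E) ∞ M]
  {φ : OpenPartialHomeomorph M E} {z : E}

theorem mdifferentiableAt_of_chart (hφ : φ ∈ IsManifold.maximalAtlas 𝓘(ℝ, E) ∞ M) (hz : z ∈ φ.target)
    {f : M → ℝ} (hf : DifferentiableAt ℝ (f ∘ φ.symm) z) :
    MDifferentiableAt 𝓘(ℝ, E) 𝓘(ℝ) f (φ.symm z) := by
  have h1 : MDifferentiableAt 𝓘(ℝ, E) 𝓘(ℝ) ((f ∘ φ.symm) ∘ φ) (φ.symm z) :=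
    MDifferentiableAt.comp (φ.symm z) (by rw [φ.right_inv hz]; exact hf.mdifferentiableAt)
      (mdifferentiableAt_chart hφ hz)
  refine h1.congr_of_eventuallyEq ?_
  filter_upwards [φ.eventually_left_inverse (φ.map_target hz)] with y hy
  simp [hy]

/-- A version of `dAt_chart` for the coefficients of a form that is only assumed differentiable at
the point. -/
theorem dAt_chart_of_differentiableAt (hφ : φ ∈ IsManifold.maximalAtlas 𝓘(ℝ, E) ∞ M)
    (hz : z ∈ φ.target) {f : M → ℝ} {g : E → ℝ} (hg : DifferentiableAt ℝ g z)
    (hfg : ∀ w ∈ φ.target, f (φ.symm w) = g w) (v : TangentSpace 𝓘(ℝ, E) (φ.symm z)) :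
    dAt E f (φ.symm z) v = fderiv ℝ g z (chartD φ z v) := by
  have h0 : f ∘ φ.symm =ᶠ[nhds z] g := (eventually_target hz).mono hfg
  have h1 := mfderiv_comp z (mdifferentiableAt_of_chart hφ hz (hg.congr_of_eventuallyEq h0))
    (mdifferentiableAt_chart_symm hφ hz)
  rw [mfderiv_eq_fderiv, h0.fderiv_eq] at h1
  refine Eq.trans ?_ (congrArg (fun L ↦ L (chartD φ z v)) h1).symm
  change _ = mfderiv 𝓘(ℝ, E) 𝓘(ℝ) f (φ.symm z) (chartI φ z (chartD φ z v))
  rw [chartI_chartD hφ hz]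
  rfl

variable [FiniteDimensional ℝ E] {k : ℕ} {𝒱 : RegularFoliation E M k}

/-- The foliated exterior derivative is computed in charts by the exterior derivative. -/
theorem extDeriv_chart (hφ : φ ∈ IsManifold.maximalAtlas 𝓘(ℝ, E) ∞ M) (hz : z ∈ φ.target) {m : ℕ}
    {β : 𝒱.Form m} {η : E → E [⋀^Fin m]→L[ℝ] ℝ} (hη : DifferentiableAt ℝ η z)
    (hβ : ∀ w ∈ φ.target, ∀ v : Fin m → 𝒱.tangent (φ.symm w),
      β (φ.symm w) v = η w (fun i ↦ chartD φ w (v i)))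
    (X : Fin (m + 1) → 𝒱.tangentFields) :
    𝒱.extDeriv m β X (φ.symm z)
      = _root_.extDeriv η z (fun i ↦ chartField φ (X i : VField E M) z) := by
  have hX : ∀ i, DifferentiableAt ℝ (chartField φ (X i : VField E M)) z := fun i ↦
    (contDiffAt_chartField hφ hz _).differentiableAt (by simp)
  rcases m with _ | m
  · rw [extDeriv_apply hη, RegularFoliation.extDeriv, Fin.sum_univ_one]
    simp only [Fin.val_zero, pow_zero, one_smul]
    refine dAt_chart_of_differentiableAt hφ hz
      (hη.continuousAlternatingMap_apply_const _) (fun w hw ↦ ?_) _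
    rw [hβ w hw]
    congr 1
    exact Subsingleton.elim _ _
  -- Both sides are now the formula with derivatives and brackets of vector fields, with the same
  -- index conventions, and are compared term by term.
  · rw [extDeriv_apply_vectorField hη hX, RegularFoliation.extDeriv]
    congr 1
    · refine Finset.sum_congr rfl fun i _ ↦ ?_
      rw [zsmul_eq_mul]
      push_cast
      congr 1
      refine dAt_chart_of_differentiableAt hφ hz ?_ (fun w hw ↦ hβ w hw _) _
      exact hη.continuousAlternatingMap_apply fun l ↦ hX (i.succAbove l)
    · refine Finset.sum_congr rfl fun i _ ↦ Finset.sum_congr rfl fun j _ ↦ ?_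
      rw [zsmul_eq_mul, hβ z hz]
      push_cast
      congr 2
      funext l
      refine Fin.cases ?_ (fun l ↦ ?_) l
      · exact chartD_mlieBracket hφ hz (X i.castSucc : VField E M).contMDiff
          (X j.succ : VField E M).contMDiff
      · rfl

end ExteriorDerivative

/-! ### The modular vector field of the Poisson foliation. -/

section LeafModular

set_option maxSynthPendingDepth 3

theorem modelModular_congr {E : Type*} [NormedAddCommGroup E] [NormedSpace ℝ E]
    [FiniteDimensional ℝ E] {P Q : E → (E →L[ℝ] ℝ) →L[ℝ] E} {z : E} (h : P =ᶠ[nhds z] Q)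
    (s : E → ℝ) : modelModular P s z = modelModular Q s z := by
  rw [modelModular, modelModular, h.fderiv_eq, h.self_of_nhds]

theorem modelModular_zero {E : Type*} [NormedAddCommGroup E] [NormedSpace ℝ E]
    [FiniteDimensional ℝ E] (s : E → ℝ) (z : E) :
    modelModular (fun _ ↦ (0 : (E →L[ℝ] ℝ) →L[ℝ] E)) s z = 0 := by
  simp [modelModular, ContinuousLinearMap.flip_zero]

/-- A bivector on a line vanishes. -/
theorem sharp_eq_zero_of_finrank_eq_one {V : Type*} [AddCommGroup V] [Module ℝ V]
    (hV : finrank ℝ V = 1) {S : Dual ℝ V →ₗ[ℝ] V} (hS : ∀ α : Dual ℝ V, α (S α) = 0) : S = 0 := by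
  obtain ⟨v, -, hv⟩ := finrank_eq_one_iff'.1 hV
  have key : ∀ α : Dual ℝ V, α v ≠ 0 → S α = 0 := by
    intro α hα
    obtain ⟨c, hc⟩ := hv (S α)
    have h1 := hS α
    rw [← hc, map_smul, smul_eq_mul] at h1
    rw [← hc, (mul_eq_zero.1 h1).resolve_right hα, zero_smul]
  ext α
  by_cases hα : α v = 0
  · have : α = 0 := by
      ext w
      obtain ⟨c, rfl⟩ := hv w
      simp [hα]
    simp [this]
  · exact key α hα

variable {E : Type*} [NormedAddCommGroup E] [NormedSpace ℝ E] [FiniteDimensional ℝ E]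
  {M : Type*} [TopologicalSpace M] [ChartedSpace E M] [IsManifold 𝓘(ℝ, E) ∞ M]
  {k : ℕ} {𝒱 : RegularFoliation E M k} {B : BivectorField E M}
  {φ : OpenPartialHomeomorph M E} {F : Submodule ℝ E} {z : E}

theorem contract_chart {m : ℕ} {𝒱 : RegularFoliation E M (m + 2)} (P : LeafBivector 𝒱)
    (hc : IsFoliatedChart 𝒱 φ F) (hz : z ∈ φ.target) {pr : E →L[ℝ] F} (hpr : ∀ v : F, pr v = v)
    {τ : (𝒱.tangent (φ.symm z)) [⋀^Fin (m + 2)]→ₗ[ℝ] ℝ} {σ : F [⋀^Fin (m + 2)]→ₗ[ℝ] ℝ}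
    (hτ : τ = σ.compLinearMap (hc.tangentEquiv hz).toLinearMap)
    (v : Fin m → 𝒱.tangent (φ.symm z)) :
    contract (P.sharp (φ.symm z)) τ v = toContAlt
      ((contract (restrictSharp pr (chartSharp φ P.toBivectorField z)) σ).compLinearMap
        pr.toLinearMap) (fun i ↦ chartD φ z (v i)) := by
  have h1 : ∀ u : 𝒱.tangent (φ.symm z), pr (chartD φ z u) = hc.tangentEquiv hz u := fun u ↦
    hpr (hc.tangentEquiv hz u)
  have h2 : (hc.tangentEquiv hz).toLinearMap ∘ₗ P.sharp (φ.symm z) ∘ₗ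
      (hc.tangentEquiv hz).toLinearMap.dualMap
      = restrictSharp pr (chartSharp φ P.toBivectorField z) := by
    refine LinearMap.ext fun ξ ↦ ?_
    rw [restrictSharp_apply, chartSharp_apply]
    refine Eq.trans ?_ (h1 _).symm
    refine congrArg (fun ζ ↦ hc.tangentEquiv hz (P.sharp (φ.symm z) ζ)) ?_
    ext u
    exact (congrArg ξ (h1 u)).symm
  rw [hτ, contract_conj, toContAlt_apply, AlternatingMap.compLinearMap_apply]
  rw [← h2]
  congr 1
  funext i
  exact (h1 (v i)).symm

theorem finrank_tangent (𝒱 : RegularFoliation E M k) (x : M) : finrank ℝ (𝒱.tangent x) = k := by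
  obtain ⟨φ, F, hc, hx⟩ := exists_isFoliatedChart 𝒱 x
  obtain ⟨z, hz, rfl⟩ := exists_coord hx
  rw [(hc.tangentEquiv hz).finrank_eq, hc.finrank_eq]

variable [T2Space M]

/-- The vertical part of the modular vector field of the coupling volume form is the modular vector
field of the leaf-tangent part. -/
theorem isModularField_verticalPart (h : IsCoupling 𝒱 B)
    {b : ∀ x : M, TangentSpace 𝓘(ℝ, E) x →ₗ[ℝ] Dual ℝ (TangentSpace 𝓘(ℝ, E) x)}
    (hb : ∀ x, (∀ u, ∀ v ∈ 𝒱.tangent x, b x u v = 0) ∧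
      ∀ u, B.sharp x (b x u) = u - (h.connection x u : TangentSpace 𝓘(ℝ, E) x))
    {τ : 𝒱.Form k} (hτ : 𝒱.IsLeafVolume τ) (Z : B.poiss)
    (hZ : ∀ φ ∈ IsManifold.maximalAtlas 𝓘(ℝ, E) ∞ M, ∀ z ∈ φ.target,
        chartField φ (Z : VField E M) z = chartModular φ B (couplingVolume h b τ) z) :
    h.leafPart.IsModularField τ (h.leafPart.toTangent (verticalMap h Z)) := by
  have key : ∀ {φ : OpenPartialHomeomorph M E} {F : Submodule ℝ E} (hc : IsFoliatedChart 𝒱 φ F)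
      {z : E}, z ∈ φ.target → chartField φ (verticalPart h Z) z
        = modelModular (chartSharp φ h.leafPart.toBivectorField)
          (fun w ↦ Real.log (leafDensity h hc τ w)) z := by
    intro φ F hc z hz
    refine (chartField_connection h hc.mem_atlas hz _).trans ?_
    rw [hZ φ hc.mem_atlas z hz, chartConn_chartModular h hb hc hz hτ]
    exact (modelModular_congr ((eventually_target hz).mono fun _ hw ↦
      chartSharp_leafPart h hc.mem_atlas hw) _).symm
  rcases k with _ | _ | m
  · exact trivial
  -- In rank one `P` vanishes, so its coordinate modular field is zero and the vertical field with
  -- it.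
  · intro x
    refine AlternatingMap.map_coord_zero _ 0 ?_
    obtain ⟨φ, F, hc, hx⟩ := exists_isFoliatedChart 𝒱 x
    obtain ⟨z, hz, rfl⟩ := exists_coord hx
    have h0 : chartSharp φ h.leafPart.toBivectorField = fun _ ↦ 0 := by
      funext w
      have h1 := sharp_eq_zero_of_finrank_eq_one (finrank_tangent 𝒱 (φ.symm w))
        (h.leafPart.alt (φ.symm w))
      ext α
      rw [chartSharp_apply]
      change chartD φ w ((h.leafPart.sharp (φ.symm w) _ : 𝒱.tangent (φ.symm w)) : TangentSpace 𝓘(ℝ, E) (φ.symm w)) = 0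
      rw [h1]
      exact map_zero _
    have h2 := key hc hz
    rw [h0, modelModular_zero] at h2
    refine (hc.tangentEquiv hz).injective (Subtype.ext ?_)
    rw [map_zero]
    exact h2
  · intro X x
    obtain ⟨φ, F, hc, hx⟩ := exists_isFoliatedChart 𝒱 x
    obtain ⟨z, hz, rfl⟩ := exists_coord hx
    obtain ⟨pr, hpr⟩ := exists_projection F
    have hd := (contDiffAt_leafDensity h hc hz hτ).differentiableAt (by simp)
    have hne := leafDensity_ne_zero h hc hz (hτ.ne_zero _)
    have hmem : ∀ w ∈ φ.target, ∀ α, chartSharp φ h.leafPart.toBivectorField w α ∈ F :=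
      fun w hw α ↦ (hc.mem_iff w hw _).1 (Submodule.coe_mem _)
    obtain ⟨h1, h2⟩ := extDeriv_contract hc.finrank_eq pr hpr
      ((contDiffAt_chartSharp_leafPart h hc hz).differentiableAt (by simp))
      (chartSharp_alt h.leafPart.toBivectorField) ((eventually_target hz).mono hmem) hd
      (s := fun w ↦ Real.log (leafDensity h hc τ w))
      (by rw [fderiv.log hd hne, smul_inv_smul₀ hne]) hc.vol
    rw [extDeriv_chart hc.mem_atlas hz h1 (fun w hw v ↦
      contract_chart h.leafPart hc hw hpr (leafForm_eq h hc hw τ) v)]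
    refine Eq.trans ?_ (congrArg Neg.neg
      (h2 fun i ↦ ⟨chartField φ (X i : VField E M) z, hc.chartField_mem hz (X i)⟩)).symm
    rw [leafForm_eq h hc hz τ, AlternatingMap.compLinearMap_apply]
    have h3 : pr (chartField φ (verticalPart h Z) z) = hc.tangentEquiv hz
        (𝒱.val (h.leafPart.toTangent (verticalMap h Z)) (φ.symm z)) :=
      hpr (hc.tangentEquiv hz (𝒱.val (h.leafPart.toTangent (verticalMap h Z)) (φ.symm z)))
    rw [← key hc hz, h3]
    rw [neg_neg]
    congr 1
    funext i
    refine Fin.cases rfl (fun i ↦ rfl) i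

theorem H1_mk_eq_of_sub_mem {Z Z' : B.poiss}
    (hZ : (Z' : VField E M) - Z ∈ B.hamFields) :
    BivectorField.H1.mk B Z' = BivectorField.H1.mk B Z :=
  (Submodule.Quotient.eq _).2 hZ

end LeafModular

end CouplingPoisson

end

open CouplingPoisson

/-- Let `𝒱` be an orientable regular foliation of a smooth manifold `M`, and `B` a `𝒱`-coupling
Poisson structure on `M` with connection `γ` and leaf-tangent part `P = B_{0,2}`. Then `(M, 𝒱, P)`
is a Poisson foliation, the modular classes of `(M, B)` and of `(M, 𝒱, P)` exist, `γ` induces a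
linear map `γ*` from the first Poisson cohomology of `(M, B)` to the first cohomology of
`(M, 𝒱, P)`, and `γ*` maps the first modular class to the second. -/
theorem corollary4p3 {E : Type*} [NormedAddCommGroup E] [NormedSpace ℝ E] [FiniteDimensional ℝ E]
    {M : Type*} [TopologicalSpace M] [ChartedSpace E M] [IsManifold 𝓘(ℝ, E) ∞ M]
    [T2Space M] [SigmaCompactSpace M] {k : ℕ}
    (𝒱 : CouplingPoisson.RegularFoliation E M k) (h𝒱 : 𝒱.IsOrientable)
    (B : CouplingPoisson.BivectorField E M) (hB : CouplingPoisson.IsCoupling 𝒱 B) :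
    hB.leafPart.IsPoissonFoliation ∧
    ∃ (modM : B.H1) (modV : hB.leafPart.H1) (γstar : B.H1 →ₗ[ℝ] hB.leafPart.H1),
      CouplingPoisson.IsModularClass B modM ∧
      hB.leafPart.IsModularClass modV ∧
      hB.IsInducedByConnection γstar ∧
      γstar modM = modV := by
  obtain ⟨b, hb⟩ := exists_flat hB
  obtain ⟨τ₀, hτ₀⟩ := h𝒱
  have hΩ₀ := isVolumeForm_couplingVolume hB hb hτ₀
  obtain ⟨Z₀, -, hZ₀, hc₀⟩ := exists_isModularField hB.poisson hΩ₀
  have key : ∀ Ω : TopForm E M, IsVolumeForm Ω → ∃ Z : B.poiss, IsModularField B Ω Z ∧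
      BivectorField.H1.mk B Z = BivectorField.H1.mk B ⟨Z₀, hZ₀⟩ ∧
      ∀ φ ∈ IsManifold.maximalAtlas 𝓘(ℝ, E) ∞ M, ∀ z ∈ φ.target,
        chartField φ (Z : VField E M) z = chartModular φ B Ω z := by
    intro Ω hΩ
    obtain ⟨Z, hZ, hZp, hc⟩ := exists_isModularField hB.poisson hΩ
    exact ⟨⟨Z, hZp⟩, hZ, H1_mk_eq_of_sub_mem (sub_mem_hamFields hΩ₀ hΩ hc₀ hc), hc⟩
  -- The open witness is the leaf-wise modular class; the final `rfl` sets it to the image of the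
  -- modular class of `M`.
  refine ⟨leafPart_isPoisson hB, BivectorField.H1.mk B ⟨Z₀, hZ₀⟩, _, verticalClass hB,
    ⟨⟨_, hΩ₀⟩, fun Ω hΩ ↦ ?_⟩, ⟨⟨τ₀, hτ₀⟩, fun τ hτ ↦ ?_⟩,
    fun X ↦ ⟨verticalMap hB X, fun x ↦ rfl, rfl⟩, rfl⟩
  · obtain ⟨Z, hZ, hZ', -⟩ := key Ω hΩ
    exact ⟨Z, hZ, hZ'⟩
  -- Each `τ` is treated with its own coupling volume form, whose modular field lies in the common
  -- class; independence of `τ` is thus inherited from independence of `Ω`.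
  · obtain ⟨Z, -, hZ', hc⟩ := key _ (isVolumeForm_couplingVolume hB hb hτ)
    refine ⟨verticalMap hB Z, isModularField_verticalPart hB hb hτ Z hc, ?_⟩
    rw [← verticalClass_mk, hZ']
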